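/- Let $N\ge 1$ and $\hbar>0$. Let $\gamma=(\gamma_{nj})_{1\le j\le n\le N-1}$ be variables and let $\gamma_N=(\gamma_{N1},\dots,\gamma_{NN})$ be a label. Put $$E_{nn}=\frac1{i\hbar}\Big(\sum_{j=1}^n\gamma_{nj}-\sum_{j=1}^{n-1}\gamma_{n-1,j}\Big)\quad(1\le n\le N),\qquad w'_N=1,$$ $$w_N=e^{-\frac{\pi}{\hbar}\sum_{n=1}^{N-1}(n-1)\sum_{j=1}^n\gamma_{nj}}\prod_{n=1}^{N-1}\prod_{k=1}^n\prod_{m=1}^{n+1}\hbar^{\frac{\gamma_{nk}-\gamma_{n+1,m}}{i\hbar}+\frac12}\,\Gamma\Big(\frac{\gamma_{nk}-\gamma_{n+1,m}}{i\hbar}+\frac12\Big),$$ $$\langle\phi,\chi\rangle=\int_{\mathbb R^{N(N-1)/2}}\mu_0(\gamma)\,\overline{\phi(\gamma)}\,\chi(\gamma)\,d\gamma,\qquad \mu_0(\gamma)=\prod_{n=2}^{N-1}\prod_{p<r}(\gamma_{np}-\gamma_{nr})\big(e^{2\pi\gamma_{np}/\hbar}-e^{2\pi\gamma_{nr}/\hbar}\big).$$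 With $\rho_k=\frac12(N-2k+1)$ and $x\in\mathbb R^N$ define $$\psi_{\gamma_N}(x)=e^{-x\cdot\rho}\,\big\langle w'_N,\;e^{-\sum_{k=1}^N x_kE_{kk}}\,w_N\big\rangle .$$ Let $p_n=-i\hbar\,\partial/\partial x_n$, and let $A_m(\lambda)$ be the upper left entry of the open Toda monodromy matrix $L_m(\lambda)\cdots L_1(\lambda)$, where $L_n(\lambda)=\begin{pmatrix}\lambda-p_n & e^{-x_n}\\ -e^{x_n}&0\end{pmatrix}$ (so $A_0=1$). Let $D=\{\gamma_N\in\mathbb C^N:\ \mathrm{Im}\,\gamma_{Nj}<\hbar/2 \text{ for all } j\}\supset\mathbb R^N$. **Theorem.** For every $\gamma_N\in D$ (in particular for every real $\gamma_N$) and every $x\in\mathbb R^N$ the integral defining $\psi_{\gamma_N}(x)$ converges absolutely. For fixed $x$ it is holomorphic in $\gamma_N\in D$, so that $e^{-i\hbar\partial_{\gamma_{Nj}}}$ acts as the translation $\gamma_{Nj}\mapsto\gamma_{Nj}-i\hbar$ of $D$ into itself; for fixed $\gamma_N\in D$ it is smooth in $x$. For every $\gamma_N\in D$: 1. $A_N(\lambda)\,\psi_{\gamma_N}(x)=\prod_{m=1}^N(\lambda-\gamma_{Nm})\,\psi_{\gamma_N}(x)$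 for all $\lambda\in\mathbb C$ and $x\in\mathbb R^N$; 2. $A_{N-1}(\gamma_{Nj})\,\psi_{\gamma_N}(x)=i^{1-N}e^{-x_N}e^{-i\hbar\partial_{\gamma_{Nj}}}\psi_{\gamma_N}(x)$ for $j=1,\dots,N$ and $x\in\mathbb R^N$; 3. (Mellin–Barnes representation) for all $x\in\mathbb R^N$, $$\psi_{\gamma_N}(x)=(2\pi\hbar)^{\binom N3}\int_{\mathcal C}\prod_{n=1}^{N-1}\frac{\prod_{k=1}^n\prod_{m=1}^{n+1}\hbar^{\frac{\gamma_{nk}-\gamma_{n+1,m}}{i\hbar}}\,\Gamma\big(\frac{\gamma_{nk}-\gamma_{n+1,m}}{i\hbar}\big)}{\prod_{s\ne p}\Gamma\big(\frac{\gamma_{ns}-\gamma_{np}}{i\hbar}\big)}\;e^{\frac i\hbar\sum_{n=1}^N\left(\sum_{j=1}^n\gamma_{nj}-\sum_{j=1}^{n-1}\gamma_{n-1,j}\right)x_n}\,d\gamma ,$$ where each $\gamma_{nj}$ $(1\le j\le n\le N-1)$ runs over a horizontal line $\mathbb R+ic_{nj}$; the integral converges absolutely and the formula holds for every choice of the real numbers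 $c_{nj}$ such that $\min_j\mathrm{Im}\,\gamma_{nj}>\max_m\mathrm{Im}\,\gamma_{n+1,m}$ for $n=1,\dots,N-1$. -/

import Mathlib

open scoped ContDiff

noncomputable section

namespace TodaGZ

/-! ### Gelfand-Zetlin variables -/

/-- Index set of the integration variables `γ_{nj}`, `1 ≤ n ≤ N - 1`, `1 ≤ j ≤ n`:
the level `n` carries the entries `j = 0, …, n - 1` (the level `n = 0` is empty).
It has `N (N - 1) / 2` elements. -/
abbrev GZIndex (N : ℕ) : Type := (n : Fin N) × Fin (n : ℕ)

/-- The triangular array with top level `a = (γ_{N1}, …, γ_{NN})` and lower levels `g`;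
`gzArray a g n j` is `γ_{n, j + 1}`, and it is `0` outside the triangle. -/
def gzArray {N : ℕ} (a : Fin N → ℂ) (g : GZIndex N → ℂ) (n j : ℕ) : ℂ :=
  if hn : n < N then
    if hj : j < n then g ⟨⟨n, hn⟩, ⟨j, hj⟩⟩ else 0
  else if hN : n = N ∧ j < N then a ⟨j, hN.2⟩ else 0

/-- The function by which `E_{kk}` acts by multiplication,
`(1 / iħ) (∑_{j ≤ k} γ_{kj} - ∑_{j ≤ k - 1} γ_{k-1,j})`;
the argument `k : Fin N` counts from zero. -/
def diagE {N : ℕ} (ħ : ℝ) (a : Fin N → ℂ) (k : Fin N) (g : GZIndex N → ℂ) : ℂ :=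
  (1 / (Complex.I * ħ)) *
    ((∑ j ∈ Finset.range ((k : ℕ) + 1), gzArray a g ((k : ℕ) + 1) j) -
      ∑ j ∈ Finset.range (k : ℕ), gzArray a g (k : ℕ) j)

/-- The action of the Cartan torus element `exp (- ∑ x_k E_{kk})` on functions. -/
def cartanTorus {N : ℕ} (ħ : ℝ) (a : Fin N → ℂ) (x : Fin N → ℝ)
    (φ : (GZIndex N → ℂ) → ℂ) : (GZIndex N → ℂ) → ℂ :=
  fun g => Complex.exp (-∑ k, (x k : ℂ) * diagE ħ a k g) * φ g

/-! ### Whittaker vectors and their pairing -/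

/-- The factor `s_n(γ_n, γ_{n+1})`. -/
def sFactor {N : ℕ} (ħ : ℝ) (a : Fin N → ℂ) (n : ℕ) (g : GZIndex N → ℂ) : ℂ :=
  ∏ k ∈ Finset.range n, ∏ m ∈ Finset.range (n + 1),
    (ħ : ℂ) ^ ((gzArray a g n k - gzArray a g (n + 1) m) / (Complex.I * ħ) + 1 / 2) *
      Complex.Gamma ((gzArray a g n k - gzArray a g (n + 1) m) / (Complex.I * ħ) + 1 / 2)

/-- The Whittaker vector `w_N`. -/
def whittaker {N : ℕ} (ħ : ℝ) (a : Fin N → ℂ) (g : GZIndex N → ℂ) : ℂ :=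
  Complex.exp (-(Real.pi / ħ : ℂ) *
      ∑ n ∈ Finset.Ico 1 N, ((n : ℂ) - 1) * ∑ j ∈ Finset.range n, gzArray a g n j) *
    ∏ n ∈ Finset.Ico 1 N, sFactor ħ a n g

/-- The dual Whittaker vector, the constant function `1`. -/
def whittakerDual (N : ℕ) : (GZIndex N → ℂ) → ℂ := fun _ => 1

/-- The density `μ₀`; it involves the levels `2, …, N - 1` only. -/
def mu0 {N : ℕ} (ħ : ℝ) (g : GZIndex N → ℂ) : ℂ :=
  ∏ n ∈ Finset.Ico 2 N, ∏ r ∈ Finset.range n, ∏ p ∈ Finset.range r,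
    ((gzArray 0 g n p - gzArray 0 g n r) *
      (Complex.exp (2 * Real.pi * gzArray 0 g n p / ħ) -
        Complex.exp (2 * Real.pi * gzArray 0 g n r / ħ)))

/-- The integrand `μ₀ · conj φ · ψ` of the pairing, on real points. -/
def pairingIntegrand {N : ℕ} (ħ : ℝ) (φ ψ : (GZIndex N → ℂ) → ℂ) (v : GZIndex N → ℝ) : ℂ :=
  mu0 ħ (fun i => (v i : ℂ)) * (starRingEnd ℂ) (φ fun i => (v i : ℂ)) * ψ (fun i => (v i : ℂ))

/-- The pairing `⟨φ, ψ⟩`, an integral over `ℝ^{N(N-1)/2}` with Lebesgue measure. -/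
def pairing {N : ℕ} (ħ : ℝ) (φ ψ : (GZIndex N → ℂ) → ℂ) : ℂ :=
  ∫ v : GZIndex N → ℝ, pairingIntegrand ħ φ ψ v

/-- `ρ^{(N)}_{k+1} = (N - 2 (k + 1) + 1) / 2`. -/
def rho (N : ℕ) (k : Fin N) : ℝ := ((N : ℝ) - 2 * ((k : ℕ) + 1 : ℝ) + 1) / 2

/-- The matrix element
`ψ_γ(x) = e^{-x·ρ} ⟨w'_N, e^{-∑ x_k E_{kk}} w_N⟩`, with `γ = a` allowed to be complex. -/
def psi {N : ℕ} (ħ : ℝ) (a : Fin N → ℂ) (x : Fin N → ℝ) : ℂ :=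
  Complex.exp (-((∑ k, x k * rho N k : ℝ) : ℂ)) *
    pairing ħ (whittakerDual N) (cartanTorus ħ a x (whittaker ħ a))

/-- The domain `Im γ_{Nj} < ħ / 2` for all `j`; it contains `ℝ^N` and is stable under
the translations `γ_{Nj} ↦ γ_{Nj} - iħ`. -/
def labelDomain (N : ℕ) (ħ : ℝ) : Set (Fin N → ℂ) := {a | ∀ j, (a j).im < ħ / 2}

/-! ### Open Toda chain: Lax operators and monodromy matrix -/

/-- Smooth complex-valued functions of `x = (x_1, …, x_N)`. -/
def SmoothFn (N : ℕ) : Submodule ℂ ((Fin N → ℝ) → ℂ) where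
  carrier := {f | ContDiff ℝ ∞ f}
  add_mem' := by
    intro f g (hf : ContDiff ℝ ∞ f) (hg : ContDiff ℝ ∞ g)
    exact hf.add hg
  zero_mem' := (contDiff_const : ContDiff ℝ ∞ fun _ : Fin N → ℝ => (0 : ℂ))
  smul_mem' := by
    intro c f (hf : ContDiff ℝ ∞ f)
    exact contDiff_const.mul hf

/-- The momentum `p_n = -iħ ∂/∂x_n`. -/
def momentum {N : ℕ} (ħ : ℝ) (n : Fin N) : Module.End ℂ (SmoothFn N) where
  toFun f := ⟨fun x => -Complex.I * ħ * fderiv ℝ (f : (Fin N → ℝ) → ℂ) x (Pi.single n 1), by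
    have hf : ContDiff ℝ ∞ (f : (Fin N → ℝ) → ℂ) := f.2
    exact contDiff_const.mul ((hf.fderiv_right (m := ∞) (by simp)).clm_apply contDiff_const)⟩
  map_add' f g := by
    have hf : ContDiff ℝ ∞ (f : (Fin N → ℝ) → ℂ) := f.2
    have hg : ContDiff ℝ ∞ (g : (Fin N → ℝ) → ℂ) := g.2
    ext x
    have h := fderiv_add (hf.differentiable (by simp) x) (hg.differentiable (by simp) x)
    simp only [Submodule.coe_add, Pi.add_apply, h, add_apply]
    ring
  map_smul' c f := by
    have hf : ContDiff ℝ ∞ (f : (Fin N → ℝ) → ℂ) := f.2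
    ext x
    have h := fderiv_const_smul (hf.differentiable (by simp) x) c
    simp only [Submodule.coe_smul, Pi.smul_apply, h, smul_apply,
      RingHom.id_apply, smul_eq_mul]
    ring

/-- Multiplication by `e^{c x_n}`. -/
def mulExp {N : ℕ} (c : ℝ) (n : Fin N) : Module.End ℂ (SmoothFn N) where
  toFun f := ⟨fun x => (Real.exp (c * x n) : ℂ) * (f : (Fin N → ℝ) → ℂ) x, by
    have hf : ContDiff ℝ ∞ (f : (Fin N → ℝ) → ℂ) := f.2
    exact (Complex.ofRealCLM.contDiff.comp
      (contDiff_const.mul (contDiff_apply ℝ ℝ n)).exp).mul hf⟩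
  map_add' f g := by ext x; simp [mul_add]
  map_smul' c f := by ext x; simp [mul_left_comm]

/-- The Lax operator `L_n(u)`, with rows `(u - p_n, e^{-x_n})` and `(-e^{x_n}, 0)`. -/
def lax {N : ℕ} (ħ : ℝ) (u : ℂ) (n : Fin N) :
    Matrix (Fin 2) (Fin 2) (Module.End ℂ (SmoothFn N)) :=
  !![u • (1 : Module.End ℂ (SmoothFn N)) - momentum ħ n, mulExp (-1) n;
     -mulExp 1 n, 0]

/-- The monodromy matrix `T_m(u) = L_m(u) ⋯ L_1(u)`, acting on functions of `x_1, …, x_N`. -/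
def monodromy {N : ℕ} (ħ : ℝ) (u : ℂ) :
    (m : ℕ) → m ≤ N → Matrix (Fin 2) (Fin 2) (Module.End ℂ (SmoothFn N))
  | 0, _ => 1
  | m + 1, hm => lax ħ u ⟨m, hm⟩ * monodromy ħ u m (Nat.le_of_succ_le hm)

/-- `A_m(u)`, the upper left entry of `T_m(u)`: the generating function of the Hamiltonians
of the `m`-particle open Toda chain. -/
def todaA {N : ℕ} (ħ : ℝ) (m : ℕ) (hm : m ≤ N) (u : ℂ) : Module.End ℂ (SmoothFn N) :=
  monodromy ħ u m hm 0 0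

/-! ### Mellin-Barnes integrals -/

/-- The Mellin-Barnes integrand. -/
def mellinBarnesIntegrand {N : ℕ} (ħ : ℝ) (a : Fin N → ℂ) (x : Fin N → ℝ)
    (g : GZIndex N → ℂ) : ℂ :=
  (∏ n ∈ Finset.Ico 1 N,
    (∏ k ∈ Finset.range n, ∏ m ∈ Finset.range (n + 1),
      (ħ : ℂ) ^ ((gzArray a g n k - gzArray a g (n + 1) m) / (Complex.I * ħ)) *
        Complex.Gamma ((gzArray a g n k - gzArray a g (n + 1) m) / (Complex.I * ħ))) /
    ∏ s ∈ Finset.range n, ∏ p ∈ (Finset.range n).erase s,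
      Complex.Gamma ((gzArray a g n s - gzArray a g n p) / (Complex.I * ħ))) *
  Complex.exp (Complex.I / ħ *
    ∑ n : Fin N, ((∑ j ∈ Finset.range ((n : ℕ) + 1), gzArray a g ((n : ℕ) + 1) j) -
      ∑ j ∈ Finset.range (n : ℕ), gzArray a g (n : ℕ) j) * (x n : ℂ))

/-- The imaginary parts `c` of the lines of integration are admissible if
`min_j Im γ_{nj} > max_m Im γ_{n+1,m}` for `n = 1, …, N - 1`, the top level being `a`. -/
def AdmissibleHeights {N : ℕ} (a : Fin N → ℂ) (c : GZIndex N → ℝ) : Prop :=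
  ∀ n < N, ∀ j < n, ∀ m < n + 1,
    (gzArray a (fun i => (c i : ℂ) * Complex.I) (n + 1) m).im <
      (gzArray a (fun i => (c i : ℂ) * Complex.I) n j).im

end TodaGZ

end

/-! On the contour with level `n` at height `ħ (N - n) / 2`, the integrand of the pairing, times
`e^{-x·ρ}`, is the Mellin-Barnes integrand times `(2πħ)^{N choose 3}`. Adjacent levels differ by `ħ
/ 2`, which produces the `1/2` in the Gamma arguments. The density `μ₀` is, up to exponentials, the
product of the `1 / (Γ(w) Γ(-w))` by the reflection formula, and these exponentials cancel the
prefactor of `w_N`. This is `psi_eq_integral_kernel`.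

Convergence is a competition: each cross factor decays like `exp(-(π/2ħ)|Δ|)`, each pair within a
level grows like `exp((π/ħ)|Δ|)`. The net rate is `π/2ħ` times `decayRate`, half the sum of the
energy distances between adjacent levels plus the pair sum of the top level. The energy distance of
`n` reals and `n + 1` reals is nonnegative and controls how far the smaller family sticks out of the
larger one (`crossEnergy_lower`), so with the top level bounded the rate dominates every variable.
The resulting exponential decay, locally uniform in the imaginary parts, gives absolute convergence,
holomorphy in the label, differentiation under the integral and independence of the contour
(`integral_tube_shift`).

For the Toda equations, `p_n` acts under the integral as multiplication by the difference of two
level sums. The claim is that `A_m(u)` acts as multiplication by `∏ (u - γ_{mk})`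
(`todaA_smoothMoment`). By the three-term recursion of the `A_m` this amounts to one relation
between integrals of three consecutive level polynomials (`moment_levelPoly_add_two`). Lagrange
interpolation at the entries of the middle level turns its two sides into sums over `j` of integrals
of the same regularized kernel, on contours that differ by lowering `γ_{n+1,j}` by `ħ`; the
regularization removes the only poles in between.

At `m = N` the level polynomial is constant in the integration variables, which gives the eigenvalue
equation. At `m = N - 1` and `u = γ_{Nj}` it is the factor the kernel acquires under `γ_{Nj} ↦
γ_{Nj} - iħ`, which gives the second equation. -/

noncomputable section

/-! ### Energy inequalities for triangular arrays of reals -/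

namespace TodaGZ

open Finset

/-- Twice the energy-distance of two finite families of reals. -/
def crossEnergy (S T : Finset ℕ) (x y : ℕ → ℝ) : ℝ :=
  2 * ∑ i ∈ S, ∑ j ∈ T, |x i - y j| - ∑ i ∈ S, ∑ j ∈ S, |x i - x j| - ∑ i ∈ T, ∑ j ∈ T, |y i - y j|

theorem sum_sum_insert_symm (S : Finset ℕ) (i : ℕ) (hi : i ∉ S) (x : ℕ → ℝ) :
    ∑ a ∈ insert i S, ∑ b ∈ insert i S, |x a - x b| =
      2 * ∑ a ∈ S, |x i - x a| + ∑ a ∈ S, ∑ b ∈ S, |x a - x b| := by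
  simp only [sum_insert hi, sum_add_distrib, sub_self, abs_zero, abs_sub_comm (x i)]
  ring

/-- Induction by removing the maximum of each family. Removing both changes the energy by at least
`4 max(d, 0)`, where `d` is the difference of the maxima. The surplus element of `T` is what makes
the linear terms add up to `+2d`. -/
theorem crossEnergy_lower (n : ℕ) : ∀ (S T : Finset ℕ) (x y : ℕ → ℝ), #S = n → #T = n + 1 →
    0 ≤ crossEnergy S T x y ∧ ∀ i ∈ S, ∃ j ∈ T, 4 * (x i - y j) ≤ crossEnergy S T x y := by
  induction n with
  | zero =>
    intro S T x y hS hT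
    obtain rfl := card_eq_zero.1 hS
    obtain ⟨j, rfl⟩ := card_eq_one.1 hT
    simp [crossEnergy]
  | succ n ih =>
    intro S T x y hS hT
    obtain ⟨i, hi, hmi⟩ := exists_max_image S x (card_pos.1 (by omega))
    obtain ⟨j, hj, hmj⟩ := exists_max_image T y (card_pos.1 (by omega))
    obtain ⟨S, hiS, rfl⟩ : ∃ S', i ∉ S' ∧ S = insert i S' :=
      ⟨S.erase i, notMem_erase _ _, (insert_erase hi).symm⟩
    obtain ⟨T, hjT, rfl⟩ : ∃ T', j ∉ T' ∧ T = insert j T' :=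
      ⟨T.erase j, notMem_erase _ _, (insert_erase hj).symm⟩
    rw [card_insert_of_notMem hiS] at hS
    rw [card_insert_of_notMem hjT] at hT
    have hS' : #S = n := by omega
    have hT' : #T = n + 1 := by omega
    have h0 := (ih S T x y hS' hT').1
    have key : crossEnergy (insert i S) (insert j T) x y = crossEnergy S T x y +
        2 * |x i - y j| + 2 * ∑ b ∈ T, (|x i - y b| - |y j - y b|) +
        2 * ∑ a ∈ S, (|x a - y j| - |x i - x a|) := by
      rw [crossEnergy, sum_sum_insert_symm S i hiS, sum_sum_insert_symm T j hjT, crossEnergy]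
      simp only [sum_insert hiS, sum_insert hjT, sum_add_distrib, sum_sub_distrib]
      ring
    have e1 : ∀ b ∈ T, |y j - y b| = y j - y b := fun b hb =>
      abs_of_nonneg (sub_nonneg.2 (hmj b (mem_insert_of_mem hb)))
    have e2 : ∀ a ∈ S, |x i - x a| = x i - x a := fun a ha =>
      abs_of_nonneg (sub_nonneg.2 (hmi a (mem_insert_of_mem ha)))
    have s1 : (n + 1 : ℝ) * (x i - y j) ≤ ∑ b ∈ T, (|x i - y b| - |y j - y b|) := by
      have : ∑ b ∈ T, (x i - y j) ≤ ∑ b ∈ T, (|x i - y b| - |y j - y b|) := by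
        refine sum_le_sum fun b hb => ?_
        rw [e1 b hb]
        linarith [le_abs_self (x i - y b)]
      simpa only [sum_const, hT', nsmul_eq_mul, Nat.cast_add, Nat.cast_one] using this
    have s2 : (n : ℝ) * (y j - x i) ≤ ∑ a ∈ S, (|x a - y j| - |x i - x a|) := by
      have : ∑ a ∈ S, (y j - x i) ≤ ∑ a ∈ S, (|x a - y j| - |x i - x a|) := by
        refine sum_le_sum fun a ha => ?_
        rw [e2 a ha]
        linarith [neg_abs_le (x a - y j)]
      simpa only [sum_const, hS', nsmul_eq_mul] using this
    -- With `d = x i - y j`, the increment in `key` is at least `2|d| + 2(n+1)d - 2nd = 2|d| + 2d`.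
    have hmax : 4 * max (x i - y j) 0 ≤ crossEnergy (insert i S) (insert j T) x y := by
      rcases le_total (y j) (x i) with h | h
      · rw [max_eq_left (by linarith)]
        linarith [le_abs_self (x i - y j)]
      · rw [max_eq_right (by linarith)]
        linarith [neg_abs_le (x i - y j)]
    refine ⟨le_trans (by positivity) hmax, fun a ha => ⟨j, mem_insert_self _ _, ?_⟩⟩
    have := hmi a ha
    linarith [le_max_left (x i - y j) 0]

/-- The energy is invariant under reflection of the line. -/
theorem crossEnergy_lower_neg {n : ℕ} {S T : Finset ℕ} (x y : ℕ → ℝ) (hS : #S = n)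
    (hT : #T = n + 1) : ∀ i ∈ S, ∃ j ∈ T, 4 * (y j - x i) ≤ crossEnergy S T x y := by
  intro i hi
  obtain ⟨j, hj, h⟩ := (crossEnergy_lower n S T (-x) (-y) hS hT).2 i hi
  refine ⟨j, hj, ?_⟩
  have : crossEnergy S T (-x) (-y) = crossEnergy S T x y := by
    simp [crossEnergy, neg_add_eq_sub, abs_sub_comm]
  rw [this] at h
  simp only [Pi.neg_apply] at h
  linarith

/-- The sum of the distances within a level. -/
def pairSum (n : ℕ) (x : ℕ → ℝ) : ℝ := ∑ r ∈ range n, ∑ p ∈ range r, |x p - x r|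

/-- The sum of the distances between two adjacent levels. -/
def crossSum (n : ℕ) (x y : ℕ → ℝ) : ℝ := ∑ k ∈ range n, ∑ m ∈ range (n + 1), |x k - y m|

theorem sum_range_range_eq_two_mul_pairSum (n : ℕ) (x : ℕ → ℝ) :
    ∑ i ∈ range n, ∑ j ∈ range n, |x i - x j| = 2 * pairSum n x := by
  induction n with
  | zero => simp [pairSum]
  | succ n ih =>
    rw [range_add_one, sum_sum_insert_symm _ _ notMem_range_self, ih]
    simp only [pairSum, sum_range_succ _ n, abs_sub_comm (x n)]
    ring

theorem crossEnergy_range (n : ℕ) (x y : ℕ → ℝ) :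
    crossEnergy (range n) (range (n + 1)) x y =
      2 * (crossSum n x y - pairSum n x - pairSum (n + 1) y) := by
  simp only [crossEnergy, sum_range_range_eq_two_mul_pairSum, crossSum]
  ring

/-- The decay rate controlling the Mellin-Barnes integrand. -/
def decayRate (N : ℕ) (u : ℕ → ℕ → ℝ) : ℝ :=
  ∑ n ∈ Ico 1 N, crossSum n (u n) (u (n + 1)) - 2 * ∑ n ∈ Ico 2 N, pairSum n (u n)

/-- Each intermediate level is the lower member of one adjacent pair and the upper member of
another, so its pair sum is counted twice; the top level is counted once and level `1` has no pairs.
-/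
theorem sum_crossEnergy (N : ℕ) (hN : 1 ≤ N) (u : ℕ → ℕ → ℝ) :
    ∑ n ∈ Ico 1 N, crossEnergy (range n) (range (n + 1)) (u n) (u (n + 1)) =
      2 * (decayRate N u - pairSum N (u N)) := by
  induction N, hN using Nat.le_induction with
  | base => simp [decayRate, pairSum]
  | succ N hN ih =>
    rw [sum_Ico_succ_top hN, ih, crossEnergy_range, decayRate, decayRate, sum_Ico_succ_top hN]
    rcases eq_or_lt_of_le hN with rfl | h
    · simp [pairSum]
    · rw [sum_Ico_succ_top (show 2 ≤ N from h)]
      ring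

theorem pairSum_nonneg (n : ℕ) (x : ℕ → ℝ) : 0 ≤ pairSum n x :=
  sum_nonneg fun _ _ => sum_nonneg fun _ _ => abs_nonneg _

theorem decayRate_nonneg {N : ℕ} (hN : 1 ≤ N) (u : ℕ → ℕ → ℝ) : 0 ≤ decayRate N u := by
  have h := sum_crossEnergy N hN u
  have h2 : 0 ≤ ∑ n ∈ Ico 1 N, crossEnergy (range n) (range (n + 1)) (u n) (u (n + 1)) :=
    sum_nonneg fun n _ => (crossEnergy_lower n _ _ _ _ (card_range n) (card_range _)).1
  linarith [pairSum_nonneg N (u N)]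

/-- Descending from the top, each level exceeds the range of the one above it by at most a quarter
of their cross energy. The energies are nonnegative, so the accumulated sum is at most the full one.
-/
theorem abs_le_decayRate {N : ℕ} (hN : 1 ≤ N) (u : ℕ → ℕ → ℝ) {R : ℝ}
    (hR : ∀ j < N, |u N j| ≤ R) {n k : ℕ} (hn : n ≤ N) (hn0 : 1 ≤ n) (hk : k < n) :
    2 * |u n k| ≤ 2 * R + decayRate N u := by
  have chain : ∀ d n, n + d = N → 1 ≤ n → ∀ k < n, 4 * |u n k| ≤ 4 * R +
      ∑ i ∈ Ico n N, crossEnergy (range i) (range (i + 1)) (u i) (u (i + 1)) := by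
    intro d
    induction d with
    | zero =>
      rintro n rfl - k hk
      simpa using hR k hk
    | succ d ih =>
      intro n hn hn0 k hk
      have hnN : n < N := by omega
      rw [sum_eq_sum_Ico_succ_bot hnN]
      obtain ⟨j, hj, h1⟩ := (crossEnergy_lower n (range n) (range (n + 1)) (u n) (u (n + 1))
        (card_range n) (card_range _)).2 k (mem_range.2 hk)
      obtain ⟨l, hl, h2⟩ := crossEnergy_lower_neg (S := range n) (T := range (n + 1)) (u n)
        (u (n + 1)) (card_range n) (card_range _) k (mem_range.2 hk)
      have h3 := ih (n + 1) (by omega) (by omega) j (mem_range.1 hj)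
      have h4 := ih (n + 1) (by omega) (by omega) l (mem_range.1 hl)
      have := le_abs_self (u (n + 1) j)
      have := neg_abs_le (u (n + 1) l)
      rcases abs_cases (u n k) with ⟨h, -⟩ | ⟨h, -⟩ <;> rw [h] <;> linarith
  have h1 := chain (N - n) n (by omega) hn0 k hk
  have h2 : ∑ i ∈ Ico n N, crossEnergy (range i) (range (i + 1)) (u i) (u (i + 1)) ≤
      ∑ i ∈ Ico 1 N, crossEnergy (range i) (range (i + 1)) (u i) (u (i + 1)) :=
    sum_le_sum_of_subset_of_nonneg (Ico_subset_Ico_left hn0)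
      fun i _ _ => (crossEnergy_lower i _ _ _ _ (card_range i) (card_range _)).1
  rw [sum_crossEnergy N hN] at h2
  linarith [pairSum_nonneg N (u N)]

end TodaGZ

end

/-! ### Holomorphic parameter integrals and contour shifts in tubes -/

noncomputable section

namespace TodaGZ

open MeasureTheory Filter Topology Metric Set

theorem integrable_exp_neg_mul_sum_abs {ι : Type*} [Fintype ι] {δ : ℝ} (hδ : 0 < δ) :
    Integrable (fun v : ι → ℝ => Real.exp (-δ * ∑ i, |v i|)) := by
  have h1 : Integrable (fun t : ℝ => Real.exp (-δ * |t|)) := by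
    rw [← integrableOn_univ, ← Iic_union_Ioi (a := (0 : ℝ)), integrableOn_union]
    constructor
    · refine (integrableOn_exp_mul_Iic hδ 0).congr_fun (fun t ht => ?_) measurableSet_Iic
      simp [abs_of_nonpos (mem_Iic.1 ht)]
    · refine (integrableOn_exp_mul_Ioi (neg_lt_zero.2 hδ) 0).congr_fun (fun t ht => ?_)
        measurableSet_Ioi
      simp [abs_of_pos (mem_Ioi.1 ht)]
  have := Integrable.fintype_prod (ι := ι) (f := fun _ t => Real.exp (-δ * |t|)) (fun _ => h1)
  refine this.congr (ae_of_all _ fun v => ?_)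
  simp [← Real.exp_sum, Finset.mul_sum]

/-- A parameter integral is holomorphic if the integrand is, and is locally dominated. -/
theorem differentiableOn_integral_of_locally_dominated {E : Type*} [NormedAddCommGroup E]
    [NormedSpace ℂ E] [FiniteDimensional ℂ E] {α : Type*} [MeasurableSpace α] {μ : Measure α}
    {f : E → α → ℂ} {U : Set E} (hU : IsOpen U)
    (hd : ∀ v, DifferentiableOn ℂ (fun a => f a v) U)
    (hm : ∀ a ∈ U, AEStronglyMeasurable (f a) μ)
    (hb : ∀ a ∈ U, ∃ r > 0, ∃ g : α → ℝ, Integrable g μ ∧ ∀ᵐ v ∂μ, ∀ b ∈ ball a r, ‖f b v‖ ≤ g v) :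
    DifferentiableOn ℂ (fun a => ∫ v, f a v ∂μ) U := by
  intro a ha
  obtain ⟨r₁, hr₁, g, hg, hfg⟩ := hb a ha
  obtain ⟨r₂, hr₂, hr₂U⟩ := Metric.isOpen_iff.1 hU a ha
  set r := min r₁ r₂ with hrdef
  have hr : 0 < r := lt_min hr₁ hr₂
  have hrU : ball a r ⊆ U := (ball_subset_ball (min_le_right _ _)).trans hr₂U
  have hda : ∀ v, ∀ b ∈ U, DifferentiableAt ℂ (fun a => f a v) b := fun v b hbU =>
    (hd v).differentiableAt (hU.mem_nhds hbU)
  -- Directional derivatives are limits of measurable difference quotients; a basis of `E` assembles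
  -- them into the full derivative.
  have hmeas : AEStronglyMeasurable (fun v => fderiv ℂ (fun a => f a v) a) μ := by
    have hdir : ∀ w : E, AEStronglyMeasurable (fun v => fderiv ℂ (fun a => f a v) a w) μ := by
      intro w
      have hc : Tendsto (fun n : ℕ => ‖((n + 1 : ℕ) : ℂ)‖) atTop atTop := by
        simp only [Complex.norm_natCast]
        exact tendsto_natCast_atTop_atTop.comp (tendsto_add_atTop_nat 1)
      have hlim : Tendsto (fun n : ℕ => a + ((n + 1 : ℕ) : ℂ)⁻¹ • w) atTop (𝓝 a) := by
        have h1 := tendsto_inv₀_cobounded.comp (tendsto_norm_atTop_iff_cobounded.1 hc)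
        simpa using (h1.smul_const w).const_add a
      obtain ⟨n₀, hn₀⟩ := eventually_atTop.1 (hlim.eventually (hU.mem_nhds ha))
      refine aestronglyMeasurable_of_tendsto_ae atTop
        (f := fun n : ℕ => fun v => ((n + n₀ + 1 : ℕ) : ℂ) •
          (f (a + ((n + n₀ + 1 : ℕ) : ℂ)⁻¹ • w) v - f a v)) (fun n => ?_)
        (ae_of_all _ fun v => ?_)
      · have h1 : AEStronglyMeasurable (fun v => f (a + ((n + n₀ + 1 : ℕ) : ℂ)⁻¹ • w) v - f a v) μ :=
          (hm _ (hn₀ (n + n₀) (by omega))).sub (hm a ha)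
        exact h1.const_smul ((n + n₀ + 1 : ℕ) : ℂ)
      · exact ((hda v a ha).hasFDerivAt.lim w hc).comp (tendsto_add_atTop_nat n₀)
    obtain ⟨n, ⟨e⟩⟩ : ∃ n, Nonempty (Module.Basis (Fin n) ℂ E) :=
      ⟨_, ⟨Module.finBasis ℂ E⟩⟩
    have : (fun v => fderiv ℂ (fun a => f a v) a) = fun v => ∑ i,
        (fderiv ℂ (fun a => f a v) a (e i)) • (LinearMap.toContinuousLinearMap (e.coord i)) := by
      ext v w
      conv_lhs => rw [← e.sum_repr w, map_sum]
      simp [-Module.Basis.sum_repr, mul_comm]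
    rw [this]
    exact Finset.aestronglyMeasurable_fun_sum _ fun i _ => (hdir (e i)).smul_const _
  -- Cauchy estimate on balls of radius `r / 2`: the domination of `f` also dominates its
  -- derivative.
  have hbound : ∀ᵐ v ∂μ, ∀ b ∈ ball a (r / 2),
      ‖fderiv ℂ (fun a => f a v) b‖ ≤ (2 * g v) / (r / 2) := by
    filter_upwards [hfg] with v hv b hb
    have hsub : ball b (r / 2) ⊆ ball a r := by
      refine ball_subset_ball' ?_
      have := mem_ball.1 hb
      linarith
    refine Complex.norm_fderiv_le_div_of_mapsTo_ball ((hd v).mono (hsub.trans hrU)) ?_ (by positivity)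
    intro c hc
    have h1 := hv c (ball_subset_ball (min_le_left _ _) (hsub hc))
    have h2 := hv b (ball_subset_ball (min_le_left _ _) (ball_subset_ball (half_le_self hr.le) hb))
    rw [mem_closedBall, dist_eq_norm]
    exact (norm_sub_le _ _).trans (by linarith)
  refine (hasFDerivAt_integral_of_dominated_of_fderiv_le (𝕜 := ℂ) (ball_mem_nhds a (half_pos hr))
    (F' := fun b v => fderiv ℂ (fun a => f a v) b)
    ?_ ?_ hmeas hbound ((hg.const_mul 2).div_const _) ?_).differentiableAt.differentiableWithinAt
  · exact (hU.eventually_mem ha).mono fun b hb => hm b hb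
  · refine hg.mono' (hm a ha) ?_
    filter_upwards [hfg] with v hv using hv a (mem_ball_self hr₁)
  · exact ae_of_all _ fun v b hb => (hda v b
      (hrU (ball_subset_ball (by linarith) hb))).hasFDerivAt

/-- Exponential decay in the real directions, locally uniformly in the imaginary parts. -/
def TubeDecay {ι : Type*} [Fintype ι] (F : (ι → ℂ) → ℂ) (U : Set (ι → ℝ)) : Prop :=
  ∀ y ∈ U, ∃ r > 0, ∃ C δ : ℝ, 0 < δ ∧ ∀ z : ι → ℂ, (fun i => (z i).im) ∈ ball y r →
    ‖F z‖ ≤ C * Real.exp (-δ * ∑ i, |(z i).re|)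

variable {ι : Type*} [Fintype ι] {F : (ι → ℂ) → ℂ} {U : Set (ι → ℝ)}

omit [Fintype ι] in
theorem continuous_tube_slice
    (hd : ∀ z : ι → ℂ, (fun i => (z i).im) ∈ U → DifferentiableAt ℂ F z) {w : ι → ℂ}
    (hw : (fun i => (w i).im) ∈ U) : Continuous (fun v : ι → ℝ => F (fun i => v i + w i)) := by
  refine continuous_iff_continuousAt.2 fun v => ?_
  have h1 : ContinuousAt F (fun i => v i + w i) := (hd _ (by simpa using hw)).continuousAt
  have h2 : Continuous (fun v : ι → ℝ => fun i => (v i + w i : ℂ)) := by fun_prop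
  exact ContinuousAt.comp (f := fun v : ι → ℝ => fun i => (v i + w i : ℂ)) h1 h2.continuousAt

theorem integrable_tube_slice
    (hd : ∀ z : ι → ℂ, (fun i => (z i).im) ∈ U → DifferentiableAt ℂ F z) (hF : TubeDecay F U)
    {c : ι → ℝ} (hc : c ∈ U) :
    Integrable (fun v : ι → ℝ => F (fun i => v i + c i * Complex.I)) := by
  obtain ⟨r, hr, C, δ, hδ, hb⟩ := hF c hc
  refine ((integrable_exp_neg_mul_sum_abs hδ).const_mul C).mono'
    (continuous_tube_slice hd (w := fun i => c i * Complex.I) (by simpa using hc)).aestronglyMeasurable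
    (ae_of_all _ fun v => ?_)
  simpa using hb (fun i => v i + c i * Complex.I) (by simpa using hr)

/-- Contour shift: integrals over real slices of a tube agree. -/
theorem integral_tube_shift (hU : IsOpen U) (hconv : Convex ℝ U)
    (hd : ∀ z : ι → ℂ, (fun i => (z i).im) ∈ U → DifferentiableAt ℂ F z) (hF : TubeDecay F U)
    {c c' : ι → ℝ} (hc : c ∈ U) (hc' : c' ∈ U) :
    ∫ v : ι → ℝ, F (fun i => v i + c i * Complex.I) =
      ∫ v : ι → ℝ, F (fun i => v i + c' i * Complex.I) := by
  -- A single complex parameter joins the two slices: `s = 0` gives height `c` and `s = I` gives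
  -- height `c'`.
  set w : ℂ → ι → ℂ := fun s i => s * (c' i - c i : ℝ) + c i * Complex.I with hwdef
  set f : ℂ → (ι → ℝ) → ℂ := fun s v => F (fun i => v i + w s i) with hf
  set im' : ℂ → ι → ℝ := fun s i => s.im * (c' i - c i) + c i with him'
  have him : ∀ s, (fun i => (w s i).im) = im' s := fun s => by
    ext i; simp [hwdef, him']
  have hcont : Continuous im' := by
    simp only [him']
    refine continuous_pi fun i => ?_
    exact (Complex.continuous_im.mul continuous_const).add continuous_const
  set V : Set ℂ := im' ⁻¹' U with hV
  have hVo : IsOpen V := hU.preimage hcont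
  have hVc : Convex ℝ V := by
    intro s hs t ht p q hp hq hpq
    have : im' (p • s + q • t) = p • im' s + q • im' t := by
      ext i
      simp only [him', Complex.add_im, Complex.smul_im, smul_eq_mul, Pi.add_apply, Pi.smul_apply]
      linear_combination -hpq * c i
    rw [hV, mem_preimage, this]
    exact hconv hs ht hp hq hpq
  have hdiff : DifferentiableOn ℂ (fun s => ∫ v, f s v) V := by
    refine differentiableOn_integral_of_locally_dominated hVo (fun v s hs => ?_) (fun s hs => ?_)
      (fun s hs => ?_)
    · have h1 : DifferentiableAt ℂ F (fun i => v i + w s i) := by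
        refine hd _ ?_
        have : (fun i => ((v i : ℂ) + w s i).im) = im' s := by rw [← him]; ext i; simp
        rw [this]; exact hs
      have h2 : DifferentiableAt ℂ (fun s : ℂ => fun i => (v i : ℂ) + w s i) s := by
        rw [differentiableAt_pi]
        intro i
        simp only [hwdef]
        fun_prop
      exact (DifferentiableAt.comp s h1 h2).differentiableWithinAt
    · exact (continuous_tube_slice hd (by rw [him]; exact hs)).aestronglyMeasurable
    · obtain ⟨r, hr, C, δ, hδ, hb⟩ := hF (im' s) hs
      obtain ⟨r', hr', hsub⟩ := Metric.isOpen_iff.1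
        ((isOpen_ball (x := im' s) (ε := r)).preimage hcont) s (mem_ball_self hr)
      have hC : 0 ≤ C := by
        have := (norm_nonneg _).trans (hb (w s) (by rw [him]; exact mem_ball_self hr))
        exact nonneg_of_mul_nonneg_left this (Real.exp_pos _)
      refine ⟨r', hr', fun v => C * Real.exp (δ * ((|s.re| + r') * ∑ i, |c' i - c i|)) *
        Real.exp (-δ * ∑ i, |v i|), (integrable_exp_neg_mul_sum_abs hδ).const_mul _,
        ae_of_all _ fun v t ht => ?_⟩
      have h1 := hb (fun i => v i + w t i) (by
        have : (fun i => ((v i : ℂ) + w t i).im) = im' t := by rw [← him]; ext i; simp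
        rw [this]; exact hsub ht)
      refine h1.trans ?_
      beta_reduce
      rw [mul_assoc, ← Real.exp_add]
      refine mul_le_mul_of_nonneg_left (Real.exp_le_exp.2 ?_) hC
      have hre : |t.re| ≤ |s.re| + r' := by
        have h2 : |(t - s).re| ≤ r' := (Complex.abs_re_le_norm _).trans
          (by rw [← dist_eq_norm]; exact (mem_ball.1 ht).le)
        rw [Complex.sub_re] at h2
        linarith [abs_sub_abs_le_abs_sub t.re s.re]
      have h3 : ∑ i, |v i| ≤ ∑ i, |((v i : ℂ) + w t i).re| + (|s.re| + r') * ∑ i, |c' i - c i| := by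
        rw [Finset.mul_sum, ← Finset.sum_add_distrib]
        refine Finset.sum_le_sum fun i _ => ?_
        have : ((v i : ℂ) + w t i).re = v i + t.re * (c' i - c i) := by simp [hwdef]
        rw [this]
        have h4 := abs_sub_abs_le_abs_sub (v i) (-(t.re * (c' i - c i)))
        rw [abs_neg, sub_neg_eq_add, abs_mul] at h4
        nlinarith [abs_nonneg (c' i - c i)]
      nlinarith
  -- A real change of `s` is a translation of `v`, which Lebesgue measure does not see. The
  -- holomorphic function of `s` therefore has vanishing derivative and is constant on the convex
  -- set `V`.
  have htrans : ∀ (s : ℂ) (t : ℝ), ∫ v, f (s + t) v = ∫ v, f s v := by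
    intro s t
    rw [← integral_add_right_eq_self (f s) (fun i => t * (c' i - c i))]
    refine integral_congr_ae (ae_of_all _ fun v => ?_)
    simp only [hf, hwdef]
    congr 1
    ext i
    simp only [Pi.add_apply]
    push_cast
    ring
  have hderiv : EqOn (deriv fun s => ∫ v, f s v) 0 V := by
    intro s hs
    have h1 := ((hdiff.differentiableAt (hVo.mem_nhds hs)).hasDerivAt)
    have h2 : HasDerivAt (fun t : ℝ => ∫ v, f (s + t) v) (deriv (fun s => ∫ v, f s v) s) 0 := by
      have h3 : HasDerivAt (fun t : ℂ => s + t) 1 ((0 : ℝ) : ℂ) := by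
        simpa using (hasDerivAt_id _).const_add s
      have h4 : HasDerivAt (fun s => ∫ v, f s v) (deriv (fun s => ∫ v, f s v) s)
          (s + ((0 : ℝ) : ℂ)) := by simpa using h1
      have := (h4.comp _ h3).comp_ofReal
      simpa using this
    simp only [htrans] at h2
    exact h2.unique (hasDerivAt_const _ _)
  have h0 : (0 : ℂ) ∈ V := by
    change im' 0 ∈ U
    convert hc using 1
    ext i; simp [him']
  have h1 : Complex.I ∈ V := by
    change im' Complex.I ∈ U
    convert hc' using 1
    ext i; simp [him']
  have h := hVo.is_const_of_deriv_eq_zero hVc.isPreconnected hdiff hderiv h0 h1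
  simp only [hf, hwdef] at h
  convert h using 4 with v v
  · ext i; simp
  · ext i; push_cast; ring

end TodaGZ

end

noncomputable section

namespace TodaGZ

open MeasureTheory Filter Topology Metric Set

/-! ### Decay of the Gamma function -/

theorem norm_cpow_mul_exp_eq {z r : ℂ} {t : ℝ} (ht : 0 < t) :
    ‖(t : ℂ) ^ (z - 1) * Complex.exp (-(r * t))‖ = t ^ (z.re - 1) * Real.exp (-(r.re * t)) := by
  rw [norm_mul, Complex.norm_cpow_eq_rpow_re_of_pos ht, Complex.norm_exp]
  simp

theorem integrableOn_rpow_mul_exp_neg {s b : ℝ} (hs : 0 < s) (hb : 0 < b) :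
    IntegrableOn (fun t : ℝ => t ^ (s - 1) * Real.exp (-(b * t))) (Ioi 0) := by
  have := integrableOn_rpow_mul_exp_neg_mul_rpow (s := s - 1) (p := 1) (b := b)
    (by linarith) one_pos hb
  simpa using this

theorem measurable_cpow_mul_exp (z r : ℂ) :
    Measurable (fun t : ℝ => (t : ℂ) ^ (z - 1) * Complex.exp (-(r * t))) := by
  fun_prop

/-- Both sides are holomorphic in `r` on the right half-plane and agree for real `r > 0`, so the
identity theorem applies. -/
theorem integral_cpow_mul_exp_neg_mul_Ioi_complex {z r : ℂ} (hz : 0 < z.re) (hr : 0 < r.re) :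
    ∫ t : ℝ in Ioi 0, (t : ℂ) ^ (z - 1) * Complex.exp (-(r * t)) =
      r ^ (-z) * Complex.Gamma z := by
  set U : Set ℂ := {r | 0 < r.re} with hU
  have hUo : IsOpen U := isOpen_lt continuous_const Complex.continuous_re
  have hUc : IsPreconnected U := (convex_halfSpace_re_gt 0).isPreconnected
  have h1 : DifferentiableOn ℂ (fun r : ℂ => ∫ t : ℝ in Ioi 0,
      (t : ℂ) ^ (z - 1) * Complex.exp (-(r * t))) U := by
    refine differentiableOn_integral_of_locally_dominated hUo (fun t => ?_)
      (fun a _ => (measurable_cpow_mul_exp z a).aestronglyMeasurable) (fun a ha => ?_)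
    · fun_prop
    · have ha' : 0 < a.re := ha
      refine ⟨a.re / 2, by positivity, fun t => t ^ (z.re - 1) * Real.exp (-(a.re / 2 * t)),
        integrableOn_rpow_mul_exp_neg hz (by positivity), ?_⟩
      refine (ae_restrict_iff' measurableSet_Ioi).2 (ae_of_all _ fun t ht b hb => ?_)
      have ht : 0 < t := ht
      rw [norm_cpow_mul_exp_eq ht]
      have h2 : |(b - a).re| < a.re / 2 := (Complex.abs_re_le_norm _).trans_lt
        (by rw [← dist_eq_norm]; exact mem_ball.1 hb)
      rw [Complex.sub_re, abs_lt] at h2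
      beta_reduce
      gcongr
      linarith
  have h2 : DifferentiableOn ℂ (fun r : ℂ => r ^ (-z) * Complex.Gamma z) U := by
    intro r hr
    refine DifferentiableAt.differentiableWithinAt ?_
    refine DifferentiableAt.mul_const ?_ _
    exact differentiableAt_id.cpow_const (Or.inl hr)
  have h3 := (h1.analyticOnNhd hUo).eqOn_of_preconnected_of_frequently_eq (h2.analyticOnNhd hUo)
    hUc (show (1 : ℂ) ∈ U by simp [hU]) ?_
  · exact h3 hr
  -- Real points different from `1` and accumulating at `1`, where both sides are known to agree.
  have hlim : Tendsto (fun n : ℕ => (1 + ((n + 1 : ℕ) : ℂ)⁻¹ : ℂ)) atTop (𝓝[≠] 1) := by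
    refine tendsto_nhdsWithin_iff.2 ⟨?_, Eventually.of_forall fun n => ?_⟩
    · have hc : Tendsto (fun n : ℕ => ‖((n + 1 : ℕ) : ℂ)‖) atTop atTop := by
        simp only [Complex.norm_natCast]
        exact tendsto_natCast_atTop_atTop.comp (tendsto_add_atTop_nat 1)
      have h1 := tendsto_inv₀_cobounded.comp (tendsto_norm_atTop_iff_cobounded.1 hc)
      simpa using h1.const_add (1 : ℂ)
    · simp only [mem_compl_iff, mem_singleton_iff, add_eq_left, inv_eq_zero]
      exact_mod_cast Nat.succ_ne_zero n
  refine hlim.frequently (Frequently.of_forall fun n => ?_)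
  have hpos : (0 : ℝ) < 1 + ((n + 1 : ℕ) : ℝ)⁻¹ := by positivity
  have h := Complex.integral_cpow_mul_exp_neg_mul_Ioi hz hpos
  have e : ((1 + ((n + 1 : ℕ) : ℝ)⁻¹ : ℝ) : ℂ) = 1 + ((n + 1 : ℕ) : ℂ)⁻¹ := by push_cast; rfl
  rw [← e, h, one_div, ← Complex.ofReal_inv, Complex.ofReal_inv,
    Complex.inv_cpow _ _ (by rw [Complex.arg_ofReal_of_nonneg hpos.le]; exact Real.pi_pos.ne),
    Complex.cpow_neg]

/-- Take `r = e^{iφ}` in the rotated Euler integral: `|r^{-z}| = e^{φ Im z}`, while the absolute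
value of the integrand involves only `Re r = cos φ`. -/
theorem exp_mul_norm_Gamma_le {z : ℂ} (hz : 0 < z.re) {φ : ℝ} (hφ : |φ| < Real.pi / 2) :
    Real.exp (φ * z.im) * ‖Complex.Gamma z‖ ≤ (1 / Real.cos φ) ^ z.re * Real.Gamma z.re := by
  have hcos : 0 < Real.cos φ := Real.cos_pos_of_mem_Ioo ⟨by linarith [neg_abs_le φ],
    by linarith [le_abs_self φ]⟩
  have hre : (Complex.exp (φ * Complex.I)).re = Real.cos φ := by
    rw [Complex.exp_ofReal_mul_I_re]
  have h := integral_cpow_mul_exp_neg_mul_Ioi_complex (r := Complex.exp (φ * Complex.I)) hz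
    (by rw [hre]; exact hcos)
  have h1 : ‖Complex.exp (φ * Complex.I) ^ (-z)‖ = Real.exp (φ * z.im) := by
    rw [Complex.cpow_def_of_ne_zero (Complex.exp_ne_zero _), Complex.log_exp, Complex.norm_exp]
    · simp
    · simp; linarith [neg_abs_le φ, Real.pi_pos]
    · simp; linarith [le_abs_self φ, Real.pi_pos]
  rw [← h1, ← norm_mul, ← h, ← Real.integral_rpow_mul_exp_neg_mul_Ioi hz hcos]
  refine norm_integral_le_of_norm_le (integrableOn_rpow_mul_exp_neg hz hcos) ?_
  refine (ae_restrict_iff' measurableSet_Ioi).2 (ae_of_all _ fun t ht => ?_)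
  rw [norm_cpow_mul_exp_eq ht, hre]

/-- The rotation angle is `θ` with the sign of `Im z`. Every rate below `π / 2` is reached,
uniformly on closed vertical strips in the right half-plane. -/
theorem exists_norm_Gamma_le {θ s₀ s₁ : ℝ} (hθ0 : 0 ≤ θ) (hθ : θ < Real.pi / 2) (hs₀ : 0 < s₀) :
    ∃ C, ∀ z : ℂ, s₀ ≤ z.re → z.re ≤ s₁ →
      ‖Complex.Gamma z‖ ≤ C * Real.exp (-θ * |z.im|) := by
  have hcos : 0 < Real.cos θ := Real.cos_pos_of_mem_Ioo ⟨by linarith, hθ⟩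
  obtain ⟨C, hC⟩ := (isCompact_Icc (a := s₀) (b := s₁)).exists_bound_of_continuousOn
    (f := Real.Gamma) (fun s hs => (Real.differentiableAt_Gamma fun m => by
      have : s₀ ≤ s := hs.1
      have : (0 : ℝ) ≤ m := Nat.cast_nonneg m
      linarith).continuousAt.continuousWithinAt)
  refine ⟨(1 / Real.cos θ) ^ s₁ * C, fun z h0 h1 => ?_⟩
  have hz : 0 < z.re := hs₀.trans_le h0
  obtain ⟨φ, hφ1, hφ2, hφ3⟩ : ∃ φ, |φ| < Real.pi / 2 ∧ Real.cos φ = Real.cos θ ∧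
      φ * z.im = θ * |z.im| := by
    rcases le_total 0 z.im with h | h
    · exact ⟨θ, by rwa [abs_of_nonneg hθ0], rfl, by rw [abs_of_nonneg h]⟩
    · exact ⟨-θ, by rwa [abs_neg, abs_of_nonneg hθ0], Real.cos_neg θ, by
        rw [abs_of_nonpos h]; ring⟩
  have key := exp_mul_norm_Gamma_le hz hφ1
  rw [hφ2, hφ3] at key
  have hone : 1 ≤ 1 / Real.cos θ := by
    rw [le_div_iff₀ hcos]; linarith [Real.cos_le_one θ]
  have k2 : (1 / Real.cos θ) ^ z.re * Real.Gamma z.re ≤ (1 / Real.cos θ) ^ s₁ * C := by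
    have := (le_abs_self _).trans (hC z.re ⟨h0, h1⟩)
    have h3 := (Real.Gamma_pos_of_pos hz).le
    gcongr
  have e : Real.exp (-θ * |z.im|) * Real.exp (θ * |z.im|) = 1 := by
    rw [← Real.exp_add]; simp
  calc ‖Complex.Gamma z‖ = Real.exp (-θ * |z.im|) *
        (Real.exp (θ * |z.im|) * ‖Complex.Gamma z‖) := by rw [← mul_assoc, e, one_mul]
    _ ≤ Real.exp (-θ * |z.im|) * ((1 / Real.cos θ) ^ s₁ * C) := by
        exact mul_le_mul_of_nonneg_left (key.trans k2) (Real.exp_pos _).le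
    _ = _ := mul_comm _ _

/-! ### The factors of the kernel -/

/-- `ħ^w Γ(w)` with `w = z / (iħ)`. -/
def gammaFactor (ħ : ℝ) (z : ℂ) : ℂ :=
  (ħ : ℂ) ^ (z / (Complex.I * ħ)) * Complex.Gamma (z / (Complex.I * ħ))

variable {ħ : ℝ}

theorem div_I_mul_re (z : ℂ) : (z / (Complex.I * ħ)).re = z.im / ħ := by
  rcases eq_or_ne ħ 0 with rfl | h
  · simp
  have : z / (Complex.I * ħ) = -Complex.I * z / ħ := by
    have : (ħ : ℂ) ≠ 0 := by exact_mod_cast h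
    field_simp
    linear_combination Complex.I_sq * z
  rw [this, Complex.div_ofReal_re]
  simp

theorem div_I_mul_im (z : ℂ) : (z / (Complex.I * ħ)).im = -z.re / ħ := by
  rcases eq_or_ne ħ 0 with rfl | h
  · simp
  have : z / (Complex.I * ħ) = -Complex.I * z / ħ := by
    have : (ħ : ℂ) ≠ 0 := by exact_mod_cast h
    field_simp
    linear_combination Complex.I_sq * z
  rw [this, Complex.div_ofReal_im]
  simp

theorem differentiableAt_gammaFactor (hħ : 0 < ħ) {z : ℂ} (hz : 0 < z.im) :
    DifferentiableAt ℂ (gammaFactor ħ) z := by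
  unfold gammaFactor
  have h1 : DifferentiableAt ℂ (fun z : ℂ => z / (Complex.I * ħ)) z := by fun_prop
  refine DifferentiableAt.mul ?_ ?_
  · exact h1.const_cpow (Or.inl (by exact_mod_cast hħ.ne'))
  · refine DifferentiableAt.comp z (Complex.differentiableAt_Gamma _ fun m hm => ?_) h1
    have := congrArg Complex.re hm
    rw [div_I_mul_re] at this
    simp only [Complex.neg_re, Complex.natCast_re] at this
    have h2 : 0 < z.im / ħ := by positivity
    have : (0 : ℝ) ≤ m := Nat.cast_nonneg m
    linarith

/-- The functional equation of `Γ`; all polynomial factors in the difference equations of the kernel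
come from it. -/
theorem gammaFactor_add (hħ : 0 < ħ) {z : ℂ} (hz : z ≠ 0) :
    gammaFactor ħ (z + Complex.I * ħ) = -Complex.I * z * gammaFactor ħ z := by
  have hħ' : (ħ : ℂ) ≠ 0 := by exact_mod_cast hħ.ne'
  have hI : Complex.I * (ħ : ℂ) ≠ 0 := mul_ne_zero Complex.I_ne_zero hħ'
  have e : (z + Complex.I * ħ) / (Complex.I * ħ) = z / (Complex.I * ħ) + 1 := by field_simp
  rw [gammaFactor, e, Complex.cpow_add _ _ hħ', Complex.cpow_one,
    Complex.Gamma_add_one _ (div_ne_zero hz hI), gammaFactor]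
  field_simp
  linear_combination ((ħ : ℂ) ^ (z / (Complex.I * ħ)) * Complex.Gamma (z / (Complex.I * ħ))) *
    Complex.I_sq

theorem exists_norm_gammaFactor_le (hħ : 0 < ħ) {θ s₀ s₁ : ℝ} (hθ0 : 0 ≤ θ)
    (hθ : θ < Real.pi / 2) (hs₀ : 0 < s₀) :
    ∃ C, ∀ z : ℂ, s₀ ≤ z.im → z.im ≤ s₁ →
      ‖gammaFactor ħ z‖ ≤ C * Real.exp (-(θ / ħ) * |z.re|) := by
  obtain ⟨C, hC⟩ := exists_norm_Gamma_le (s₁ := s₁ / ħ) hθ0 hθ (div_pos hs₀ hħ)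
  obtain ⟨D, hD⟩ := (isCompact_Icc (a := s₀ / ħ) (b := s₁ / ħ)).exists_bound_of_continuousOn
    (f := fun s : ℝ => ħ ^ s) (Real.continuous_const_rpow hħ.ne').continuousOn
  refine ⟨D * C, fun z h0 h1 => ?_⟩
  have k0 : s₀ / ħ ≤ (z / (Complex.I * ħ)).re := by rw [div_I_mul_re]; gcongr
  have k1 : (z / (Complex.I * ħ)).re ≤ s₁ / ħ := by rw [div_I_mul_re]; gcongr
  have h2 := hC _ k0 k1
  have h3 := hD _ ⟨k0, k1⟩
  rw [gammaFactor, norm_mul, Complex.norm_cpow_eq_rpow_re_of_pos hħ, mul_assoc]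
  have e : Real.exp (-θ * |(z / (Complex.I * ħ)).im|) = Real.exp (-(θ / ħ) * |z.re|) := by
    rw [div_I_mul_im, abs_div, abs_neg, abs_of_pos hħ]
    congr 1
    ring
  rw [e] at h2
  exact mul_le_mul ((le_abs_self _).trans h3) h2 (norm_nonneg _) ((norm_nonneg _).trans h3)

theorem norm_sinh_le (z : ℂ) : ‖Complex.sinh z‖ ≤ Real.exp |z.re| := by
  rw [Complex.sinh, norm_div, Complex.norm_ofNat]
  have h1 : ‖Complex.exp z‖ ≤ Real.exp |z.re| := by
    rw [Complex.norm_exp]; exact Real.exp_le_exp.2 (le_abs_self _)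
  have h2 : ‖Complex.exp (-z)‖ ≤ Real.exp |z.re| := by
    rw [Complex.norm_exp]; exact Real.exp_le_exp.2 (neg_le_abs _)
  linarith [norm_sub_le (Complex.exp z) (Complex.exp (-z))]

/-- The entire function `sinh (π d / ħ) / (π ħ)`. -/
def sinhFactor (ħ : ℝ) (d : ℂ) : ℂ := Complex.sinh (Real.pi * d / ħ) / (Real.pi * ħ)

theorem differentiable_sinhFactor : Differentiable ℂ (sinhFactor ħ) := by
  unfold sinhFactor
  fun_prop

theorem sinhFactor_add (hħ : 0 < ħ) (d : ℂ) :
    sinhFactor ħ (d + Complex.I * ħ) = -sinhFactor ħ d := by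
  have hħ' : (ħ : ℂ) ≠ 0 := by exact_mod_cast hħ.ne'
  have e : Real.pi * (d + Complex.I * ħ) / ħ = Real.pi * d / ħ + Real.pi * Complex.I := by
    field_simp
  rw [sinhFactor, e, Complex.sinh_add, Complex.sinh_mul_I, Complex.cosh_mul_I, sinhFactor]
  simp [neg_div]

theorem sinhFactor_sub (hħ : 0 < ħ) (d : ℂ) :
    sinhFactor ħ (d - Complex.I * ħ) = -sinhFactor ħ d := by
  have := sinhFactor_add hħ (d - Complex.I * ħ)
  rw [sub_add_cancel] at this
  rw [this, neg_neg]

theorem norm_sinhFactor_le (hħ : 0 < ħ) (d : ℂ) :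
    ‖sinhFactor ħ d‖ ≤ 1 / (Real.pi * ħ) * Real.exp (Real.pi / ħ * |d.re|) := by
  have hpi := Real.pi_pos
  rw [sinhFactor, norm_div]
  have h1 : ‖(Real.pi * ħ : ℂ)‖ = Real.pi * ħ := by
    rw [← Complex.ofReal_mul, Complex.norm_real, Real.norm_of_nonneg (by positivity)]
  have h2 := norm_sinh_le (Real.pi * d / ħ)
  have h3 : (Real.pi * d / ħ : ℂ).re = Real.pi / ħ * d.re := by
    rw [Complex.div_ofReal_re, Complex.re_ofReal_mul]; ring
  rw [h3, abs_mul, abs_of_pos (by positivity : 0 < Real.pi / ħ)] at h2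
  rw [h1, div_eq_mul_inv, mul_comm, one_div]
  gcongr

/-- The linear factor costs only an arbitrarily small increase `ε / ħ` of the exponential rate. -/
theorem exists_norm_mul_sinhFactor_le (hħ : 0 < ħ) {ε : ℝ} (hε : 0 < ε) (L : ℝ) :
    ∃ C, ∀ d : ℂ, |d.im| ≤ L → ‖sinhFactor ħ d‖ ≤ C * Real.exp ((Real.pi + ε) / ħ * |d.re|) ∧
      ‖d * sinhFactor ħ d‖ ≤ C * Real.exp ((Real.pi + ε) / ħ * |d.re|) := by
  have hpi := Real.pi_pos
  refine ⟨1 / (Real.pi * ħ) * (1 + |L| + ħ / ε), fun d hd => ?_⟩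
  have h1 := norm_sinhFactor_le hħ d
  have h2 : ‖d‖ ≤ |d.re| + |L| := (Complex.norm_le_abs_re_add_abs_im d).trans
    (by linarith [le_abs_self L])
  have h3 : |d.re| ≤ ħ / ε * Real.exp (ε / ħ * |d.re|) := by
    have := Real.add_one_le_exp (ε / ħ * |d.re|)
    calc |d.re| = ħ / ε * (ε / ħ * |d.re|) := by field_simp
      _ ≤ _ := by gcongr; linarith
  have h4 : 1 ≤ Real.exp (ε / ħ * |d.re|) := Real.one_le_exp (by positivity)
  have h5 : Real.exp ((Real.pi + ε) / ħ * |d.re|) =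
      Real.exp (Real.pi / ħ * |d.re|) * Real.exp (ε / ħ * |d.re|) := by
    rw [← Real.exp_add]; congr 1; ring
  have h6 : 1 + ‖d‖ ≤ (1 + |L| + ħ / ε) * Real.exp (ε / ħ * |d.re|) := by
    nlinarith [abs_nonneg L]
  have h7 : (1 + ‖d‖) * ‖sinhFactor ħ d‖ ≤
      1 / (Real.pi * ħ) * (1 + |L| + ħ / ε) * Real.exp ((Real.pi + ε) / ħ * |d.re|) := by
    calc _ ≤ ((1 + |L| + ħ / ε) * Real.exp (ε / ħ * |d.re|)) *
          (1 / (Real.pi * ħ) * Real.exp (Real.pi / ħ * |d.re|)) := by gcongr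
      _ = _ := by rw [h5]; ring
  have h8 := norm_nonneg (sinhFactor ħ d)
  have h9 := norm_nonneg d
  rw [norm_mul]
  constructor <;> nlinarith

end TodaGZ

end

noncomputable section

namespace TodaGZ

open Finset

variable {N : ℕ} {ħ : ℝ}

/-! ### The kernel -/

/-- Product of factors `A` over adjacent levels and `B` within the levels of a triangular array. -/
def gzProd (A : ℕ → ℕ → ℂ → ℂ) (B : ℕ → ℕ → ℕ → ℂ → ℂ) (a : Fin N → ℂ) (g : GZIndex N → ℂ) : ℂ :=
  (∏ n ∈ Ico 1 N, ∏ k ∈ range n, ∏ m ∈ range (n + 1),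
      A n k (gzArray a g n k - gzArray a g (n + 1) m)) *
    ∏ n ∈ Ico 2 N, ∏ r ∈ range n, ∏ p ∈ range r,
      B n p r (gzArray a g n p - gzArray a g n r)

/-- The factor between adjacent levels; at the marked position `κ` it is multiplied by its
argument, which removes the first pole. -/
def crossFactor (ħ : ℝ) (κ : ℕ × ℕ) (n k : ℕ) (z : ℂ) : ℂ :=
  if κ = (n, k) then Complex.I * gammaFactor ħ (z + Complex.I * ħ) else gammaFactor ħ z

/-- The factor within a level; at the marked position `κ` the linear factor is divided out. -/
def pairFactor (ħ : ℝ) (κ : ℕ × ℕ) (n p r : ℕ) (d : ℂ) : ℂ :=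
  if κ = (n, p) then sinhFactor ħ d else if κ = (n, r) then -sinhFactor ħ d
    else d * sinhFactor ħ d

/-- The sum of the level `n`. -/
def levelSum (a : Fin N → ℂ) (g : GZIndex N → ℂ) (n : ℕ) : ℂ := ∑ j ∈ range n, gzArray a g n j

/-- The exponent of the plane wave. -/
def waveExponent (ħ : ℝ) (a : Fin N → ℂ) (x : Fin N → ℝ) (g : GZIndex N → ℂ) : ℂ :=
  Complex.I / ħ * ∑ n : Fin N, (levelSum a g ((n : ℕ) + 1) - levelSum a g n) * (x n : ℂ)

/-- The Mellin-Barnes kernel, regularized at the marked position `κ`. As the level `0` is empty,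
`κ = 0` marks nothing. -/
def kernel (ħ : ℝ) (κ : ℕ × ℕ) (a : Fin N → ℂ) (x : Fin N → ℝ) (g : GZIndex N → ℂ) : ℂ :=
  gzProd (crossFactor ħ κ) (pairFactor ħ κ) a g * Complex.exp (waveExponent ħ a x g)

theorem gzArray_of_lt (a : Fin N → ℂ) (g : GZIndex N → ℂ) {n j : ℕ} (hn : n < N) (hj : j < n) :
    gzArray a g n j = g ⟨⟨n, hn⟩, ⟨j, hj⟩⟩ := by
  simp [gzArray, hn, hj]

theorem gzArray_top (a : Fin N → ℂ) (g : GZIndex N → ℂ) {j : ℕ} (hj : j < N) :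
    gzArray a g N j = a ⟨j, hj⟩ := by
  simp [gzArray, hj]

theorem gzArray_cases (a : Fin N → ℂ) (g : GZIndex N → ℂ) (n j : ℕ) :
    (∃ i, gzArray a g n j = g i) ∨ (∃ i, gzArray a g n j = a i) ∨ gzArray a g n j = 0 := by
  unfold gzArray
  split_ifs with h1 h2 h3
  · exact Or.inl ⟨_, rfl⟩
  · exact Or.inr (Or.inr rfl)
  · exact Or.inr (Or.inl ⟨_, rfl⟩)
  · exact Or.inr (Or.inr rfl)

theorem abs_re_gzArray_le {a : Fin N → ℂ} {R : ℝ} (hR : 0 ≤ R) (ha : ∀ j, |(a j).re| ≤ R)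
    (g : GZIndex N → ℂ) (n k : ℕ) : |(gzArray a g n k).re| ≤ ∑ i, |(g i).re| + R := by
  have hS : 0 ≤ ∑ i, |(g i).re| := sum_nonneg fun _ _ => abs_nonneg _
  rcases gzArray_cases a g n k with ⟨i, hi⟩ | ⟨i, hi⟩ | hi <;> rw [hi]
  · have := single_le_sum (f := fun i => |(g i).re|) (fun _ _ => abs_nonneg _) (mem_univ i)
    linarith
  · linarith [ha i]
  · simp; linarith

/-! ### Exponential decay of the kernel -/

/-- The rate at which cross factors must decay and pair factors may grow, on a triangular array,
for the product to decay exponentially. -/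
theorem exists_decay (hN : 1 ≤ N) (hħ : 0 < ħ) : ∃ ε > 0, ε < Real.pi / 2 ∧ ∃ δ > 0, ∀ R, 0 ≤ R →
    ∃ D, ∀ (a : Fin N → ℂ) (g : GZIndex N → ℂ), (∀ j, |(a j).re| ≤ R) →
      -((Real.pi / 2 - ε) / ħ) * ∑ n ∈ Ico 1 N, ∑ k ∈ range n, ∑ m ∈ range (n + 1),
          |(gzArray a g n k - gzArray a g (n + 1) m).re| +
        ((Real.pi + ε) / ħ) * ∑ n ∈ Ico 2 N, ∑ r ∈ range n, ∑ p ∈ range r,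
          |(gzArray a g n p - gzArray a g n r).re| ≤ D - δ * ∑ i, |(g i).re| := by
  have hpi := Real.pi_pos
  obtain ⟨d, hd⟩ : ∃ d, d = (Fintype.card (GZIndex N) : ℝ) := ⟨_, rfl⟩
  have hd0 : 0 ≤ d := hd ▸ Nat.cast_nonneg _
  obtain ⟨M, hM⟩ : ∃ M, M = ∑ n ∈ Ico 1 N, ∑ k ∈ range n, ∑ m ∈ range (n + 1), (2 : ℝ) +
    ∑ n ∈ Ico 2 N, ∑ r ∈ range n, ∑ p ∈ range r, (2 : ℝ) := ⟨_, rfl⟩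
  have hM0 : 0 ≤ M := by
    rw [hM]
    exact add_nonneg (sum_nonneg fun _ _ => sum_nonneg fun _ _ => sum_nonneg fun _ _ => zero_le_two)
      (sum_nonneg fun _ _ => sum_nonneg fun _ _ => sum_nonneg fun _ _ => zero_le_two)
  -- `M` is twice the number of factors, so `X + Y ≤ M (S + R)`. This `ε` keeps the loss `ε (X + Y)`
  -- below a quarter of the main decay `π S / (d + 1)`, up to a constant.
  obtain ⟨ε, hε⟩ : ∃ ε, ε = Real.pi / 4 / ((d + 1) * (M + 1)) := ⟨_, rfl⟩
  have hε0 : 0 < ε := by rw [hε]; positivity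
  have hεM : ε * M ≤ Real.pi / 4 / (d + 1) := by
    rw [hε, div_mul_eq_mul_div, div_le_div_iff₀ (by positivity) (by positivity)]
    have : 0 ≤ Real.pi / 4 * (d + 1) := by positivity
    nlinarith
  have hεlt : ε < Real.pi / 2 := by
    have : ε ≤ Real.pi / 4 := hε ▸ div_le_self (by positivity) (by nlinarith)
    linarith
  refine ⟨ε, hε0, hεlt, Real.pi / 4 / (d + 1) / ħ, by positivity, fun R hR =>
    ⟨(Real.pi * R + ε * M * R) / ħ, fun a g ha => ?_⟩⟩
  set S := ∑ i, |(g i).re| with hS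
  set u : ℕ → ℕ → ℝ := fun n k => (gzArray a g n k).re with hu
  have hu' : ∀ n k, |u n k| ≤ S + R := fun n k => abs_re_gzArray_le hR ha g n k
  simp only [Complex.sub_re]
  set X := ∑ n ∈ Ico 1 N, ∑ k ∈ range n, ∑ m ∈ range (n + 1), |u n k - u (n + 1) m| with hX
  set Y := ∑ n ∈ Ico 2 N, ∑ r ∈ range n, ∑ p ∈ range r, |u n p - u n r| with hY
  have hXY : decayRate N u = X - 2 * Y := rfl
  have hbd : X + Y ≤ M * (S + R) := by
    have h2 : ∀ n k n' k', |u n k - u n' k'| ≤ 2 * (S + R) := fun n k n' k' =>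
      (abs_sub _ _).trans (by linarith [hu' n k, hu' n' k'])
    rw [hM, add_mul]
    simp only [sum_mul]
    exact add_le_add (sum_le_sum fun n _ => sum_le_sum fun k _ => sum_le_sum fun m _ => h2 _ _ _ _)
      (sum_le_sum fun n _ => sum_le_sum fun k _ => sum_le_sum fun m _ => h2 _ _ _ _)
  have hdec : 2 * S ≤ (d + 1) * (2 * R + decayRate N u) := by
    have h1 : ∀ i ∈ (univ : Finset (GZIndex N)), 2 * |(g i).re| ≤ 2 * R + decayRate N u := by
      rintro ⟨⟨n, hn⟩, ⟨k, hk⟩⟩ -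
      have := abs_le_decayRate hN u (R := R) (fun j hj => by
        simp only [hu, gzArray_top a g hj]; exact ha _) (n := n) (k := k) hn.le
        (by simp only at hk; omega) hk
      simp only [hu, gzArray_of_lt a g hn hk] at this
      exact this
    have h2 := sum_le_sum h1
    rw [← mul_sum, sum_const, nsmul_eq_mul, card_univ, ← hd] at h2
    have := decayRate_nonneg hN u
    linarith
  rw [hXY] at hdec
  have h3 : S / (d + 1) ≤ R + (X - 2 * Y) / 2 := by
    rw [div_le_iff₀ (by positivity)]; linarith
  have hS0 : 0 ≤ S := sum_nonneg fun _ _ => abs_nonneg _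
  have h4 : ε * (X + Y) ≤ Real.pi / 4 / (d + 1) * S + ε * M * R := by
    have h5 := mul_le_mul_of_nonneg_left hbd hε0.le
    have h6 := mul_le_mul_of_nonneg_right hεM hS0
    linarith
  have e : -((Real.pi / 2 - ε) / ħ) * X + (Real.pi + ε) / ħ * Y =
      (-(Real.pi / 2) * (X - 2 * Y) + ε * (X + Y)) / ħ := by ring
  have e2 : (Real.pi * R + ε * M * R) / ħ - Real.pi / 4 / (d + 1) / ħ * S =
      (Real.pi * R + ε * M * R - Real.pi / 4 / (d + 1) * S) / ħ := by ring
  rw [e, e2]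
  gcongr
  have h7 := mul_le_mul_of_nonneg_left h3 hpi.le
  have e3 : Real.pi / 4 / (d + 1) * S = Real.pi * (S / (d + 1)) / 4 := by ring
  have e4 : 0 ≤ Real.pi * (S / (d + 1)) := by positivity
  linarith

theorem norm_gzProd_le {A : ℕ → ℕ → ℂ → ℂ} {B : ℕ → ℕ → ℕ → ℂ → ℂ} {a : Fin N → ℂ}
    {g : GZIndex N → ℂ} {C θ η : ℝ}
    (hA : ∀ n ∈ Ico 1 N, ∀ k ∈ range n, ∀ m ∈ range (n + 1),
      ‖A n k (gzArray a g n k - gzArray a g (n + 1) m)‖ ≤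
        C * Real.exp (-θ * |(gzArray a g n k - gzArray a g (n + 1) m).re|))
    (hB : ∀ n ∈ Ico 2 N, ∀ r ∈ range n, ∀ p ∈ range r,
      ‖B n p r (gzArray a g n p - gzArray a g n r)‖ ≤
        C * Real.exp (η * |(gzArray a g n p - gzArray a g n r).re|)) :
    ‖gzProd A B a g‖ ≤ ((∏ n ∈ Ico 1 N, ∏ _k ∈ range n, ∏ _m ∈ range (n + 1), C) *
      ∏ n ∈ Ico 2 N, ∏ r ∈ range n, ∏ _p ∈ range r, C) *
      Real.exp (-θ * ∑ n ∈ Ico 1 N, ∑ k ∈ range n, ∑ m ∈ range (n + 1),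
          |(gzArray a g n k - gzArray a g (n + 1) m).re| +
        η * ∑ n ∈ Ico 2 N, ∑ r ∈ range n, ∑ p ∈ range r,
          |(gzArray a g n p - gzArray a g n r).re|) := by
  rw [gzProd, norm_mul, Real.exp_add, mul_mul_mul_comm]
  have h1 : ∀ {ι : Type} (s : Finset ι) (f : ι → ℂ) (h : ι → ℝ), (∀ i ∈ s, ‖f i‖ ≤ h i) →
      ‖∏ i ∈ s, f i‖ ≤ ∏ i ∈ s, h i := fun s f h hf => by
    rw [norm_prod]
    exact prod_le_prod (fun _ _ => norm_nonneg _) hf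
  have h2 := h1 _ _ _ fun n hn => h1 _ _ _ fun k hk => h1 _ _ _ fun m hm => hA n hn k hk m hm
  have h3 := h1 _ _ _ fun n hn => h1 _ _ _ fun k hk => h1 _ _ _ fun m hm => hB n hn k hk m hm
  simp only [prod_mul_distrib, ← Real.exp_sum, ← mul_sum] at h2 h3
  exact mul_le_mul h2 h3 (norm_nonneg _) ((norm_nonneg _).trans h2)

/-- The arguments of the cross factors stay away from the poles. -/
def AwayFromPoles (ħ : ℝ) (κ : ℕ × ℕ) (s₀ : ℝ) (a : Fin N → ℂ) (g : GZIndex N → ℂ) : Prop :=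
  ∀ n ∈ Ico 1 N, ∀ k ∈ range n, ∀ m ∈ range (n + 1),
    s₀ ≤ (gzArray a g n k - gzArray a g (n + 1) m).im + if κ = (n, k) then ħ else 0

theorem norm_exp_waveExponent_le (hħ : 0 < ħ) {a : Fin N → ℂ} {g : GZIndex N → ℂ}
    {x : Fin N → ℝ} {L X : ℝ} (hL : ∀ n j, |(gzArray a g n j).im| ≤ L) (hx : ∀ n, |x n| ≤ X) :
    ‖Complex.exp (waveExponent ħ a x g)‖ ≤
      Real.exp (1 / ħ * ∑ n : Fin N, (((n : ℕ) + 1) * L + (n : ℕ) * L) * X) := by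
  have hL' : ∀ n, |(levelSum a g n).im| ≤ n * L := fun n => by
    rw [levelSum, Complex.im_sum]
    refine (abs_sum_le_sum_abs _ _).trans ?_
    have := sum_le_sum fun j (_ : j ∈ range n) => hL n j
    simpa using this
  rw [Complex.norm_exp]
  refine Real.exp_le_exp.2 ?_
  have e : (waveExponent ħ a x g).re = 1 / ħ * ∑ n : Fin N,
      -((levelSum a g ((n : ℕ) + 1) - levelSum a g n).im * x n) := by
    have : waveExponent ħ a x g = ((1 / ħ : ℝ) : ℂ) * (Complex.I *
      ∑ n : Fin N, (levelSum a g ((n : ℕ) + 1) - levelSum a g n) * (x n : ℂ)) := by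
      rw [waveExponent]; push_cast; ring
    rw [this, Complex.re_ofReal_mul, Complex.I_mul_re, Complex.im_sum, sum_neg_distrib]
    simp only [Complex.im_mul_ofReal]
  rw [e]
  gcongr with n
  refine (neg_le_abs _).trans ?_
  rw [abs_mul, Complex.sub_im]
  refine mul_le_mul ((abs_sub _ _).trans (add_le_add ?_ (hL' n))) (hx n) (abs_nonneg _) ?_
  · exact_mod_cast hL' (n + 1)
  · have := (abs_nonneg _).trans (hL 0 0)
    positivity

/-- The rate `δ` depends on `N` and `ħ` alone, and the constant is uniform in the mark, label, point
and heights within the stated bounds. This uniformity supplies the dominating functions needed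
later. -/
theorem exists_norm_kernel_le (hN : 1 ≤ N) (hħ : 0 < ħ) : ∃ δ > 0, ∀ s₀ > 0, ∀ L R X, 0 ≤ R →
    ∃ C, 0 ≤ C ∧ ∀ (κ : ℕ × ℕ) (a : Fin N → ℂ) (g : GZIndex N → ℂ) (x : Fin N → ℝ),
      AwayFromPoles ħ κ s₀ a g → (∀ n j, |(gzArray a g n j).im| ≤ L) → (∀ j, |(a j).re| ≤ R) →
      (∀ n, |x n| ≤ X) → ‖kernel ħ κ a x g‖ ≤ C * Real.exp (-δ * ∑ i, |(g i).re|) := by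
  obtain ⟨ε, hε, hεpi, δ, hδ, hdec⟩ := exists_decay hN hħ
  refine ⟨δ, hδ, fun s₀ hs₀ L R X hR => ?_⟩
  obtain ⟨D, hD⟩ := hdec R hR
  -- Differences of entries have imaginary part at most `2L`; the marked factors are evaluated `ħ`
  -- higher.
  obtain ⟨C₁, hC₁⟩ := exists_norm_gammaFactor_le (s₁ := 2 * L + ħ) hħ
    (θ := Real.pi / 2 - ε) (by linarith) (by linarith) hs₀
  obtain ⟨C₂, hC₂⟩ := exists_norm_mul_sinhFactor_le hħ hε (2 * L)
  set C := max (max C₁ C₂) 0 with hC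
  have hC1 : C₁ ≤ C := (le_max_left _ _).trans (le_max_left _ _)
  have hC2 : C₂ ≤ C := (le_max_right _ _).trans (le_max_left _ _)
  have hC0 : 0 ≤ C := le_max_right _ _
  refine ⟨((∏ n ∈ Ico 1 N, ∏ _k ∈ range n, ∏ _m ∈ range (n + 1), C) *
      ∏ n ∈ Ico 2 N, ∏ r ∈ range n, ∏ _p ∈ range r, C) * Real.exp D *
      Real.exp (1 / ħ * ∑ n : Fin N, (((n : ℕ) + 1) * L + (n : ℕ) * L) * X), by positivity,
    fun κ a g x hκ hL ha hx => ?_⟩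
  have hdiff : ∀ n k n' k', |(gzArray a g n k - gzArray a g n' k').im| ≤ 2 * L :=
    fun n k n' k' => by
      rw [Complex.sub_im]
      exact (abs_sub _ _).trans (by linarith [hL n k, hL n' k'])
  have h1 := norm_gzProd_le (A := crossFactor ħ κ) (B := pairFactor ħ κ) (a := a) (g := g)
    (C := C) (θ := (Real.pi / 2 - ε) / ħ) (η := (Real.pi + ε) / ħ) ?_ ?_
  · rw [kernel, norm_mul]
    refine (mul_le_mul h1 (norm_exp_waveExponent_le hħ hL hx) (norm_nonneg _)
      (by positivity)).trans ?_
    have h2 := Real.exp_le_exp.2 ((hD a g ha).trans_eq (sub_eq_add_neg D _))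
    rw [Real.exp_add D, ← neg_mul] at h2
    calc _ ≤ ((∏ n ∈ Ico 1 N, ∏ _k ∈ range n, ∏ _m ∈ range (n + 1), C) *
        ∏ n ∈ Ico 2 N, ∏ r ∈ range n, ∏ _p ∈ range r, C) *
        (Real.exp D * Real.exp (-δ * ∑ i, |(g i).re|)) *
        Real.exp (1 / ħ * ∑ n : Fin N, (((n : ℕ) + 1) * L + (n : ℕ) * L) * X) := by gcongr
      _ = _ := by ring
  · intro n hn k hk m hm
    have h2 := hκ n hn k hk m hm
    have h3 := (le_abs_self _).trans (hdiff n k (n + 1) m)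
    unfold crossFactor
    split_ifs at h2 ⊢ with h
    · have h4 := hC₁ (gzArray a g n k - gzArray a g (n + 1) m + Complex.I * ħ)
        (by simpa using h2) (by simpa using h3)
      rw [norm_mul, Complex.norm_I, one_mul]
      refine h4.trans ?_
      have : (gzArray a g n k - gzArray a g (n + 1) m + Complex.I * ħ).re =
        (gzArray a g n k - gzArray a g (n + 1) m).re := by simp
      rw [this]
      gcongr
    · refine (hC₁ _ (by linarith) (by linarith)).trans ?_
      gcongr
  · intro n hn r hr p hp
    obtain ⟨h2, h3⟩ := hC₂ _ (hdiff n p n r)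
    have h4 : C₂ * Real.exp ((Real.pi + ε) / ħ * |(gzArray a g n p - gzArray a g n r).re|) ≤
        C * Real.exp ((Real.pi + ε) / ħ * |(gzArray a g n p - gzArray a g n r).re|) := by gcongr
    unfold pairFactor
    split_ifs
    · exact h2.trans h4
    · rw [norm_neg]; exact h2.trans h4
    · exact h3.trans h4

/-! ### Holomorphy of the kernel -/

section Differentiability

variable {E : Type*} [NormedAddCommGroup E] [NormedSpace ℂ E] {α : E → Fin N → ℂ}
  {β : E → GZIndex N → ℂ} {e : E}

theorem differentiableAt_prod {ι : Type*} {s : Finset ι} {f : ι → E → ℂ}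
    (h : ∀ i ∈ s, DifferentiableAt ℂ (f i) e) : DifferentiableAt ℂ (fun e => ∏ i ∈ s, f i e) e := by
  classical
  induction s using Finset.induction_on with
  | empty => simp
  | insert i s hi ih =>
    simp only [prod_insert hi]
    exact (h i (mem_insert_self _ _)).fun_mul (ih fun j hj => h j (mem_insert_of_mem hj))

theorem differentiableAt_gzArray (hα : DifferentiableAt ℂ α e) (hβ : DifferentiableAt ℂ β e)
    (n k : ℕ) : DifferentiableAt ℂ (fun e => gzArray (α e) (β e) n k) e := by
  unfold gzArray
  split_ifs
  · exact differentiableAt_pi.1 hβ _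
  · fun_prop
  · exact differentiableAt_pi.1 hα _
  · fun_prop

theorem differentiableAt_kernel (hħ : 0 < ħ) (hα : DifferentiableAt ℂ α e)
    (hβ : DifferentiableAt ℂ β e) (κ : ℕ × ℕ) (x : Fin N → ℝ) {s₀ : ℝ} (hs₀ : 0 < s₀)
    (hκ : AwayFromPoles ħ κ s₀ (α e) (β e)) :
    DifferentiableAt ℂ (fun e => kernel ħ κ (α e) x (β e)) e := by
  have hd := differentiableAt_gzArray hα hβ
  unfold kernel gzProd
  refine DifferentiableAt.fun_mul (DifferentiableAt.fun_mul ?_ ?_) ?_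
  · refine differentiableAt_prod fun n hn => ?_
    refine differentiableAt_prod fun k hk => ?_
    refine differentiableAt_prod fun m hm => ?_
    have h := hκ n hn k hk m hm
    unfold crossFactor
    split_ifs at h ⊢
    · refine (DifferentiableAt.comp (g := gammaFactor ħ)
        (f := fun e => gzArray (α e) (β e) n k - gzArray (α e) (β e) (n + 1) m + Complex.I * ħ) e
        (differentiableAt_gammaFactor hħ ?_) (((hd _ _).sub (hd _ _)).add_const _)).const_mul _
      simpa using hs₀.trans_le h
    · exact DifferentiableAt.comp (g := gammaFactor ħ)
        (f := fun e => gzArray (α e) (β e) n k - gzArray (α e) (β e) (n + 1) m) e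
        (differentiableAt_gammaFactor hħ (by linarith)) ((hd _ _).sub (hd _ _))
  · refine differentiableAt_prod fun n hn => ?_
    refine differentiableAt_prod fun r hr => ?_
    refine differentiableAt_prod fun p hp => ?_
    have h2 : DifferentiableAt ℂ
        (fun e => sinhFactor ħ (gzArray (α e) (β e) n p - gzArray (α e) (β e) n r)) e :=
      DifferentiableAt.comp (g := sinhFactor ħ) e (differentiable_sinhFactor _)
        ((hd _ _).sub (hd _ _))
    unfold pairFactor
    split_ifs
    · exact h2
    · exact h2.neg
    · exact ((hd _ _).sub (hd _ _)).mul h2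
  · unfold waveExponent levelSum
    refine DifferentiableAt.cexp (DifferentiableAt.const_mul (DifferentiableAt.fun_sum fun n _ =>
      DifferentiableAt.mul_const (DifferentiableAt.sub ?_ ?_) _) _)
    · exact DifferentiableAt.fun_sum fun j _ => hd _ _
    · exact DifferentiableAt.fun_sum fun j _ => hd _ _

end Differentiability

end TodaGZ

end

noncomputable section

namespace TodaGZ

open Finset

variable {N : ℕ} {ħ : ℝ}

/-! ### The Mellin-Barnes integrand is the kernel -/

theorem crossFactor_zero {n k : ℕ} (hn : n ≠ 0) (z : ℂ) : crossFactor ħ 0 n k z = gammaFactor ħ z :=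
  if_neg fun h => hn (congrArg Prod.fst h).symm

theorem pairFactor_zero {n p r : ℕ} (hn : n ≠ 0) (d : ℂ) :
    pairFactor ħ 0 n p r d = d * sinhFactor ħ d := by
  rw [pairFactor, if_neg fun h => hn (congrArg Prod.fst h).symm,
    if_neg fun h => hn (congrArg Prod.fst h).symm]

/-- Reflection formula. It holds for every `d`, poles included: there `Γ` has the value `0`, the
inverse of `0` is `0`, and the right side vanishes. -/
theorem inv_Gamma_mul_Gamma_neg (hħ : 0 < ħ) (d : ℂ) :
    (Complex.Gamma (d / (Complex.I * ħ)) * Complex.Gamma (-(d / (Complex.I * ħ))))⁻¹ =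
      d * sinhFactor ħ d := by
  have hħ' : (ħ : ℂ) ≠ 0 := by exact_mod_cast hħ.ne'
  have hpi : (Real.pi : ℂ) ≠ 0 := by exact_mod_cast Real.pi_ne_zero
  rcases eq_or_ne d 0 with rfl | hd
  · simp
  set z := d / (Complex.I * ħ) with hz
  have hz0 : z ≠ 0 := div_ne_zero hd (mul_ne_zero Complex.I_ne_zero hħ')
  have h1 := Complex.Gamma_mul_Gamma_one_sub z
  have h2 : Complex.Gamma (1 - z) = -z * Complex.Gamma (-z) := by
    rw [← Complex.Gamma_add_one _ (neg_ne_zero.2 hz0)]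
    congr 1; ring
  have h3 : Complex.Gamma z * Complex.Gamma (-z) = Real.pi / Complex.sin (Real.pi * z) / (-z) := by
    rw [← h1, h2]; field_simp
  have h4 : Real.pi * z = -(Real.pi * d / ħ) * Complex.I := by
    rw [hz]; field_simp; linear_combination Complex.I_sq
  rw [h3, h4, Complex.sin_mul_I, Complex.sinh_neg, sinhFactor, inv_div, hz]
  field_simp

theorem prod_erase_eq_prod_pairs (n : ℕ) (f : ℕ → ℕ → ℂ) :
    ∏ s ∈ range n, ∏ p ∈ (range n).erase s, f s p = ∏ r ∈ range n, ∏ p ∈ range r, f p r * f r p := by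
  induction n with
  | zero => simp
  | succ n ih =>
    rw [prod_range_succ, prod_range_succ _ n, ← ih]
    have h1 : ∀ s ∈ range n, ∏ p ∈ (range (n + 1)).erase s, f s p =
        f s n * ∏ p ∈ (range n).erase s, f s p := by
      intro s hs
      have hsn : s ≠ n := (mem_range.1 hs).ne
      rw [range_add_one, erase_insert_of_ne hsn.symm, prod_insert]
      simp
    rw [prod_congr rfl h1, prod_mul_distrib, range_add_one, erase_insert notMem_range_self,
      prod_mul_distrib]
    ring

theorem mellinBarnesIntegrand_eq_kernel (hħ : 0 < ħ) (a : Fin N → ℂ) (x : Fin N → ℝ)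
    (g : GZIndex N → ℂ) : mellinBarnesIntegrand ħ a x g = kernel ħ 0 a x g := by
  rw [mellinBarnesIntegrand, kernel, gzProd]
  congr 1
  rw [prod_div_distrib, div_eq_mul_inv, ← prod_inv_distrib]
  congr 1
  · refine prod_congr rfl fun n hn => prod_congr rfl fun k _ => prod_congr rfl fun m _ => ?_
    rw [crossFactor_zero (by have := (mem_Ico.1 hn).1; omega), gammaFactor]
  · have h1 : ∀ n ∈ Ico 1 N, (∏ s ∈ range n, ∏ p ∈ (range n).erase s,
        Complex.Gamma ((gzArray a g n s - gzArray a g n p) / (Complex.I * ħ)))⁻¹ =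
        ∏ r ∈ range n, ∏ p ∈ range r,
          pairFactor ħ 0 n p r (gzArray a g n p - gzArray a g n r) := by
      intro n hn
      rw [prod_erase_eq_prod_pairs n fun s p =>
        Complex.Gamma ((gzArray a g n s - gzArray a g n p) / (Complex.I * ħ)), ← prod_inv_distrib]
      refine prod_congr rfl fun r _ => ?_
      rw [← prod_inv_distrib]
      refine prod_congr rfl fun p _ => ?_
      rw [pairFactor_zero (by have := (mem_Ico.1 hn).1; omega), ← inv_Gamma_mul_Gamma_neg hħ,
        ← neg_div, neg_sub]
    rw [prod_congr rfl h1]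
    rcases le_or_gt N 1 with h | h
    · rw [Ico_eq_empty_of_le h, Ico_eq_empty_of_le (by omega)]
    · rw [prod_eq_prod_Ico_succ_bot h]
      simp

/-! ### The matrix element is an integral of the kernel -/

/-- The heights of the contour on which the Mellin-Barnes integral is the matrix element. -/
def baseHeight (ħ : ℝ) (N : ℕ) (i : GZIndex N) : ℝ := ħ * ((N : ℝ) - (i.1 : ℕ)) / 2

theorem gzArray_baseHeight (a : Fin N → ℂ) (v : GZIndex N → ℝ) {n k : ℕ} (hn : n ≤ N)
    (hk : k < n) : gzArray a (fun i => v i + baseHeight ħ N i * Complex.I) n k =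
      gzArray a (fun i => (v i : ℂ)) n k + Complex.I * ħ * (((N : ℂ) - n) / 2) := by
  rcases hn.eq_or_lt with rfl | hn
  · simp [gzArray_top _ _ hk]
  · rw [gzArray_of_lt _ _ hn hk, gzArray_of_lt _ _ hn hk, baseHeight]
    push_cast
    ring

theorem levelSum_baseHeight (a : Fin N → ℂ) (v : GZIndex N → ℝ) {n : ℕ} (hn : n ≤ N) :
    levelSum a (fun i => v i + baseHeight ħ N i * Complex.I) n =
      levelSum a (fun i => (v i : ℂ)) n + n * (Complex.I * ħ * (((N : ℂ) - n) / 2)) := by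
  rw [levelSum, levelSum, sum_congr rfl fun k hk =>
    gzArray_baseHeight (ħ := ħ) a v hn (mem_range.1 hk), sum_add_distrib]
  simp

theorem diagE_eq (a : Fin N → ℂ) (n : Fin N) (g : GZIndex N → ℂ) : diagE ħ a n g =
    1 / (Complex.I * ħ) * (levelSum a g ((n : ℕ) + 1) - levelSum a g n) := rfl

/-- Level `n` contributes `n (N - n) / 2` to the height of its sum; successive differences of these
numbers are the `rho N n`, which accounts for the factor `e^{-x·ρ}`. -/
theorem waveExponent_baseHeight (hħ : 0 < ħ) (a : Fin N → ℂ) (x : Fin N → ℝ) (v : GZIndex N → ℝ) :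
    waveExponent ħ a x (fun i => v i + baseHeight ħ N i * Complex.I) =
      -((∑ k, x k * rho N k : ℝ) : ℂ) + -∑ k, (x k : ℂ) * diagE ħ a k (fun i => (v i : ℂ)) := by
  have hħ' : (ħ : ℂ) ≠ 0 := by exact_mod_cast hħ.ne'
  have h1 : ∀ n : Fin N, Complex.I / ħ *
      ((levelSum a (fun i => v i + baseHeight ħ N i * Complex.I) ((n : ℕ) + 1) -
        levelSum a (fun i => v i + baseHeight ħ N i * Complex.I) n) * (x n : ℂ)) =
      -(((x n * rho N n : ℝ) : ℂ)) + -((x n : ℂ) * diagE ħ a n (fun i => (v i : ℂ))) := by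
    intro n
    rw [levelSum_baseHeight a v n.2, levelSum_baseHeight a v n.2.le, diagE_eq, rho]
    push_cast
    field_simp
    ring_nf
    simp only [Complex.I_sq, show Complex.I ^ 3 = -Complex.I by
      rw [pow_succ, Complex.I_sq]; ring]
    ring
  rw [waveExponent, mul_sum, sum_congr rfl fun n _ => h1 n, sum_add_distrib, sum_neg_distrib,
    sum_neg_distrib]
  push_cast
  rfl

theorem sFactor_baseHeight (hħ : 0 < ħ) (a : Fin N → ℂ) (v : GZIndex N → ℝ) {n : ℕ}
    (hn : n ∈ Ico 1 N) : sFactor ħ a n (fun i => (v i : ℂ)) =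
      ∏ k ∈ range n, ∏ m ∈ range (n + 1), crossFactor ħ 0 n k
        (gzArray a (fun i => v i + baseHeight ħ N i * Complex.I) n k -
          gzArray a (fun i => v i + baseHeight ħ N i * Complex.I) (n + 1) m) := by
  have hħ' : (ħ : ℂ) ≠ 0 := by exact_mod_cast hħ.ne'
  obtain ⟨h1, h2⟩ := mem_Ico.1 hn
  refine prod_congr rfl fun k hk => prod_congr rfl fun m hm => ?_
  rw [crossFactor_zero (by omega), gzArray_baseHeight a v h2.le (mem_range.1 hk),
    gzArray_baseHeight a v h2 (mem_range.1 hm), gammaFactor]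
  have : (gzArray a (fun i => (v i : ℂ)) n k + Complex.I * ħ * (((N : ℂ) - n) / 2) -
      (gzArray a (fun i => (v i : ℂ)) (n + 1) m + Complex.I * ħ * (((N : ℂ) - (n + 1 : ℕ)) / 2))) /
      (Complex.I * ħ) = (gzArray a (fun i => (v i : ℂ)) n k -
      gzArray a (fun i => (v i : ℂ)) (n + 1) m) / (Complex.I * ħ) + 1 / 2 := by
    push_cast
    field_simp
    ring
  rw [this]

theorem sub_mul_exp_sub_exp (hħ : 0 < ħ) (p r : ℂ) :
    (p - r) * (Complex.exp (2 * Real.pi * p / ħ) - Complex.exp (2 * Real.pi * r / ħ)) =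
      (2 * Real.pi * ħ) * ((p - r) * sinhFactor ħ (p - r)) *
        Complex.exp (Real.pi / ħ * (p + r)) := by
  have hħ' : (ħ : ℂ) ≠ 0 := by exact_mod_cast hħ.ne'
  have hpi : (Real.pi : ℂ) ≠ 0 := by exact_mod_cast Real.pi_ne_zero
  have e1 : 2 * Real.pi * p / ħ = Real.pi / ħ * (p + r) + Real.pi * (p - r) / ħ := by
    field_simp; ring
  have e2 : 2 * Real.pi * r / ħ = Real.pi / ħ * (p + r) + -(Real.pi * (p - r) / ħ) := by
    field_simp; ring
  rw [e1, e2, Complex.exp_add, Complex.exp_add, sinhFactor, Complex.sinh]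
  field_simp

theorem sum_pairs_add (n : ℕ) (f : ℕ → ℂ) :
    ∑ r ∈ range n, ∑ p ∈ range r, (f p + f r) = ((n : ℂ) - 1) * ∑ j ∈ range n, f j := by
  induction n with
  | zero => simp
  | succ n ih =>
    rw [sum_range_succ, ih, sum_range_succ _ n, sum_add_distrib]
    simp
    ring

theorem prod_pairs_const (n : ℕ) (c : ℂ) :
    ∏ r ∈ range n, ∏ _p ∈ range r, c = c ^ n.choose 2 := by
  simp only [prod_const, card_range]
  rw [prod_pow_eq_pow_sum (range n) (fun x => x) c, sum_range_id, Nat.choose_two_right]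

theorem sum_choose_two (N : ℕ) : ∑ n ∈ Ico 2 N, n.choose 2 = N.choose 3 := by
  induction N with
  | zero => simp
  | succ N ih =>
    rcases lt_or_ge N 2 with h | h
    · interval_cases N <;> simp [Nat.choose]
    · rw [sum_Ico_succ_top h, ih, Nat.choose_succ_succ' N 2, add_comm]

/-- Each pair in `μ₀` is `2πħ` times a pair factor times `exp((π/ħ)(γ_p + γ_r))`. Over a level these
exponents add up to `n - 1` times the level sum and cancel the prefactor of `w_N`. The constants
give the exponent `∑ (n choose 2) = N choose 3`. -/
theorem mu0_baseHeight (hħ : 0 < ħ) (a : Fin N → ℂ) (v : GZIndex N → ℝ) :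
    mu0 ħ (fun i : GZIndex N => (v i : ℂ)) *
      Complex.exp (-(Real.pi / ħ : ℂ) * ∑ n ∈ Ico 1 N, ((n : ℂ) - 1) *
        ∑ j ∈ range n, gzArray a (fun i => (v i : ℂ)) n j) =
      ((2 * Real.pi * ħ : ℝ) : ℂ) ^ N.choose 3 * ∏ n ∈ Ico 2 N, ∏ r ∈ range n, ∏ p ∈ range r,
        pairFactor ħ 0 n p r (gzArray a (fun i => v i + baseHeight ħ N i * Complex.I) n p -
          gzArray a (fun i => v i + baseHeight ħ N i * Complex.I) n r) := by
  set f := gzArray a (fun i => (v i : ℂ)) with hf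
  have h1 : mu0 ħ (fun i : GZIndex N => (v i : ℂ)) = ∏ n ∈ Ico 2 N, ∏ r ∈ range n, ∏ p ∈ range r,
      ((2 * Real.pi * ħ) * pairFactor ħ 0 n p r
        (gzArray a (fun i => v i + baseHeight ħ N i * Complex.I) n p -
          gzArray a (fun i => v i + baseHeight ħ N i * Complex.I) n r) *
        Complex.exp (Real.pi / ħ * (f n p + f n r))) := by
    refine prod_congr rfl fun n hn => prod_congr rfl fun r hr => prod_congr rfl fun p hp => ?_
    obtain ⟨hn1, hn2⟩ := mem_Ico.1 hn
    have hr' : r < n := mem_range.1 hr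
    have hp' : p < n := (mem_range.1 hp).trans hr'
    rw [sub_mul_exp_sub_exp hħ, pairFactor_zero (by omega), gzArray_baseHeight a v hn2.le hp',
      gzArray_baseHeight a v hn2.le hr', add_sub_add_right_eq_sub, hf]
    simp only [gzArray_of_lt _ _ hn2 hp', gzArray_of_lt _ _ hn2 hr']
  have h2 : ∑ n ∈ Ico 1 N, ((n : ℂ) - 1) * ∑ j ∈ range n, f n j =
      ∑ n ∈ Ico 2 N, ((n : ℂ) - 1) * ∑ j ∈ range n, f n j := by
    rcases le_or_gt N 1 with h | h
    · rw [Ico_eq_empty_of_le h, Ico_eq_empty_of_le (by omega)]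
    · rw [sum_eq_sum_Ico_succ_bot h]
      simp
  rw [h1, h2]
  simp only [prod_mul_distrib, ← Complex.exp_sum, ← mul_sum, sum_pairs_add, prod_pairs_const,
    prod_pow_eq_pow_sum, sum_choose_two]
  rw [mul_assoc, ← Complex.exp_add, neg_mul, add_neg_cancel, Complex.exp_zero, mul_one]
  push_cast
  simp only [mul_pow]

theorem exp_mul_pairingIntegrand (hħ : 0 < ħ) (a : Fin N → ℂ) (x : Fin N → ℝ)
    (v : GZIndex N → ℝ) :
    Complex.exp (-((∑ k, x k * rho N k : ℝ) : ℂ)) *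
      pairingIntegrand ħ (whittakerDual N) (cartanTorus ħ a x (whittaker ħ a)) v =
      ((2 * Real.pi * ħ : ℝ) : ℂ) ^ N.choose 3 *
        kernel ħ 0 a x (fun i => v i + baseHeight ħ N i * Complex.I) := by
  rw [pairingIntegrand, cartanTorus, whittaker, kernel, gzProd, waveExponent_baseHeight hħ,
    Complex.exp_add, prod_congr rfl fun n hn => sFactor_baseHeight hħ a v hn, whittakerDual,
    map_one]
  have := mu0_baseHeight hħ a v
  linear_combination (Complex.exp (-((∑ k, x k * rho N k : ℝ) : ℂ)) *
    Complex.exp (-∑ k, (x k : ℂ) * diagE ħ a k (fun i => (v i : ℂ))) *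
    ∏ n ∈ Ico 1 N, ∏ k ∈ range n, ∏ m ∈ range (n + 1), crossFactor ħ 0 n k
        (gzArray a (fun i => v i + baseHeight ħ N i * Complex.I) n k -
          gzArray a (fun i => v i + baseHeight ħ N i * Complex.I) (n + 1) m)) * this

theorem psi_eq_integral_kernel (hħ : 0 < ħ) (a : Fin N → ℂ) (x : Fin N → ℝ) :
    psi ħ a x = ((2 * Real.pi * ħ : ℝ) : ℂ) ^ N.choose 3 *
      ∫ v : GZIndex N → ℝ, kernel ħ 0 a x (fun i => v i + baseHeight ħ N i * Complex.I) := by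
  rw [psi, pairing, ← MeasureTheory.integral_const_mul, ← MeasureTheory.integral_const_mul]
  simp only [exp_mul_pairingIntegrand hħ]

end TodaGZ

end

noncomputable section

namespace TodaGZ

open Finset MeasureTheory Filter Topology

variable {N : ℕ} {ħ : ℝ}

/-! ### Entire functions of subexponential growth -/

/-- Entire functions of subexponential growth. -/
def Subexponential (P : (GZIndex N → ℂ) → ℂ) : Prop :=
  Differentiable ℂ P ∧ ∀ ε > 0, ∃ C, 0 ≤ C ∧ ∀ g, ‖P g‖ ≤ C * Real.exp (ε * ∑ i, ‖g i‖)

namespace Subexponential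

variable {P Q : (GZIndex N → ℂ) → ℂ}

theorem sum_norm_nonneg (g : GZIndex N → ℂ) : 0 ≤ ∑ i, ‖g i‖ := sum_nonneg fun _ _ => norm_nonneg _

theorem const (c : ℂ) : Subexponential fun _ : GZIndex N → ℂ => c :=
  ⟨differentiable_const c, fun ε hε => ⟨‖c‖, norm_nonneg _, fun g =>
    le_mul_of_one_le_right (norm_nonneg _) (Real.one_le_exp (by
      have := sum_norm_nonneg g
      positivity))⟩⟩

theorem mul (hP : Subexponential P) (hQ : Subexponential Q) : Subexponential fun g => P g * Q g := by
  refine ⟨hP.1.mul hQ.1, fun ε hε => ?_⟩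
  obtain ⟨C, hC, h1⟩ := hP.2 (ε / 2) (half_pos hε)
  obtain ⟨D, hD, h2⟩ := hQ.2 (ε / 2) (half_pos hε)
  refine ⟨C * D, by positivity, fun g => ?_⟩
  rw [norm_mul]
  refine (mul_le_mul (h1 g) (h2 g) (norm_nonneg _) (by positivity)).trans_eq ?_
  rw [mul_mul_mul_comm, ← Real.exp_add]
  congr 2
  ring

theorem add (hP : Subexponential P) (hQ : Subexponential Q) : Subexponential fun g => P g + Q g := by
  refine ⟨hP.1.add hQ.1, fun ε hε => ?_⟩
  obtain ⟨C, hC, h1⟩ := hP.2 ε hε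
  obtain ⟨D, hD, h2⟩ := hQ.2 ε hε
  refine ⟨C + D, by positivity, fun g => (norm_add_le _ _).trans ?_⟩
  rw [add_mul]
  exact add_le_add (h1 g) (h2 g)

theorem sub (hP : Subexponential P) (hQ : Subexponential Q) : Subexponential fun g => P g - Q g := by
  have := hP.add ((const (-1)).mul hQ)
  simpa [sub_eq_add_neg] using this

theorem sum {ι : Type*} (s : Finset ι) {P : ι → (GZIndex N → ℂ) → ℂ}
    (h : ∀ i ∈ s, Subexponential (P i)) : Subexponential fun g => ∑ i ∈ s, P i g := by
  classical
  induction s using Finset.induction_on with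
  | empty => simpa using const 0
  | insert i s hi ih =>
    simp only [sum_insert hi]
    exact (h i (mem_insert_self _ _)).add (ih fun j hj => h j (mem_insert_of_mem hj))

theorem prod {ι : Type*} (s : Finset ι) {P : ι → (GZIndex N → ℂ) → ℂ}
    (h : ∀ i ∈ s, Subexponential (P i)) : Subexponential fun g => ∏ i ∈ s, P i g := by
  classical
  induction s using Finset.induction_on with
  | empty => simpa using const 1
  | insert i s hi ih =>
    simp only [prod_insert hi]
    exact (h i (mem_insert_self _ _)).mul (ih fun j hj => h j (mem_insert_of_mem hj))

theorem coord (i : GZIndex N) : Subexponential fun g => g i := by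
  refine ⟨differentiable_apply i, fun ε hε => ⟨1 / ε, by positivity, fun g => ?_⟩⟩
  have h1 : ‖g i‖ ≤ ∑ i, ‖g i‖ :=
    single_le_sum (f := fun i => ‖g i‖) (fun _ _ => norm_nonneg _) (mem_univ i)
  have h2 := Real.add_one_le_exp (ε * ∑ i, ‖g i‖)
  rw [one_div, inv_mul_eq_div, le_div_iff₀ hε]
  nlinarith

theorem gzArray (a : Fin N → ℂ) (n k : ℕ) : Subexponential fun g => gzArray a g n k := by
  unfold TodaGZ.gzArray
  split_ifs
  · exact coord _
  · exact const _
  · exact const _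
  · exact const _

theorem levelSum (a : Fin N → ℂ) (n : ℕ) : Subexponential fun g => levelSum a g n :=
  sum _ fun j _ => gzArray a n j

end Subexponential

/-! ### Decay of the kernel on tubes -/

/-- Half of the decay rate pays for `P`, whatever subexponential function it is; the imaginary parts
contribute only a constant. -/
theorem exists_norm_mul_kernel_le (hN : 1 ≤ N) (hħ : 0 < ħ) : ∃ δ > 0,
    ∀ P : (GZIndex N → ℂ) → ℂ, Subexponential P → ∀ s₀ > 0, ∀ L R X, 0 ≤ R →
    ∃ C, 0 ≤ C ∧ ∀ (κ : ℕ × ℕ) (a : Fin N → ℂ) (g : GZIndex N → ℂ) (x : Fin N → ℝ),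
      AwayFromPoles ħ κ s₀ a g → (∀ n j, |(gzArray a g n j).im| ≤ L) → (∀ j, |(a j).re| ≤ R) →
      (∀ n, |x n| ≤ X) → ‖P g * kernel ħ κ a x g‖ ≤ C * Real.exp (-δ * ∑ i, |(g i).re|) := by
  obtain ⟨δ, hδ, h⟩ := exists_norm_kernel_le hN hħ
  refine ⟨δ / 2, half_pos hδ, fun P hP s₀ hs₀ L R X hR => ?_⟩
  obtain ⟨C, hC, hK⟩ := h s₀ hs₀ L R X hR
  obtain ⟨D, hD, hPD⟩ := hP.2 (δ / 2) (half_pos hδ)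
  refine ⟨D * C * Real.exp (δ / 2 * (Fintype.card (GZIndex N) * L)), by positivity,
    fun κ a g x h1 hL ha hx => ?_⟩
  have h2 : ∑ i, ‖g i‖ ≤ ∑ i, |(g i).re| + Fintype.card (GZIndex N) * L := by
    have : ∑ _i : GZIndex N, L = Fintype.card (GZIndex N) * L := by simp
    rw [← this, ← sum_add_distrib]
    refine sum_le_sum fun i _ => (Complex.norm_le_abs_re_add_abs_im _).trans ?_
    obtain ⟨⟨n, hn⟩, ⟨k, hk⟩⟩ := i
    have := hL n k
    rw [gzArray_of_lt a g hn hk] at this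
    linarith
  rw [norm_mul]
  calc _ ≤ (D * Real.exp (δ / 2 * (∑ i, |(g i).re| + Fintype.card (GZIndex N) * L))) *
        (C * Real.exp (-δ * ∑ i, |(g i).re|)) := by
        refine mul_le_mul ((hPD g).trans ?_) (hK κ a g x h1 hL ha hx) (norm_nonneg _) (by positivity)
        gcongr
    _ = D * C * (Real.exp (δ / 2 * (∑ i, |(g i).re| + Fintype.card (GZIndex N) * L)) *
        Real.exp (-δ * ∑ i, |(g i).re|)) := by ring
    _ = D * C * (Real.exp (δ / 2 * (Fintype.card (GZIndex N) * L)) *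
        Real.exp (-(δ / 2) * ∑ i, |(g i).re|)) := by
        rw [← Real.exp_add, ← Real.exp_add]; congr 2; ring
    _ = _ := by ring

theorem abs_im_gzArray_le {a : Fin N → ℂ} {g : GZIndex N → ℂ} {L : ℝ} (hL : 0 ≤ L)
    (ha : ∀ j, |(a j).im| ≤ L) (hg : ∀ i, |(g i).im| ≤ L) (n k : ℕ) :
    |(gzArray a g n k).im| ≤ L := by
  rcases gzArray_cases a g n k with ⟨i, hi⟩ | ⟨i, hi⟩ | hi <;> rw [hi]
  · exact hg i
  · exact ha i
  · simpa using hL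

theorem im_gzArray_congr (a : Fin N → ℂ) {g g' : GZIndex N → ℂ} (h : ∀ i, (g i).im = (g' i).im)
    (n k : ℕ) : (gzArray a g n k).im = (gzArray a g' n k).im := by
  unfold gzArray
  split_ifs
  · exact h _
  · rfl
  · rfl
  · rfl

theorem awayFromPoles_congr {κ : ℕ × ℕ} {s₀ : ℝ} {a : Fin N → ℂ} {g g' : GZIndex N → ℂ}
    (h : ∀ i, (g i).im = (g' i).im) :
    AwayFromPoles ħ κ s₀ a g ↔ AwayFromPoles ħ κ s₀ a g' := by
  simp only [AwayFromPoles, Complex.sub_im, im_gzArray_congr a h]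

/-- The imaginary parts for which the kernel is holomorphic. -/
def regularHeights (ħ : ℝ) (κ : ℕ × ℕ) (a : Fin N → ℂ) : Set (GZIndex N → ℝ) :=
  {y | ∀ n ∈ Ico 1 N, ∀ k ∈ range n, ∀ m ∈ range (n + 1),
    0 < (gzArray a (fun i => y i * Complex.I) n k -
      gzArray a (fun i => y i * Complex.I) (n + 1) m).im + if κ = (n, k) then ħ else 0}

theorem continuousAt_gzArray {E : Type*} [TopologicalSpace E] {α : E → Fin N → ℂ}
    {β : E → GZIndex N → ℂ} {e : E} (hα : ContinuousAt α e) (hβ : ContinuousAt β e) (n k : ℕ) :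
    ContinuousAt (fun e => gzArray (α e) (β e) n k) e := by
  unfold gzArray
  split_ifs
  · exact continuousAt_pi.1 hβ _
  · exact continuousAt_const
  · exact continuousAt_pi.1 hα _
  · exact continuousAt_const

/-- Finitely many strict inequalities between continuous functions persist nearby with a common
margin. -/
theorem exists_awayFromPoles {E : Type*} [TopologicalSpace E] {α : E → Fin N → ℂ}
    {β : E → GZIndex N → ℂ} {e : E} (hα : ContinuousAt α e) (hβ : ContinuousAt β e) {κ : ℕ × ℕ}
    (h : ∀ n ∈ Ico 1 N, ∀ k ∈ range n, ∀ m ∈ range (n + 1),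
      0 < (gzArray (α e) (β e) n k - gzArray (α e) (β e) (n + 1) m).im +
        if κ = (n, k) then ħ else 0) :
    ∃ s₀ > 0, ∀ᶠ e' in 𝓝 e, AwayFromPoles ħ κ s₀ (α e') (β e') := by
  have h1 : ∀ᶠ p in (𝓝[>] (0 : ℝ)) ×ˢ 𝓝 e, AwayFromPoles ħ κ p.1 (α p.2) (β p.2) := by
    simp only [AwayFromPoles, Filter.eventually_all_finset]
    intro n hn k hk m hm
    have h2 : ContinuousAt (fun e => (gzArray (α e) (β e) n k -
        gzArray (α e) (β e) (n + 1) m).im + if κ = (n, k) then ħ else 0) e :=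
      (Complex.continuous_im.continuousAt.comp ((continuousAt_gzArray hα hβ n k).sub
        (continuousAt_gzArray hα hβ (n + 1) m))).add continuousAt_const
    have h3 : Tendsto (fun p : ℝ × E => p.1) ((𝓝[>] (0 : ℝ)) ×ˢ 𝓝 e) (𝓝 0) :=
      (tendsto_id.mono_left nhdsWithin_le_nhds).comp tendsto_fst
    exact (h3.eventually_lt (h2.tendsto.comp tendsto_snd) (h n hn k hk m hm)).mono
      fun p hp => hp.le
  obtain ⟨s₀, h2, h3⟩ := (h1.curry.and self_mem_nhdsWithin).exists
  exact ⟨s₀, h3, h2⟩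

theorem isOpen_regularHeights (κ : ℕ × ℕ) (a : Fin N → ℂ) : IsOpen (regularHeights ħ κ a) := by
  refine isOpen_iff_mem_nhds.2 fun y hy => ?_
  have hβ : Continuous fun y : GZIndex N → ℝ => fun i => (y i * Complex.I : ℂ) := by fun_prop
  obtain ⟨s₀, hs₀, h⟩ := exists_awayFromPoles (α := fun _ : GZIndex N → ℝ => a)
    continuousAt_const (hβ.continuousAt (x := y)) hy
  exact h.mono fun y' h n hn k hk m hm => hs₀.trans_le (h n hn k hk m hm)

theorem im_gzArray_combo (a : Fin N → ℂ) (y y' : GZIndex N → ℝ) {p q : ℝ} (hpq : p + q = 1)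
    (n k : ℕ) : (gzArray a (fun i => ((p • y + q • y') i : ℝ) * Complex.I) n k).im =
      p * (gzArray a (fun i => y i * Complex.I) n k).im +
        q * (gzArray a (fun i => y' i * Complex.I) n k).im := by
  unfold gzArray
  split_ifs
  · simp
  · simp
  · rw [← add_mul, hpq, one_mul]
  · simp

theorem convex_regularHeights (κ : ℕ × ℕ) (a : Fin N → ℂ) : Convex ℝ (regularHeights ħ κ a) := by
  intro y hy y' hy' p q hp hq hpq n hn k hk m hm
  have h1 := hy n hn k hk m hm
  have h2 := hy' n hn k hk m hm
  simp only [Complex.sub_im] at h1 h2 ⊢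
  rw [im_gzArray_combo a y y' hpq, im_gzArray_combo a y y' hpq]
  obtain ⟨t, ht⟩ : ∃ t : ℝ, t = if κ = (n, k) then ħ else 0 := ⟨_, rfl⟩
  rw [← ht] at h1 h2 ⊢
  have h3 := convex_Ioi (0 : ℝ) h1 h2 hp hq hpq
  have h4 := Set.mem_Ioi.1 h3
  simp only [smul_eq_mul] at h4
  linear_combination h4 + t * hpq

theorem tubeDecay_mul_kernel (hN : 1 ≤ N) (hħ : 0 < ħ) (κ : ℕ × ℕ) (a : Fin N → ℂ)
    (x : Fin N → ℝ) {P : (GZIndex N → ℂ) → ℂ} (hP : Subexponential P) :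
    TubeDecay (fun g => P g * kernel ħ κ a x g) (regularHeights ħ κ a) := by
  intro y hy
  have hβ : Continuous fun y : GZIndex N → ℝ => fun i => (y i * Complex.I : ℂ) := by fun_prop
  obtain ⟨s₀, hs₀, h⟩ := exists_awayFromPoles (α := fun _ : GZIndex N → ℝ => a)
    continuousAt_const (hβ.continuousAt (x := y)) hy
  obtain ⟨r, hr, hrb⟩ := Metric.eventually_nhds_iff_ball.1 h
  obtain ⟨δ, hδ, hK⟩ := exists_norm_mul_kernel_le hN hħ
  obtain ⟨C, hC, hb⟩ := hK P hP s₀ hs₀ (‖a‖ + ‖y‖ + r) ‖a‖ ‖x‖ (norm_nonneg _)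
  refine ⟨r, hr, C, δ, hδ, fun z hz => hb κ a z x ?_ (abs_im_gzArray_le (by positivity) ?_ ?_) ?_ ?_⟩
  · exact (awayFromPoles_congr fun i => by simp).1 (hrb _ hz)
  · intro j
    have := (Complex.abs_im_le_norm (a j)).trans (norm_le_pi_norm a j)
    linarith [norm_nonneg y]
  · intro i
    have h1 : ‖fun i => (z i).im‖ ≤ ‖y‖ + r := by
      have := norm_sub_norm_le (fun i => (z i).im) y
      rw [Metric.mem_ball, dist_eq_norm] at hz
      linarith
    have := norm_le_pi_norm (fun i => (z i).im) i
    rw [Real.norm_eq_abs] at this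
    linarith [norm_nonneg a]
  · exact fun j => (Complex.abs_re_le_norm (a j)).trans (norm_le_pi_norm a j)
  · exact fun n => norm_le_pi_norm x n

theorem differentiableAt_mul_kernel (hħ : 0 < ħ) (κ : ℕ × ℕ) (a : Fin N → ℂ)
    (x : Fin N → ℝ) {P : (GZIndex N → ℂ) → ℂ} (hP : Subexponential P) (z : GZIndex N → ℂ)
    (hz : (fun i => (z i).im) ∈ regularHeights ħ κ a) :
    DifferentiableAt ℂ (fun g => P g * kernel ħ κ a x g) z := by
  obtain ⟨s₀, hs₀, h⟩ := exists_awayFromPoles (E := Unit) (α := fun _ => a)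
    (β := fun _ i => ((z i).im * Complex.I : ℂ)) (e := ()) continuousAt_const continuousAt_const hz
  refine (hP.1 z).mul ?_
  exact differentiableAt_kernel (α := fun _ : GZIndex N → ℂ => a) (β := fun z => z) hħ
    (differentiableAt_const _) differentiableAt_fun_id κ x hs₀
    ((awayFromPoles_congr fun i => by simp).1 h.self_of_nhds)

theorem integrable_mul_kernel (hN : 1 ≤ N) (hħ : 0 < ħ) {κ : ℕ × ℕ} {a : Fin N → ℂ}
    (x : Fin N → ℝ) {P : (GZIndex N → ℂ) → ℂ} (hP : Subexponential P) {c : GZIndex N → ℝ}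
    (hc : c ∈ regularHeights ħ κ a) :
    Integrable fun v : GZIndex N → ℝ => P (fun i => v i + c i * Complex.I) *
      kernel ħ κ a x (fun i => v i + c i * Complex.I) :=
  integrable_tube_slice (differentiableAt_mul_kernel hħ κ a x hP)
    (tubeDecay_mul_kernel hN hħ κ a x hP) hc

theorem integral_mul_kernel_shift (hN : 1 ≤ N) (hħ : 0 < ħ) {κ : ℕ × ℕ} {a : Fin N → ℂ}
    (x : Fin N → ℝ) {P : (GZIndex N → ℂ) → ℂ} (hP : Subexponential P) {c c' : GZIndex N → ℝ}
    (hc : c ∈ regularHeights ħ κ a) (hc' : c' ∈ regularHeights ħ κ a) :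
    ∫ v : GZIndex N → ℝ, P (fun i => v i + c i * Complex.I) *
        kernel ħ κ a x (fun i => v i + c i * Complex.I) =
      ∫ v : GZIndex N → ℝ, P (fun i => v i + c' i * Complex.I) *
        kernel ħ κ a x (fun i => v i + c' i * Complex.I) :=
  integral_tube_shift (isOpen_regularHeights κ a) (convex_regularHeights κ a)
    (differentiableAt_mul_kernel hħ κ a x hP) (tubeDecay_mul_kernel hN hħ κ a x hP) hc hc'

theorem mem_regularHeights_of_admissible {a : Fin N → ℂ} {c : GZIndex N → ℝ}
    (hc : AdmissibleHeights a c) : c ∈ regularHeights ħ 0 a := by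
  intro n hn k hk m hm
  have := hc n (mem_Ico.1 hn).2 k (mem_range.1 hk) m (mem_range.1 hm)
  rw [if_neg fun h => (by have := (mem_Ico.1 hn).1; have := congrArg Prod.fst h; simp at this; omega),
    Complex.sub_im]
  linarith

/-- Consecutive integrated levels are `ħ / 2` apart, and level `N - 1` lies at `ħ / 2`, so the last
inequality is exactly the condition defining `labelDomain`. -/
theorem admissible_baseHeight (hħ : 0 < ħ) {a : Fin N → ℂ} (ha : a ∈ labelDomain N ħ) :
    AdmissibleHeights a (baseHeight ħ N) := by
  intro n hn k hk m hm
  have h1 : (gzArray a (fun i => (baseHeight ħ N i : ℂ) * Complex.I) n k).im =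
      ħ * ((N : ℝ) - n) / 2 := by
    rw [gzArray_of_lt _ _ hn hk]; simp [baseHeight]
  rw [h1]
  rcases (Nat.succ_le_of_lt hn).eq_or_lt with h | h
  · have h2 : (N : ℝ) - n = 1 := by rw [← h]; push_cast; ring
    rw [h2, show n + 1 = N from h, gzArray_top _ _ (by omega), mul_one]
    exact ha _
  · rw [gzArray_of_lt _ _ h hm]
    simp only [baseHeight, Complex.mul_im, Complex.ofReal_re, Complex.I_im, Complex.ofReal_im,
      Complex.I_re, mul_zero, mul_one, add_zero]
    push_cast
    linarith

/-! ### Holomorphy in the label -/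

theorem isOpen_labelDomain : IsOpen (labelDomain N ħ) := by
  simp only [labelDomain, Set.ofPred_forall]
  exact isOpen_iInter_of_finite fun j =>
    isOpen_lt (Complex.continuous_im.comp (continuous_apply j)) continuous_const

/-- One fixed contour serves all labels of the domain, so only the integrand depends on the label
and the kernel bound is locally uniform in it. -/
theorem differentiableOn_psi (hN : 1 ≤ N) (hħ : 0 < ħ) (x : Fin N → ℝ) :
    DifferentiableOn ℂ (fun a : Fin N → ℂ => psi ħ a x) (labelDomain N ħ) := by
  simp only [psi_eq_integral_kernel hħ]
  refine DifferentiableOn.const_mul ?_ _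
  have hreg : ∀ a ∈ labelDomain N ħ, baseHeight ħ N ∈ regularHeights ħ 0 a := fun a ha =>
    mem_regularHeights_of_admissible (admissible_baseHeight hħ ha)
  have him : ∀ (v : GZIndex N → ℝ) (i : GZIndex N), ((baseHeight ħ N i : ℂ) * Complex.I).im =
      ((v i : ℂ) + (baseHeight ħ N i : ℂ) * Complex.I).im := fun v i => by simp
  have hloc := fun a (ha : a ∈ labelDomain N ħ) => exists_awayFromPoles (ħ := ħ) (e := a)
    (α := fun a => a) (β := fun _ i => (baseHeight ħ N i * Complex.I : ℂ)) continuousAt_id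
    continuousAt_const (hreg a ha)
  refine differentiableOn_integral_of_locally_dominated isOpen_labelDomain (fun v a ha => ?_)
    (fun a ha => ?_) (fun a ha => ?_)
  · obtain ⟨s₀, hs₀, h⟩ := hloc a ha
    exact (differentiableAt_kernel (α := fun a => a) hħ differentiableAt_fun_id
      (differentiableAt_const _) 0 x hs₀
      ((awayFromPoles_congr (him v)).1 h.self_of_nhds)).differentiableWithinAt
  · have := (integrable_mul_kernel hN hħ x (Subexponential.const 1) (hreg a ha)).1
    simpa using this
  · obtain ⟨s₀, hs₀, h⟩ := hloc a ha
    obtain ⟨r, hr, hrb⟩ := Metric.eventually_nhds_iff_ball.1 h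
    obtain ⟨δ, hδ, hK⟩ := exists_norm_kernel_le hN hħ
    obtain ⟨C, hC, hb⟩ := hK s₀ hs₀ (‖a‖ + r + ‖baseHeight ħ N‖) (‖a‖ + r) ‖x‖ (by positivity)
    refine ⟨r, hr, fun v => C * Real.exp (-δ * ∑ i, |v i|),
      (integrable_exp_neg_mul_sum_abs hδ).const_mul C, ae_of_all _ fun v b hbr => ?_⟩
    have hbn : ‖b‖ ≤ ‖a‖ + r := by
      have := norm_sub_norm_le b a
      rw [Metric.mem_ball, dist_eq_norm] at hbr
      linarith
    have := hb 0 b (fun i => v i + baseHeight ħ N i * Complex.I) x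
      ((awayFromPoles_congr (him v)).1 (hrb b hbr)) (abs_im_gzArray_le (by positivity) ?_ ?_) ?_ ?_
    · simpa using this
    · intro j
      have := (Complex.abs_im_le_norm (b j)).trans (norm_le_pi_norm b j)
      linarith [norm_nonneg (baseHeight ħ N)]
    · intro i
      have := norm_le_pi_norm (baseHeight ħ N) i
      rw [← him v i]
      simp only [Complex.mul_im, Complex.ofReal_re, Complex.I_im, Complex.ofReal_im,
        Complex.I_re, mul_zero, mul_one, add_zero]
      rw [← Real.norm_eq_abs]
      linarith [norm_nonneg a]
    · exact fun j => ((Complex.abs_re_le_norm (b j)).trans (norm_le_pi_norm b j)).trans hbn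
    · exact fun n => norm_le_pi_norm x n

end TodaGZ

end

noncomputable section

namespace TodaGZ

open Finset MeasureTheory Filter Topology
open scoped ContDiff

variable {N : ℕ} {ħ : ℝ}

/-! ### Moments of the kernel and their derivatives -/

/-- The point of the base contour with real part `v`. -/
def basePoint (ħ : ℝ) (v : GZIndex N → ℝ) (i : GZIndex N) : ℂ :=
  v i + baseHeight ħ N i * Complex.I

/-- The integral of the kernel against `P` over the base contour. -/
def moment (ħ : ℝ) (a : Fin N → ℂ) (P : (GZIndex N → ℂ) → ℂ) (x : Fin N → ℝ) : ℂ :=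
  ∫ v : GZIndex N → ℝ, P (basePoint ħ v) * kernel ħ 0 a x (basePoint ħ v)

/-- The symbol of the momentum `p_n`. -/
def momentumSymbol (a : Fin N → ℂ) (n : Fin N) (g : GZIndex N → ℂ) : ℂ :=
  levelSum a g ((n : ℕ) + 1) - levelSum a g n

theorem Subexponential.momentumSymbol (a : Fin N → ℂ) (n : Fin N) :
    Subexponential (momentumSymbol a n) :=
  (Subexponential.levelSum a _).sub (Subexponential.levelSum a _)

theorem integrable_moment (hN : 1 ≤ N) (hħ : 0 < ħ) {a : Fin N → ℂ} (ha : a ∈ labelDomain N ħ)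
    (x : Fin N → ℝ) {P : (GZIndex N → ℂ) → ℂ} (hP : Subexponential P) :
    Integrable fun v => P (basePoint ħ v) * kernel ħ 0 a x (basePoint ħ v) :=
  integrable_mul_kernel hN hħ x hP
    (mem_regularHeights_of_admissible (admissible_baseHeight hħ ha))

theorem exists_norm_mul_kernel_basePoint_le (hN : 1 ≤ N) (hħ : 0 < ħ) {a : Fin N → ℂ}
    (ha : a ∈ labelDomain N ħ) {P : (GZIndex N → ℂ) → ℂ} (hP : Subexponential P) (X : ℝ) :
    ∃ B : (GZIndex N → ℝ) → ℝ, Integrable B ∧ ∀ x : Fin N → ℝ, ‖x‖ ≤ X → ∀ v,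
      ‖P (basePoint ħ v) * kernel ħ 0 a x (basePoint ħ v)‖ ≤ B v := by
  obtain ⟨s₀, hs₀, h⟩ := exists_awayFromPoles (E := Unit) (α := fun _ => a)
    (β := fun _ i => (baseHeight ħ N i * Complex.I : ℂ)) (e := ()) continuousAt_const
    continuousAt_const (mem_regularHeights_of_admissible (admissible_baseHeight hħ ha))
  obtain ⟨δ, hδ, hK⟩ := exists_norm_mul_kernel_le hN hħ
  obtain ⟨C, hC, hb⟩ := hK P hP s₀ hs₀ (‖a‖ + ‖baseHeight ħ N‖) ‖a‖ X (norm_nonneg _)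
  refine ⟨fun v => C * Real.exp (-δ * ∑ i, |v i|), (integrable_exp_neg_mul_sum_abs hδ).const_mul C,
    fun x hx v => ?_⟩
  have := hb 0 a (basePoint ħ v) x ((awayFromPoles_congr fun i => by simp [basePoint]).1
    h.self_of_nhds) (abs_im_gzArray_le (by positivity) ?_ ?_) ?_ ?_
  · simpa [basePoint] using this
  · intro j
    have := (Complex.abs_im_le_norm (a j)).trans (norm_le_pi_norm a j)
    linarith [norm_nonneg (baseHeight ħ N)]
  · intro i
    have h1 := norm_le_pi_norm (baseHeight ħ N) i
    have h2 : (basePoint ħ v i).im = baseHeight ħ N i := by simp [basePoint]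
    rw [h2, ← Real.norm_eq_abs]
    linarith [norm_nonneg a]
  · exact fun j => (Complex.abs_re_le_norm (a j)).trans (norm_le_pi_norm a j)
  · exact fun n => (norm_le_pi_norm x n).trans hx

/-- The `n`-th coordinate as a complex-valued real-linear functional. -/
def coordCLM (n : Fin N) : (Fin N → ℝ) →L[ℝ] ℂ :=
  Complex.ofRealCLM.comp (ContinuousLinearMap.proj n)

theorem hasFDerivAt_kernel (κ : ℕ × ℕ) (a : Fin N → ℂ) (g : GZIndex N → ℂ) (x : Fin N → ℝ) :
    HasFDerivAt (fun x => kernel ħ κ a x g)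
      (∑ n, (Complex.I / ħ * (momentumSymbol a n g * kernel ħ κ a x g)) • coordCLM n) x := by
  have h1 : HasFDerivAt (fun x => waveExponent ħ a x g)
      ((Complex.I / ħ) • ∑ n : Fin N, momentumSymbol a n g • coordCLM n) x := by
    refine HasFDerivAt.const_mul ?_ _
    refine HasFDerivAt.fun_sum fun n _ => ?_
    exact HasFDerivAt.const_mul (coordCLM n).hasFDerivAt _
  refine (h1.cexp.const_mul (gzProd (crossFactor ħ κ) (pairFactor ħ κ) a g)).congr_fderiv ?_
  ext w
  simp only [smul_apply, _root_.sum_apply, smul_eq_mul, mul_sum, kernel]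
  refine sum_congr rfl fun n _ => ?_
  ring

/-- Differentiating the plane wave multiplies `P` by `momentumSymbol`, which stays in the
subexponential class, so the differentiated integrand is dominated for `x` in a bounded set. -/
theorem hasFDerivAt_moment (hN : 1 ≤ N) (hħ : 0 < ħ) {a : Fin N → ℂ} (ha : a ∈ labelDomain N ħ)
    {P : (GZIndex N → ℂ) → ℂ} (hP : Subexponential P) (x : Fin N → ℝ) :
    HasFDerivAt (moment ħ a P) (∑ n, (Complex.I / ħ *
      moment ħ a (fun g => P g * momentumSymbol a n g) x) • coordCLM n) x := by
  have hPn := fun n => hP.mul (Subexponential.momentumSymbol a n)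
  choose B hB hBb using fun n =>
    exists_norm_mul_kernel_basePoint_le hN hħ ha (hPn n) (‖x‖ + 1)
  set F' : (Fin N → ℝ) → (GZIndex N → ℝ) → (Fin N → ℝ) →L[ℝ] ℂ := fun x v =>
    ∑ n, (Complex.I / ħ * (P (basePoint ħ v) * momentumSymbol a n (basePoint ħ v) *
      kernel ħ 0 a x (basePoint ħ v))) • coordCLM n with hF'
  have hint : ∀ n, Integrable fun v => (Complex.I / ħ * (P (basePoint ħ v) *
      momentumSymbol a n (basePoint ħ v) * kernel ħ 0 a x (basePoint ħ v))) • coordCLM n :=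
    fun n => ((integrable_moment hN hħ ha x (hPn n)).const_mul _).smul_const _
  have key := hasFDerivAt_integral_of_dominated_of_fderiv_le (𝕜 := ℝ) (μ := volume)
    (F := fun x v => P (basePoint ħ v) * kernel ħ 0 a x (basePoint ħ v)) (F' := F')
    (bound := fun v => ∑ n, ‖(Complex.I / ħ : ℂ)‖ * B n v * ‖coordCLM n‖)
    (Metric.ball_mem_nhds x one_pos)
    (Eventually.of_forall fun x => (integrable_moment hN hħ ha x hP).1)
    (integrable_moment hN hħ ha x hP) (Finset.aestronglyMeasurable_fun_sum _ fun n _ => (hint n).1)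
    (ae_of_all _ fun v y hy => ?_)
    (integrable_finsetSum _ fun n _ => ((hB n).const_mul _).mul_const _)
    (ae_of_all _ fun v y hy => ?_)
  · refine key.congr_fderiv ?_
    rw [hF', integral_finsetSum _ fun n _ => hint n]
    refine sum_congr rfl fun n _ => ?_
    rw [integral_smul_const, integral_const_mul, moment]
  · have hyn : ‖y‖ ≤ ‖x‖ + 1 := by
      have := norm_sub_norm_le y x
      rw [Metric.mem_ball, dist_eq_norm] at hy
      linarith
    refine (norm_sum_le _ _).trans (sum_le_sum fun n _ => ?_)
    rw [norm_smul]
    gcongr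
    exact (norm_mul_le _ _).trans (mul_le_mul_of_nonneg_left (hBb n y hyn v) (norm_nonneg _))
  · refine ((hasFDerivAt_kernel 0 a (basePoint ħ v) y).const_mul (P (basePoint ħ v))).congr_fderiv ?_
    rw [hF', smul_sum]
    refine sum_congr rfl fun n _ => ?_
    rw [smul_smul]
    congr 1
    ring

/-- The derivative is a combination of moments of the same kind, so the induction on the order runs
over all `P` at once. -/
theorem contDiff_moment (hN : 1 ≤ N) (hħ : 0 < ħ) {a : Fin N → ℂ} (ha : a ∈ labelDomain N ħ)
    {P : (GZIndex N → ℂ) → ℂ} (hP : Subexponential P) : ContDiff ℝ ∞ (moment ħ a P) := by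
  rw [contDiff_infty]
  intro k
  induction k generalizing P with
  | zero =>
    exact contDiff_zero.2 (continuous_iff_continuousAt.2 fun x =>
      (hasFDerivAt_moment hN hħ ha hP x).continuousAt)
  | succ k ih =>
    refine contDiff_succ_iff_hasFDerivAt.2 ⟨_, ?_, hasFDerivAt_moment hN hħ ha hP⟩
    exact ContDiff.sum fun n _ => (contDiff_const.mul
      (ih (hP.mul (Subexponential.momentumSymbol a n)))).smul contDiff_const

/-- Moments as smooth functions. -/
def smoothMoment (hN : 1 ≤ N) (hħ : 0 < ħ) {a : Fin N → ℂ} (ha : a ∈ labelDomain N ħ)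
    {P : (GZIndex N → ℂ) → ℂ} (hP : Subexponential P) : SmoothFn N :=
  ⟨moment ħ a P, contDiff_moment hN hħ ha hP⟩

theorem momentum_smoothMoment (hN : 1 ≤ N) (hħ : 0 < ħ) {a : Fin N → ℂ}
    (ha : a ∈ labelDomain N ħ) {P : (GZIndex N → ℂ) → ℂ} (hP : Subexponential P) (n : Fin N) :
    momentum ħ n (smoothMoment hN hħ ha hP) =
      smoothMoment hN hħ ha (hP.mul (Subexponential.momentumSymbol a n)) := by
  have hħ' : (ħ : ℂ) ≠ 0 := by exact_mod_cast hħ.ne'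
  ext x
  change -Complex.I * ħ * fderiv ℝ (moment ħ a P) x (Pi.single n 1) =
    moment ħ a (fun g => P g * momentumSymbol a n g) x
  rw [(hasFDerivAt_moment hN hħ ha hP x).fderiv, _root_.sum_apply, sum_eq_single n]
  · simp only [smul_apply, coordCLM, ContinuousLinearMap.comp_apply, ContinuousLinearMap.proj_apply,
      Pi.single_eq_same, Complex.ofRealCLM_apply, Complex.ofReal_one, smul_eq_mul, mul_one]
    field_simp
    linear_combination -(moment ħ a (fun g => P g * momentumSymbol a n g) x) * Complex.I_sq
  · intro m _ hm
    simp [coordCLM, hm]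
  · simp

end TodaGZ

end

/-! ### Interpolation identities and difference equations of the kernel -/

noncomputable section

namespace TodaGZ

open Finset

variable {N : ℕ} {ħ : ℝ}

/-! ### Lagrange interpolation -/

open Polynomial in
theorem eval_eq_sum_lagrange {n : ℕ} {y : ℕ → ℂ} (hy : Set.InjOn y (range n)) {Q : ℂ[X]}
    (hQ : Q.degree < n) (u : ℂ) :
    Q.eval u = ∑ j ∈ range n, (∏ s ∈ (range n).erase j, (u - y s) / (y j - y s)) * Q.eval (y j) := by
  have h := Lagrange.eq_interpolate (s := range n) (v := y) (f := Q) hy (by simpa using hQ)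
  conv_lhs => rw [h]
  rw [Lagrange.interpolate_apply, eval_finsetSum]
  refine sum_congr rfl fun j _ => ?_
  rw [eval_mul, eval_C, Lagrange.basis, eval_prod, mul_comm]
  congr 1
  refine prod_congr rfl fun s _ => ?_
  rw [Lagrange.basisDivisor, eval_mul, eval_C, eval_sub, eval_X, eval_C, div_eq_inv_mul]

open Polynomial in
theorem prod_sub_eq_sum_lagrange {n : ℕ} {y : ℕ → ℂ} (hy : Set.InjOn y (range (n + 1)))
    (z : ℕ → ℂ) (u : ℂ) : ∏ k ∈ range n, (u - z k) = ∑ j ∈ range (n + 1),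
      (∏ s ∈ (range (n + 1)).erase j, (u - y s) / (y j - y s)) * ∏ k ∈ range n, (y j - z k) := by
  have h := eval_eq_sum_lagrange hy (Q := ∏ k ∈ range n, (X - C (z k))) (by
    rw [degree_prod]
    simp only [degree_X_sub_C, sum_const, card_range, nsmul_eq_mul, mul_one]
    exact_mod_cast Nat.lt_succ_self n) u
  simpa [eval_prod] using h

open Polynomial in
-- Monic polynomials of degree `n + 1` with equal sums of roots agree in their two leading
-- coefficients.
theorem degree_prod_sub_prod_lt {n : ℕ} (w w' : ℕ → ℂ)
    (h : ∑ l ∈ range (n + 1), w l = ∑ l ∈ range (n + 1), w' l) :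
    (∏ l ∈ range (n + 1), (X - C (w l)) - ∏ l ∈ range (n + 1), (X - C (w' l))).degree < (n : WithBot ℕ) := by
  have hdeg : ∀ w : ℕ → ℂ, (∏ l ∈ range (n + 1), (X - C (w l))).natDegree = n + 1 := fun w => by
    rw [natDegree_prod_of_monic _ _ fun i _ => monic_X_sub_C _]
    simp
  have hcoef : ∀ w : ℕ → ℂ, (∏ l ∈ range (n + 1), (X - C (w l))).coeff n =
      -∑ l ∈ range (n + 1), w l := fun w => by
    rw [← prod_X_sub_C_nextCoeff, nextCoeff_of_natDegree_pos (by rw [hdeg]; omega), hdeg,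
      Nat.add_sub_cancel]
  have htop : ∀ w : ℕ → ℂ, (∏ l ∈ range (n + 1), (X - C (w l))).coeff (n + 1) = 1 := fun w => by
    have := (monic_prod_of_monic (range (n + 1)) _ fun i _ => monic_X_sub_C (w i)).coeff_natDegree
    rwa [hdeg] at this
  rw [degree_lt_iff_coeff_zero]
  intro m hm
  rw [coeff_sub]
  rcases lt_trichotomy m (n + 1) with h1 | rfl | h1
  · obtain rfl : m = n := by omega
    rw [hcoef, hcoef, h, sub_self]
  · rw [htop, htop, sub_self]
  · rw [coeff_eq_zero_of_natDegree_lt (by rw [hdeg]; exact h1),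
      coeff_eq_zero_of_natDegree_lt (by rw [hdeg]; exact h1), sub_self]

open Polynomial in
theorem prod_sub_eq_add_sum_lagrange {n : ℕ} {y : ℕ → ℂ} (hy : Set.InjOn y (range n))
    (w : ℕ → ℂ) (u : ℂ) : ∏ l ∈ range (n + 1), (u - w l) =
      (u - (∑ l ∈ range (n + 1), w l - ∑ s ∈ range n, y s)) * ∏ s ∈ range n, (u - y s) +
      ∑ j ∈ range n, (∏ s ∈ (range n).erase j, (u - y s) / (y j - y s)) *
        ∏ l ∈ range (n + 1), (y j - w l) := by
  set t := ∑ l ∈ range (n + 1), w l - ∑ s ∈ range n, y s with ht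
  -- The comparison polynomial has the nodes `y` as roots, plus one more root `t` chosen so that the
  -- sums of roots agree. It vanishes at the nodes, hence drops out of the interpolation.
  set w' : ℕ → ℂ := fun l => if l = n then t else y l with hw'
  have hlow : ∀ s ∈ range n, w' s = y s := fun s hs => if_neg (mem_range.1 hs).ne
  have hsum : ∑ l ∈ range (n + 1), w l = ∑ l ∈ range (n + 1), w' l := by
    rw [sum_range_succ w', sum_congr rfl hlow, hw']
    simp [ht]
  have h := eval_eq_sum_lagrange hy (degree_prod_sub_prod_lt w w' hsum) u
  have hw : ∀ v : ℂ, ∏ l ∈ range (n + 1), (v - w' l) = (v - t) * ∏ s ∈ range n, (v - y s) := by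
    intro v
    rw [prod_range_succ, prod_congr rfl fun s hs => by rw [hlow s hs], mul_comm]
    simp [hw']
  simp only [eval_sub, eval_prod, eval_X, eval_C, hw] at h
  rw [← sub_eq_iff_eq_add', h]
  refine sum_congr rfl fun j hj => ?_
  rw [prod_eq_zero hj (sub_self (y j)), mul_zero, sub_zero]

/-! ### Products supported at one position of the array -/

theorem prod_cross_ite_upper {n j : ℕ} (hn : n ∈ Ico 1 N) (hj : j < n) (f : ℕ → ℂ) :
    ∏ n' ∈ Ico 1 N, ∏ k ∈ range n', ∏ m ∈ range (n' + 1), (if (n, j) = (n', k) then f m else 1) =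
      ∏ m ∈ range (n + 1), f m := by
  rw [prod_eq_single_of_mem n hn, prod_eq_single_of_mem j (mem_range.2 hj)]
  · simp
  · intro k _ hk
    exact prod_eq_one fun m _ => if_neg fun h => hk (congrArg Prod.snd h).symm
  · intro n' _ hn'
    exact prod_eq_one fun k _ => prod_eq_one fun m _ =>
      if_neg fun h => hn' (congrArg Prod.fst h).symm

theorem prod_cross_ite_lower {n j : ℕ} (hn : n < N) (hj : j < n + 1) (f : ℕ → ℂ) :
    ∏ n' ∈ Ico 1 N, ∏ k ∈ range n', ∏ m ∈ range (n' + 1),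
      (if (n + 1, j) = (n' + 1, m) then f k else 1) = ∏ k ∈ range n, f k := by
  have hne : ∀ n', n' ≠ n → ∏ k ∈ range n', ∏ m ∈ range (n' + 1),
      (if (n + 1, j) = (n' + 1, m) then f k else 1) = 1 := fun n' hn' =>
    prod_eq_one fun k _ => prod_eq_one fun m _ =>
      if_neg fun h => hn' (by have := congrArg Prod.fst h; simp at this; omega)
  -- For `n = 0` the marked entry lies on level `1`, below which there is no level; both sides are
  -- empty products.
  rcases Nat.eq_zero_or_pos n with rfl | hn0
  · rw [range_zero, prod_empty]
    exact prod_eq_one fun n' hn' => hne n' (by have := (mem_Ico.1 hn').1; omega)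
  · rw [prod_eq_single_of_mem n (mem_Ico.2 ⟨hn0, hn⟩) fun n' _ hn' => hne n' hn']
    refine prod_congr rfl fun k _ => ?_
    rw [prod_eq_single_of_mem j (mem_range.2 hj)]
    · simp
    · intro m _ hm
      exact if_neg fun h => hm (congrArg Prod.snd h).symm

theorem prod_pairs_ite_level (n j : ℕ) (f : ℕ → ℂ) :
    ∏ r ∈ range n, ∏ p ∈ range r, (if j = p then f r else if j = r then f p else 1) =
      if j < n then ∏ s ∈ (range n).erase j, f s else 1 := by
  induction n with
  | zero => simp
  | succ n ih =>
    rw [prod_range_succ, ih]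
    rcases lt_trichotomy j n with h | rfl | h
    · rw [if_pos h, if_pos (by omega), range_add_one, erase_insert_of_ne h.ne',
        prod_insert (by simp), mul_comm]
      congr 1
      rw [prod_eq_single_of_mem j (mem_range.2 h)]
      · simp
      · intro p _ hp
        rw [if_neg (Ne.symm hp), if_neg h.ne]
    · rw [if_neg (lt_irrefl _), if_pos (Nat.lt_succ_self _), range_add_one,
        erase_insert notMem_range_self, one_mul]
      refine prod_congr rfl fun p hp => ?_
      rw [if_neg (mem_range.1 hp).ne', if_pos rfl]
    · rw [if_neg (by omega), if_neg (by omega), one_mul]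
      refine prod_eq_one fun p hp => ?_
      rw [if_neg (by have := mem_range.1 hp; omega), if_neg (by omega)]

theorem prod_pairs_ite {n j : ℕ} (hn : n ∈ Ico 1 N) (hj : j < n) (f : ℕ → ℂ) :
    ∏ n' ∈ Ico 2 N, ∏ r ∈ range n', ∏ p ∈ range r,
      (if (n, j) = (n', p) then f r else if (n, j) = (n', r) then f p else 1) =
      ∏ s ∈ (range n).erase j, f s := by
  have hne : ∀ n', n' ≠ n → ∏ r ∈ range n', ∏ p ∈ range r,
      (if (n, j) = (n', p) then f r else if (n, j) = (n', r) then f p else 1) = 1 := fun n' hn' =>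
    prod_eq_one fun r _ => prod_eq_one fun p _ => by
      rw [if_neg fun h => hn' (congrArg Prod.fst h).symm,
        if_neg fun h => hn' (congrArg Prod.fst h).symm]
  obtain ⟨hn1, hn2⟩ := mem_Ico.1 hn
  rcases hn1.eq_or_lt with rfl | hn1
  · obtain rfl : j = 0 := by omega
    rw [prod_eq_one fun n' hn' => hne n' (by have := (mem_Ico.1 hn').1; omega)]
    simp
  · rw [prod_eq_single_of_mem n (mem_Ico.2 ⟨hn1, hn2⟩) fun n' _ hn' => hne n' hn']
    simp only [Prod.mk.injEq, true_and]
    rw [prod_pairs_ite_level, if_pos hj]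

/-! ### Regularization and shift of the kernel -/

theorem crossFactor_eq_mul {κ : ℕ × ℕ} (hħ : 0 < ħ) {n k : ℕ} (hn : n ≠ 0) {z : ℂ} (hz : z ≠ 0) :
    crossFactor ħ κ n k z = (if κ = (n, k) then z else 1) * crossFactor ħ 0 n k z := by
  rw [crossFactor_zero hn, crossFactor]
  split_ifs
  · rw [gammaFactor_add hħ hz]
    linear_combination -z * gammaFactor ħ z * Complex.I_sq
  · rw [one_mul]

/-- The kernel has no zero arguments in the cross factors. -/
def CrossNeZero (a : Fin N → ℂ) (g : GZIndex N → ℂ) : Prop :=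
  ∀ n ∈ Ico 1 N, ∀ k ∈ range n, ∀ m ∈ range (n + 1), gzArray a g n k - gzArray a g (n + 1) m ≠ 0

theorem prod_pairFactor {n j : ℕ} (hn : n ∈ Ico 1 N) (hj : j < n) (a : Fin N → ℂ)
    (g : GZIndex N → ℂ) :
    (∏ n' ∈ Ico 2 N, ∏ r ∈ range n', ∏ p ∈ range r,
        pairFactor ħ (n, j) n' p r (gzArray a g n' p - gzArray a g n' r)) *
        ∏ s ∈ (range n).erase j, (gzArray a g n j - gzArray a g n s) =
      ∏ n' ∈ Ico 2 N, ∏ r ∈ range n', ∏ p ∈ range r,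
        pairFactor ħ 0 n' p r (gzArray a g n' p - gzArray a g n' r) := by
  rw [← prod_pairs_ite hn hj fun s => gzArray a g n j - gzArray a g n s]
  simp only [← prod_mul_distrib]
  refine prod_congr rfl fun n' hn' => prod_congr rfl fun r hr => prod_congr rfl fun p hp => ?_
  rw [pairFactor_zero (by have := (mem_Ico.1 hn').1; omega), pairFactor]
  split_ifs with h1 h2
  · obtain ⟨rfl, rfl⟩ := Prod.mk.inj h1
    exact mul_comm _ _
  · obtain ⟨rfl, rfl⟩ := Prod.mk.inj h2
    ring
  · exact mul_one _

/-- The marked kernel is the plain one times the coefficient at node `γ_{nj}` in the interpolation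
of the level above, stated without division so that coinciding entries are allowed. -/
theorem kernel_regularized (hħ : 0 < ħ) {n j : ℕ} (hn : n ∈ Ico 1 N) (hj : j < n)
    {a : Fin N → ℂ} {g : GZIndex N → ℂ} (hg : CrossNeZero a g) (x : Fin N → ℝ) :
    kernel ħ (n, j) a x g * ∏ s ∈ (range n).erase j, (gzArray a g n j - gzArray a g n s) =
      (∏ l ∈ range (n + 1), (gzArray a g n j - gzArray a g (n + 1) l)) * kernel ħ 0 a x g := by
  have h1 : ∏ n' ∈ Ico 1 N, ∏ k ∈ range n', ∏ m ∈ range (n' + 1),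
      crossFactor ħ (n, j) n' k (gzArray a g n' k - gzArray a g (n' + 1) m) =
      (∏ l ∈ range (n + 1), (gzArray a g n j - gzArray a g (n + 1) l)) *
        ∏ n' ∈ Ico 1 N, ∏ k ∈ range n', ∏ m ∈ range (n' + 1),
          crossFactor ħ 0 n' k (gzArray a g n' k - gzArray a g (n' + 1) m) := by
    rw [← prod_cross_ite_upper hn hj fun l => gzArray a g n j - gzArray a g (n + 1) l]
    simp only [← prod_mul_distrib]
    refine prod_congr rfl fun n' hn' => prod_congr rfl fun k hk => prod_congr rfl fun m hm => ?_
    rw [crossFactor_eq_mul hħ (by have := (mem_Ico.1 hn').1; omega) (hg n' hn' k hk m hm)]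
    congr 1
    split_ifs with h
    · obtain ⟨rfl, rfl⟩ := Prod.mk.inj h
      rfl
    · rfl
  rw [kernel, gzProd, kernel, gzProd, h1, ← prod_pairFactor hn hj]
  ring

/-- Translation of the entry `(n, j)` by `-iħ`. -/
def shiftEntry (ħ : ℝ) (i : GZIndex N) (g : GZIndex N → ℂ) : GZIndex N → ℂ :=
  Function.update g i (g i - Complex.I * ħ)

theorem gzArray_shiftEntry (a : Fin N → ℂ) (g : GZIndex N → ℂ) {n j : ℕ} (hn : n < N) (hj : j < n)
    (n' k : ℕ) : gzArray a (shiftEntry ħ ⟨⟨n, hn⟩, ⟨j, hj⟩⟩ g) n' k =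
      gzArray a g n' k - if (n, j) = (n', k) then Complex.I * ħ else 0 := by
  by_cases h : (n, j) = (n', k)
  · obtain ⟨rfl, rfl⟩ := Prod.mk.inj h
    rw [gzArray_of_lt _ _ hn hj, gzArray_of_lt _ _ hn hj, if_pos rfl]
    simp [shiftEntry]
  · rw [if_neg h, sub_zero]
    unfold gzArray
    split_ifs with h1 h2
    · refine Function.update_of_ne (fun h3 => h ?_) _ _
      rw [Sigma.mk.injEq] at h3
      obtain ⟨h4, h5⟩ := h3
      obtain rfl : n' = n := by simpa using h4
      have : k = j := by simpa using h5
      rw [this]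
    all_goals rfl

theorem levelSum_shiftEntry (a : Fin N → ℂ) (g : GZIndex N → ℂ) {n j : ℕ} (hn : n < N)
    (hj : j < n) (n' : ℕ) : levelSum a (shiftEntry ħ ⟨⟨n, hn⟩, ⟨j, hj⟩⟩ g) n' =
      levelSum a g n' - if n = n' then Complex.I * ħ else 0 := by
  simp only [levelSum, gzArray_shiftEntry, sum_sub_distrib, Prod.mk.injEq]
  congr 1
  split_ifs with h
  · subst h
    simp [hj]
  · simp [h]

theorem waveExponent_shiftEntry (hħ : 0 < ħ) (a : Fin N → ℂ) (x : Fin N → ℝ) (g : GZIndex N → ℂ)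
    {n j : ℕ} (hn : n + 1 < N) (hj : j < n + 1) :
    waveExponent ħ a x (shiftEntry ħ ⟨⟨n + 1, hn⟩, ⟨j, hj⟩⟩ g) =
      waveExponent ħ a x g + (x ⟨n, by omega⟩ - x ⟨n + 1, hn⟩ : ℝ) := by
  have hħ' : (ħ : ℂ) ≠ 0 := by exact_mod_cast hħ.ne'
  have h1 : ∀ m : Fin N, (levelSum a (shiftEntry ħ ⟨⟨n + 1, hn⟩, ⟨j, hj⟩⟩ g) ((m : ℕ) + 1) -
      levelSum a (shiftEntry ħ ⟨⟨n + 1, hn⟩, ⟨j, hj⟩⟩ g) m) * (x m : ℂ) =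
      (levelSum a g ((m : ℕ) + 1) - levelSum a g m) * (x m : ℂ) +
        ((if (⟨n + 1, hn⟩ : Fin N) = m then Complex.I * ħ * x m else 0) -
          if (⟨n, by omega⟩ : Fin N) = m then Complex.I * ħ * x m else 0) := by
    intro m
    rw [levelSum_shiftEntry, levelSum_shiftEntry]
    simp only [Nat.add_right_cancel_iff, Fin.ext_iff]
    split_ifs <;> ring
  rw [waveExponent, sum_congr rfl fun m _ => h1 m, sum_add_distrib, sum_sub_distrib, waveExponent]
  simp only [sum_ite_eq, mem_univ, if_true]
  push_cast
  field_simp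
  linear_combination (ħ : ℂ) * ((x ⟨n + 1, hn⟩ : ℂ) - x ⟨n, by omega⟩) * Complex.I_sq

/-- The shift undoes the `+iħ` in the marked cross factors, creates the product over the level below
through the functional equation, flips the sign of the marked `sinh` factors and produces `e^{x_n -
x_{n+1}}` from the plane wave. -/
theorem kernel_shiftEntry (hħ : 0 < ħ) {n j : ℕ} (hn : n + 1 < N) (hj : j < n + 1)
    {a : Fin N → ℂ} {g : GZIndex N → ℂ} (hg : CrossNeZero a g) (x : Fin N → ℝ) :
    kernel ħ (n + 1, j) a x (shiftEntry ħ ⟨⟨n + 1, hn⟩, ⟨j, hj⟩⟩ g) *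
        ∏ s ∈ (range (n + 1)).erase j, (gzArray a g (n + 1) j - gzArray a g (n + 1) s) =
      -(Real.exp (x ⟨n, by omega⟩ - x ⟨n + 1, hn⟩) : ℂ) *
        (∏ k ∈ range n, (gzArray a g (n + 1) j - gzArray a g n k)) * kernel ħ 0 a x g := by
  set g' := shiftEntry ħ ⟨⟨n + 1, hn⟩, ⟨j, hj⟩⟩ g with hg'
  have hmem : n + 1 ∈ Ico 1 N := mem_Ico.2 ⟨by omega, hn⟩
  have hsh := gzArray_shiftEntry (ħ := ħ) a g hn hj
  have h1 : ∏ n' ∈ Ico 1 N, ∏ k ∈ range n', ∏ m ∈ range (n' + 1),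
      crossFactor ħ (n + 1, j) n' k (gzArray a g' n' k - gzArray a g' (n' + 1) m) =
      (Complex.I ^ (n + 2) * ∏ k ∈ range n,
        (-Complex.I * (gzArray a g n k - gzArray a g (n + 1) j))) *
        ∏ n' ∈ Ico 1 N, ∏ k ∈ range n', ∏ m ∈ range (n' + 1),
          crossFactor ħ 0 n' k (gzArray a g n' k - gzArray a g (n' + 1) m) := by
    have e1 : Complex.I ^ (n + 2) = ∏ _l ∈ range (n + 1 + 1), Complex.I := by simp
    rw [e1, ← prod_cross_ite_upper hmem hj fun _ => Complex.I,
      ← prod_cross_ite_lower (n := n) (by omega : n < N) hj fun k => -Complex.I * (gzArray a g n k - gzArray a g (n + 1) j)]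
    simp only [← prod_mul_distrib]
    refine prod_congr rfl fun n' hn' => prod_congr rfl fun k hk => prod_congr rfl fun m hm => ?_
    rw [crossFactor_zero (by have := (mem_Ico.1 hn').1; omega), crossFactor, hsh, hsh]
    by_cases h2 : (n + 1, j) = (n', k)
    · have h3 : (n + 1, j) ≠ (n' + 1, m) := fun h => by
        have := congrArg Prod.fst (h2.symm.trans h); simp at this
      rw [if_pos h2, if_pos h2, if_pos h2, if_neg h3, if_neg h3]
      ring_nf
    · rw [if_neg h2, if_neg h2, if_neg h2]
      by_cases h3 : (n + 1, j) = (n' + 1, m)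
      · obtain ⟨h4, rfl⟩ := Prod.mk.inj h3
        obtain rfl : n = n' := by omega
        rw [if_pos rfl, if_pos rfl, sub_zero, sub_sub_eq_add_sub, add_sub_right_comm,
          gammaFactor_add hħ (hg n hn' k hk j hm), one_mul]
      · rw [if_neg h3, if_neg h3]
        simp
  have h2 : ∏ n' ∈ Ico 2 N, ∏ r ∈ range n', ∏ p ∈ range r,
      pairFactor ħ (n + 1, j) n' p r (gzArray a g' n' p - gzArray a g' n' r) =
      (-1) ^ n * ∏ n' ∈ Ico 2 N, ∏ r ∈ range n', ∏ p ∈ range r,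
        pairFactor ħ (n + 1, j) n' p r (gzArray a g n' p - gzArray a g n' r) := by
    have e1 : (-1 : ℂ) ^ n = ∏ _s ∈ (range (n + 1)).erase j, (-1 : ℂ) := by
      rw [prod_const, card_erase_of_mem (mem_range.2 hj), card_range, Nat.add_sub_cancel]
    rw [e1, ← prod_pairs_ite hmem hj fun _ => (-1 : ℂ)]
    simp only [← prod_mul_distrib]
    refine prod_congr rfl fun n' hn' => prod_congr rfl fun r hr => prod_congr rfl fun p hp => ?_
    rw [pairFactor, pairFactor, hsh, hsh]
    by_cases h3 : (n + 1, j) = (n', p)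
    · have h4 : (n + 1, j) ≠ (n', r) := fun h => by
        have := congrArg Prod.snd (h3.symm.trans h)
        have := mem_range.1 hp
        simp at *; omega
      rw [if_pos h3, if_pos h3, if_pos h3, if_pos h3, if_neg h4, sub_zero, sub_right_comm,
        sinhFactor_sub hħ]
      ring
    · rw [if_neg h3, if_neg h3, if_neg h3, if_neg h3]
      by_cases h4 : (n + 1, j) = (n', r)
      · rw [if_pos h4, if_pos h4, if_pos h4, if_pos h4, sub_zero, sub_sub_eq_add_sub,
          add_sub_right_comm, sinhFactor_add hħ]
        ring
      · rw [if_neg h4, if_neg h4, if_neg h4, if_neg h4]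
        simp
  have h3 : ∏ k ∈ range n, (-Complex.I * (gzArray a g n k - gzArray a g (n + 1) j)) =
      Complex.I ^ n * ∏ k ∈ range n, (gzArray a g (n + 1) j - gzArray a g n k) := by
    have : Complex.I ^ n = ∏ _k ∈ range n, Complex.I := by simp
    rw [this, ← prod_mul_distrib]
    exact prod_congr rfl fun k _ => by ring
  -- The phases come from `n + 2` cross factors with the level above, `n` with the level below, and
  -- `n` pairs within the level.
  have h4 : Complex.I ^ (n + 2) * Complex.I ^ n * (-1) ^ n = -1 := by
    have : Complex.I ^ (n + 2) * Complex.I ^ n * (-1) ^ n =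
        (Complex.I ^ 2 * (-1)) ^ n * Complex.I ^ 2 := by ring
    rw [this, Complex.I_sq]
    simp
  have h5 := prod_pairFactor (ħ := ħ) hmem hj a g
  rw [kernel, gzProd, kernel, gzProd, h1, h2, h3, ← h5, hg', waveExponent_shiftEntry hħ a x g hn hj,
    Complex.exp_add, Complex.ofReal_exp]
  linear_combination ((∏ k ∈ range n, (gzArray a g (n + 1) j - gzArray a g n k)) *
    (∏ n' ∈ Ico 1 N, ∏ k ∈ range n', ∏ m ∈ range (n' + 1),
      crossFactor ħ 0 n' k (gzArray a g n' k - gzArray a g (n' + 1) m)) *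
    (∏ n' ∈ Ico 2 N, ∏ r ∈ range n', ∏ p ∈ range r,
      pairFactor ħ (n + 1, j) n' p r (gzArray a g n' p - gzArray a g n' r)) *
    (∏ s ∈ (range (n + 1)).erase j, (gzArray a g (n + 1) j - gzArray a g (n + 1) s)) *
    Complex.exp (waveExponent ħ a x g) *
    Complex.exp ((x ⟨n, by omega⟩ - x ⟨n + 1, hn⟩ : ℝ) : ℂ)) * h4

end TodaGZ

end

noncomputable section

namespace TodaGZ

open Finset MeasureTheory

variable {N : ℕ} {ħ : ℝ}

/-! ### The recursion for the moments -/

/-- The polynomial `∏ (u - γ_{nk})` of the level `n`. -/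
def levelPoly (a : Fin N → ℂ) (u : ℂ) (n : ℕ) (g : GZIndex N → ℂ) : ℂ :=
  ∏ k ∈ range n, (u - gzArray a g n k)

theorem Subexponential.levelPoly (a : Fin N → ℂ) (u : ℂ) (n : ℕ) :
    Subexponential (levelPoly a u n) :=
  Subexponential.prod _ fun k _ => (Subexponential.const u).sub (Subexponential.gzArray a n k)

/-- The product `∏ (u - γ_{ns})` without the factor `s = j`. -/
def levelPolyErase (a : Fin N → ℂ) (u : ℂ) (n j : ℕ) (g : GZIndex N → ℂ) : ℂ :=
  ∏ s ∈ (range n).erase j, (u - gzArray a g n s)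

theorem Subexponential.levelPolyErase (a : Fin N → ℂ) (u : ℂ) (n j : ℕ) :
    Subexponential (levelPolyErase a u n j) :=
  Subexponential.prod _ fun k _ => (Subexponential.const u).sub (Subexponential.gzArray a n k)

theorem crossNeZero_basePoint (hħ : 0 < ħ) {a : Fin N → ℂ} (ha : a ∈ labelDomain N ħ)
    (v : GZIndex N → ℝ) : CrossNeZero a (basePoint ħ v) := by
  intro n hn k hk m hm h
  have h1 := admissible_baseHeight hħ ha n (mem_Ico.1 hn).2 k (mem_range.1 hk) m (mem_range.1 hm)
  have him : ∀ i, ((baseHeight ħ N i : ℂ) * Complex.I).im = (basePoint ħ v i).im := fun i => by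
    simp [basePoint]
  rw [im_gzArray_congr a him, im_gzArray_congr a him, ← sub_pos, ← Complex.sub_im, h] at h1
  simp at h1

/-- The base heights, lowered by `ħ` at one entry. -/
def loweredHeight (ħ : ℝ) (i : GZIndex N) : GZIndex N → ℝ :=
  Function.update (baseHeight ħ N) i (baseHeight ħ N i - ħ)

theorem add_loweredHeight_eq_shiftEntry (i : GZIndex N) (v : GZIndex N → ℝ) :
    (fun i' => (v i' : ℂ) + loweredHeight ħ i i' * Complex.I) = shiftEntry ħ i (basePoint ħ v) := by
  ext i'
  by_cases h : i' = i
  · subst h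
    simp only [loweredHeight, shiftEntry, Function.update_self, basePoint]
    push_cast
    ring
  · simp only [loweredHeight, shiftEntry, Function.update_of_ne h, basePoint]

theorem baseHeight_mem_regularHeights (hħ : 0 < ħ) {a : Fin N → ℂ} (ha : a ∈ labelDomain N ħ)
    (κ : ℕ × ℕ) : baseHeight ħ N ∈ regularHeights ħ κ a := by
  intro n hn k hk m hm
  have h1 := admissible_baseHeight hħ ha n (mem_Ico.1 hn).2 k (mem_range.1 hk) m (mem_range.1 hm)
  rw [Complex.sub_im]
  split_ifs <;> linarith

/-- Lowering one entry by `ħ` widens its gap to the level below it in the index; its gap to the next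
level shrinks by `ħ`, exactly the slack granted by the mark. -/
theorem loweredHeight_mem_regularHeights (hħ : 0 < ħ) {a : Fin N → ℂ} (ha : a ∈ labelDomain N ħ)
    {n j : ℕ} (hn : n < N) (hj : j < n) :
    loweredHeight ħ ⟨⟨n, hn⟩, ⟨j, hj⟩⟩ ∈ regularHeights ħ (n, j) a := by
  intro n' hn' k hk m hm
  have h1 := admissible_baseHeight hħ ha n' (mem_Ico.1 hn').2 k (mem_range.1 hk) m (mem_range.1 hm)
  have h2 := add_loweredHeight_eq_shiftEntry (ħ := ħ) (⟨⟨n, hn⟩, ⟨j, hj⟩⟩ : GZIndex N) 0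
  simp only [Pi.zero_apply, Complex.ofReal_zero, zero_add] at h2
  have h3 : ∀ i, ((baseHeight ħ N i : ℂ) * Complex.I).im = (basePoint ħ (0 : GZIndex N → ℝ) i).im :=
    fun i => by simp [basePoint]
  rw [im_gzArray_congr a h3, im_gzArray_congr a h3] at h1
  rw [h2, gzArray_shiftEntry a _ hn hj, gzArray_shiftEntry a _ hn hj]
  split_ifs <;> simp <;> linarith

theorem integral_regularized_shift (hN : 1 ≤ N) (hħ : 0 < ħ) {a : Fin N → ℂ}
    (ha : a ∈ labelDomain N ħ) (x : Fin N → ℝ) {P : (GZIndex N → ℂ) → ℂ} (hP : Subexponential P)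
    {n j : ℕ} (hn : n < N) (hj : j < n) :
    ∫ v : GZIndex N → ℝ, P (basePoint ħ v) * kernel ħ (n, j) a x (basePoint ħ v) =
      ∫ v : GZIndex N → ℝ, P (shiftEntry ħ ⟨⟨n, hn⟩, ⟨j, hj⟩⟩ (basePoint ħ v)) *
        kernel ħ (n, j) a x (shiftEntry ħ ⟨⟨n, hn⟩, ⟨j, hj⟩⟩ (basePoint ħ v)) := by
  simp only [← add_loweredHeight_eq_shiftEntry]
  exact integral_mul_kernel_shift hN hħ x hP (baseHeight_mem_regularHeights hħ ha _)
    (loweredHeight_mem_regularHeights hħ ha hn hj)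

theorem integrable_regularized (hN : 1 ≤ N) (hħ : 0 < ħ) {a : Fin N → ℂ}
    (ha : a ∈ labelDomain N ħ) (x : Fin N → ℝ) {P : (GZIndex N → ℂ) → ℂ} (hP : Subexponential P)
    (κ : ℕ × ℕ) : Integrable fun v : GZIndex N → ℝ =>
      P (basePoint ħ v) * kernel ħ κ a x (basePoint ħ v) :=
  integrable_mul_kernel hN hħ x hP (baseHeight_mem_regularHeights hħ ha κ)

theorem integrable_regularized_shift (hN : 1 ≤ N) (hħ : 0 < ħ) {a : Fin N → ℂ}
    (ha : a ∈ labelDomain N ħ) (x : Fin N → ℝ) {P : (GZIndex N → ℂ) → ℂ} (hP : Subexponential P)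
    {n j : ℕ} (hn : n < N) (hj : j < n) : Integrable fun v : GZIndex N → ℝ =>
      P (shiftEntry ħ ⟨⟨n, hn⟩, ⟨j, hj⟩⟩ (basePoint ħ v)) *
        kernel ħ (n, j) a x (shiftEntry ħ ⟨⟨n, hn⟩, ⟨j, hj⟩⟩ (basePoint ħ v)) := by
  simp only [← add_loweredHeight_eq_shiftEntry]
  exact integrable_mul_kernel hN hħ x hP (loweredHeight_mem_regularHeights hħ ha hn hj)

theorem ae_ne {ι : Type*} [Fintype ι] {i j : ι} (hij : i ≠ j) :
    ∀ᵐ v : ι → ℝ, v i ≠ v j := by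
  classical
  set S : Submodule ℝ (ι → ℝ) :=
    LinearMap.ker (LinearMap.proj (R := ℝ) (φ := fun _ : ι => ℝ) i - LinearMap.proj j) with hS
  have h1 : S ≠ ⊤ := fun h => by
    have : Pi.single i (1 : ℝ) ∈ S := h ▸ Submodule.mem_top
    simp [hS, hij.symm] at this
  have h2 := Measure.addHaar_submodule (volume : Measure (ι → ℝ)) S h1
  refine Filter.mem_of_superset (compl_mem_ae_iff.2 h2) fun v hv h => hv ?_
  simp [hS, h]

/-- Coincidences of entries lie on finitely many hyperplanes, which are null, so the interpolation
may be used under the integral. -/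
theorem ae_injOn_level (a : Fin N → ℂ) {n : ℕ} (hn : n < N) :
    ∀ᵐ v : GZIndex N → ℝ, Set.InjOn (gzArray a (basePoint ħ v) n) (range n) := by
  have h : ∀ᵐ v : GZIndex N → ℝ, ∀ s t : Fin n, s ≠ t → v ⟨⟨n, hn⟩, s⟩ ≠ v ⟨⟨n, hn⟩, t⟩ := by
    refine ae_all_iff.2 fun s => ae_all_iff.2 fun t => ?_
    by_cases hst : s = t
    · simp [hst]
    · exact (ae_ne (i := (⟨⟨n, hn⟩, s⟩ : GZIndex N)) (j := ⟨⟨n, hn⟩, t⟩)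
        (fun h => hst (by simpa using h))).mono fun v hv _ => hv
  filter_upwards [h] with v hv s hs t ht hst
  have hs' : s < n := by simpa using hs
  have ht' : t < n := by simpa using ht
  by_contra hne
  rw [gzArray_of_lt _ _ hn hs', gzArray_of_lt _ _ hn ht'] at hst
  refine hv ⟨s, hs'⟩ ⟨t, ht'⟩ (by simpa using hne) ?_
  simpa [basePoint, baseHeight] using congrArg Complex.re hst

theorem prod_erase_sub_ne_zero {n j : ℕ} {y : ℕ → ℂ} (hy : Set.InjOn y (range n)) (hj : j ∈ range n) :
    ∏ s ∈ (range n).erase j, (y j - y s) ≠ 0 := by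
  refine prod_ne_zero_iff.2 fun s hs h => ?_
  obtain ⟨h1, h2⟩ := mem_erase.1 hs
  exact h1 (hy (by simpa using h2) (by simpa using hj) (sub_eq_zero.1 h).symm)

/-- Level `n + 2` interpolated at the entries of level `n + 1`: the two leading coefficients give
the term with `momentumSymbol`, the remainder the marked kernels. -/
theorem levelPoly_add_two_mul_kernel (hħ : 0 < ħ) {n : ℕ} (hn : n + 1 < N) {a : Fin N → ℂ}
    {g : GZIndex N → ℂ} (hg : CrossNeZero a g)
    (hinj : Set.InjOn (gzArray a g (n + 1)) (range (n + 1))) (u : ℂ) (x : Fin N → ℝ) :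
    levelPoly a u (n + 2) g * kernel ħ 0 a x g =
      levelPoly a u (n + 1) g * (u - momentumSymbol a ⟨n + 1, hn⟩ g) * kernel ħ 0 a x g +
      ∑ j ∈ range (n + 1), levelPolyErase a u (n + 1) j g * kernel ħ (n + 1, j) a x g := by
  have h1 := prod_sub_eq_add_sum_lagrange hinj (gzArray a g (n + 2)) u
  have h2 : ∀ j ∈ range (n + 1), (∏ s ∈ (range (n + 1)).erase j,
      (u - gzArray a g (n + 1) s) / (gzArray a g (n + 1) j - gzArray a g (n + 1) s)) *
      (∏ l ∈ range (n + 2), (gzArray a g (n + 1) j - gzArray a g (n + 2) l)) * kernel ħ 0 a x g =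
      levelPolyErase a u (n + 1) j g * kernel ħ (n + 1, j) a x g := by
    intro j hj
    have h3 := kernel_regularized hħ (mem_Ico.2 ⟨by omega, hn⟩) (mem_range.1 hj) hg x
    have h4 := prod_erase_sub_ne_zero hinj hj
    rw [prod_div_distrib, mul_assoc, ← h3, levelPolyErase]
    field_simp
  rw [← sum_congr rfl h2, ← sum_mul, levelPoly, h1, levelPoly, momentumSymbol, levelSum, levelSum]
  ring

/-- Level `n` interpolated at the same nodes, its coefficients absorbed into shifted marked kernels.
The factor `levelPolyErase` omits the shifted entry and so is unchanged. -/
theorem levelPoly_mul_kernel_eq_shift (hħ : 0 < ħ) {n : ℕ} (hn : n + 1 < N) {a : Fin N → ℂ}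
    {g : GZIndex N → ℂ} (hg : CrossNeZero a g)
    (hinj : Set.InjOn (gzArray a g (n + 1)) (range (n + 1))) (u : ℂ) (x : Fin N → ℝ) :
    (Real.exp (x ⟨n, by omega⟩ - x ⟨n + 1, hn⟩) : ℂ) * (levelPoly a u n g * kernel ħ 0 a x g) =
      -∑ j : Fin (n + 1),
        levelPolyErase a u (n + 1) j (shiftEntry ħ ⟨⟨n + 1, hn⟩, j⟩ g) *
          kernel ħ (n + 1, j) a x (shiftEntry ħ ⟨⟨n + 1, hn⟩, j⟩ g) := by
  have h1 := prod_sub_eq_sum_lagrange hinj (gzArray a g n) u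
  rw [levelPoly, h1, sum_range, sum_mul, mul_sum, ← sum_neg_distrib]
  refine sum_congr rfl fun j _ => ?_
  have h3 := kernel_shiftEntry hħ hn j.2 hg x
  have h4 := prod_erase_sub_ne_zero hinj (mem_range.2 j.2)
  have h5 : levelPolyErase a u (n + 1) j (shiftEntry ħ ⟨⟨n + 1, hn⟩, j⟩ g) =
      levelPolyErase a u (n + 1) j g := by
    refine prod_congr rfl fun s hs => ?_
    rw [gzArray_shiftEntry a g hn j.2, if_neg, sub_zero]
    exact fun h => (mem_erase.1 hs).1 (congrArg Prod.snd h).symm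
  rw [h5, prod_div_distrib, levelPolyErase]
  field_simp
  linear_combination (∏ s ∈ (range (n + 1)).erase (j : ℕ), (u - gzArray a g (n + 1) s)) * h3

/-- The two interpolation formulas leave sums of integrals of the same functions over the base
contour and over contours with one lowered entry; these agree by the contour shift. -/
theorem moment_levelPoly_add_two (hN : 1 ≤ N) (hħ : 0 < ħ) {a : Fin N → ℂ}
    (ha : a ∈ labelDomain N ħ) {n : ℕ} (hn : n + 1 < N) (u : ℂ) (x : Fin N → ℝ) :
    moment ħ a (levelPoly a u (n + 2)) x =
      moment ħ a (fun g => levelPoly a u (n + 1) g * (u - momentumSymbol a ⟨n + 1, hn⟩ g)) x -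
        (Real.exp (x ⟨n, by omega⟩ - x ⟨n + 1, hn⟩) : ℂ) * moment ħ a (levelPoly a u n) x := by
  have hinj := ae_injOn_level (ħ := ħ) a hn
  have hP := fun j => Subexponential.levelPolyErase a u (n + 1) j
  have hQ := (Subexponential.levelPoly a u (n + 1)).mul
    ((Subexponential.const u).sub (Subexponential.momentumSymbol a ⟨n + 1, hn⟩))
  have h1 : moment ħ a (levelPoly a u (n + 2)) x =
      moment ħ a (fun g => levelPoly a u (n + 1) g * (u - momentumSymbol a ⟨n + 1, hn⟩ g)) x +
        ∑ j : Fin (n + 1), ∫ v : GZIndex N → ℝ, levelPolyErase a u (n + 1) j (basePoint ħ v) *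
          kernel ħ (n + 1, j) a x (basePoint ħ v) := by
    rw [moment, moment, ← integral_finsetSum _ fun (j : Fin (n + 1)) _ =>
      integrable_regularized hN hħ ha x (hP j) (n + 1, (j : ℕ)), ← integral_add
      (integrable_regularized hN hħ ha x hQ 0) (integrable_finsetSum _ fun (j : Fin (n + 1)) _ =>
        integrable_regularized hN hħ ha x (hP j) (n + 1, (j : ℕ)))]
    refine integral_congr_ae ?_
    filter_upwards [hinj] with v hv
    rw [levelPoly_add_two_mul_kernel hħ hn (crossNeZero_basePoint hħ ha v) hv, sum_range]
  have h2 : (Real.exp (x ⟨n, by omega⟩ - x ⟨n + 1, hn⟩) : ℂ) * moment ħ a (levelPoly a u n) x =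
      -∑ j : Fin (n + 1), ∫ v : GZIndex N → ℝ,
        levelPolyErase a u (n + 1) j (shiftEntry ħ ⟨⟨n + 1, hn⟩, j⟩ (basePoint ħ v)) *
          kernel ħ (n + 1, j) a x (shiftEntry ħ ⟨⟨n + 1, hn⟩, j⟩ (basePoint ħ v)) := by
    rw [moment, ← integral_const_mul, ← integral_finsetSum _ fun (j : Fin (n + 1)) _ =>
      integrable_regularized_shift hN hħ ha x (hP j) hn j.2, ← integral_neg]
    refine integral_congr_ae ?_
    filter_upwards [hinj] with v hv
    exact levelPoly_mul_kernel_eq_shift hħ hn (crossNeZero_basePoint hħ ha v) hv u x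
  rw [h1, h2, sub_neg_eq_add]
  congr 1
  exact sum_congr rfl fun j _ => integral_regularized_shift hN hħ ha x (hP j) hn j.2

/-! ### The Toda operators on moments -/

theorem todaA_zero (u : ℂ) (h : 0 ≤ N) : todaA ħ 0 h u = 1 := by
  simp [todaA, monodromy]

theorem todaA_one_apply (u : ℂ) (h : 1 ≤ N) (f : SmoothFn N) :
    todaA ħ 1 h u f = u • f - momentum ħ ⟨0, h⟩ f := by
  simp [todaA, monodromy, lax, Matrix.mul_apply, Fin.sum_univ_two]

theorem todaA_add_two_apply (u : ℂ) {m : ℕ} (h : m + 2 ≤ N) (f : SmoothFn N) :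
    todaA ħ (m + 2) h u f = u • todaA ħ (m + 1) (by omega) u f -
      momentum ħ ⟨m + 1, h⟩ (todaA ħ (m + 1) (by omega) u f) -
      mulExp (-1) ⟨m + 1, h⟩ (mulExp 1 ⟨m, by omega⟩ (todaA ħ m (by omega) u f)) := by
  have h1 : monodromy ħ u (m + 1) (by omega : m + 1 ≤ N) 1 0 =
      -mulExp 1 ⟨m, by omega⟩ * todaA ħ m (by omega) u := by
    simp [todaA, monodromy, lax, Matrix.mul_apply, Fin.sum_univ_two]
  have h2 : todaA ħ (m + 2) h u = (u • (1 : Module.End ℂ (SmoothFn N)) - momentum ħ ⟨m + 1, h⟩) *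
      todaA ħ (m + 1) (by omega) u + mulExp (-1) ⟨m + 1, h⟩ *
        monodromy ħ u (m + 1) (by omega : m + 1 ≤ N) 1 0 := by
    rw [todaA, monodromy, Matrix.mul_apply, Fin.sum_univ_two]
    rfl
  rw [h2, h1]
  simp [sub_eq_add_neg]

/-- The step is the recursion `A_{m+2} = (u - p_{m+2}) A_{m+1} - e^{x_{m+1} - x_{m+2}} A_m`, whose
image under the integral is `moment_levelPoly_add_two`. -/
theorem todaA_smoothMoment (hN : 1 ≤ N) (hħ : 0 < ħ) {a : Fin N → ℂ} (ha : a ∈ labelDomain N ħ)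
    (u : ℂ) (m : ℕ) (hm : m ≤ N) :
    todaA ħ m hm u (smoothMoment hN hħ ha (Subexponential.const 1)) =
      smoothMoment hN hħ ha (Subexponential.levelPoly a u m) := by
  induction m using Nat.twoStepInduction with
  | zero =>
    rw [todaA_zero]
    have h : levelPoly a u 0 = fun _ => 1 := by
      ext g
      simp [levelPoly]
    ext x
    simp [smoothMoment, h]
  | one =>
    rw [todaA_one_apply, momentum_smoothMoment]
    ext x
    change u * moment ħ a _ x - moment ħ a _ x = moment ħ a _ x
    rw [moment, moment, moment, ← integral_const_mul, ← integral_sub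
      ((integrable_moment hN hħ ha x (Subexponential.const 1)).const_mul u)
      (integrable_moment hN hħ ha x
        ((Subexponential.const 1).mul (Subexponential.momentumSymbol a _)))]
    congr 1
    ext v
    simp [levelPoly, momentumSymbol, levelSum]
    ring
  | more m ih1 ih2 =>
    rw [todaA_add_two_apply, ih1, ih2, momentum_smoothMoment]
    ext x
    change u * moment ħ a _ x - moment ħ a _ x - (Real.exp (-1 * x ⟨m + 1, hm⟩) : ℂ) *
      ((Real.exp (1 * x ⟨m, by omega⟩) : ℂ) * moment ħ a _ x) = moment ħ a _ x
    rw [moment_levelPoly_add_two hN hħ ha hm, ← mul_assoc, ← Complex.ofReal_mul, ← Real.exp_add]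
    have hL := Subexponential.levelPoly a u (m + 1)
    have h1 : moment ħ a (fun g => levelPoly a u (m + 1) g *
        (u - momentumSymbol a ⟨m + 1, hm⟩ g)) x = u * moment ħ a (levelPoly a u (m + 1)) x -
        moment ħ a (fun g => levelPoly a u (m + 1) g * momentumSymbol a ⟨m + 1, hm⟩ g) x := by
      rw [moment, moment, moment, ← integral_const_mul, ← integral_sub
        ((integrable_moment hN hħ ha x hL).const_mul u)
        (integrable_moment hN hħ ha x (hL.mul (Subexponential.momentumSymbol a _)))]
      congr 1
      ext v
      ring
    rw [h1]
    congr 3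
    ring_nf

/-! ### The shift of the label -/

/-- The label enters only the cross factors with level `n` and the plane wave: the former give `I ^
n` and the level polynomial by the functional equation, the latter `e^{x_N}`. -/
theorem kernel_update_label (hħ : 0 < ħ) {n : ℕ} {a : Fin (n + 1) → ℂ} {g : GZIndex (n + 1) → ℂ}
    (hg : CrossNeZero a g) (x : Fin (n + 1) → ℝ) (j : Fin (n + 1)) :
    kernel ħ 0 (Function.update a j (a j - Complex.I * ħ)) x g =
      Complex.I ^ n * (Real.exp (x ⟨n, n.lt_succ_self⟩) : ℂ) *
        (levelPoly a (a j) n g * kernel ħ 0 a x g) := by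
  have hħ' : (ħ : ℂ) ≠ 0 := by exact_mod_cast hħ.ne'
  set a' := Function.update a j (a j - Complex.I * ħ) with ha'
  have hsh : ∀ n' k, gzArray a' g n' k = gzArray a g n' k -
      if (n + 1, (j : ℕ)) = (n', k) then Complex.I * ħ else 0 := by
    intro n' k
    by_cases h : (n + 1, (j : ℕ)) = (n', k)
    · obtain ⟨rfl, rfl⟩ := Prod.mk.inj h
      rw [gzArray_top _ _ j.2, gzArray_top _ _ j.2, if_pos rfl]
      simp [ha']
    · rw [if_neg h, sub_zero]
      unfold gzArray
      split_ifs with h1 h2 h3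
      · rfl
      · rfl
      · refine Function.update_of_ne (fun h4 => h ?_) _ _
        exact Prod.ext h3.1.symm (congrArg Fin.val h4).symm
      · rfl
  have h1 : ∏ n' ∈ Ico 1 (n + 1), ∏ k ∈ range n', ∏ m ∈ range (n' + 1),
      crossFactor ħ 0 n' k (gzArray a' g n' k - gzArray a' g (n' + 1) m) =
      (∏ k ∈ range n, (-Complex.I * (gzArray a g n k - a j))) *
        ∏ n' ∈ Ico 1 (n + 1), ∏ k ∈ range n', ∏ m ∈ range (n' + 1),
          crossFactor ħ 0 n' k (gzArray a g n' k - gzArray a g (n' + 1) m) := by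
    rw [← prod_cross_ite_lower n.lt_succ_self j.2 fun k => -Complex.I * (gzArray a g n k - a j)]
    simp only [← prod_mul_distrib]
    refine prod_congr rfl fun n' hn' => prod_congr rfl fun k hk => prod_congr rfl fun m hm => ?_
    have hn'' := mem_Ico.1 hn'
    have hne : (n + 1, (j : ℕ)) ≠ (n', k) := fun h => by
      have := congrArg Prod.fst h; simp only at this; omega
    rw [crossFactor_zero (by omega), crossFactor_zero (by omega), hsh, hsh, if_neg hne, sub_zero]
    by_cases h3 : (n + 1, (j : ℕ)) = (n' + 1, m)
    · obtain ⟨h4, rfl⟩ := Prod.mk.inj h3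
      obtain rfl : n = n' := by omega
      rw [if_pos rfl, if_pos rfl, sub_sub_eq_add_sub, add_sub_right_comm,
        gammaFactor_add hħ (hg n hn' k hk j hm), gzArray_top _ _ j.2]
    · rw [if_neg h3, if_neg h3]
      simp
  have h2 : ∏ n' ∈ Ico 2 (n + 1), ∏ r ∈ range n', ∏ p ∈ range r,
      pairFactor ħ 0 n' p r (gzArray a' g n' p - gzArray a' g n' r) =
      ∏ n' ∈ Ico 2 (n + 1), ∏ r ∈ range n', ∏ p ∈ range r,
        pairFactor ħ 0 n' p r (gzArray a g n' p - gzArray a g n' r) := by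
    refine prod_congr rfl fun n' hn' => prod_congr rfl fun r hr => prod_congr rfl fun p hp => ?_
    have hn'' := mem_Ico.1 hn'
    have hne : ∀ k, (n + 1, (j : ℕ)) ≠ (n', k) := fun k h => by
      have := congrArg Prod.fst h; simp only at this; omega
    rw [hsh, hsh, if_neg (hne p), if_neg (hne r), sub_zero, sub_zero]
  have h3 : ∏ k ∈ range n, (-Complex.I * (gzArray a g n k - a j)) =
      Complex.I ^ n * levelPoly a (a j) n g := by
    have : Complex.I ^ n = ∏ _k ∈ range n, Complex.I := by simp
    rw [this, levelPoly, ← prod_mul_distrib]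
    exact prod_congr rfl fun k _ => by ring
  have hls : ∀ n', levelSum a' g n' = levelSum a g n' - if n + 1 = n' then Complex.I * ħ else 0 := by
    intro n'
    simp only [levelSum, hsh, sum_sub_distrib, Prod.mk.injEq]
    congr 1
    split_ifs with h
    · subst h
      simp [j.2]
    · simp [h]
  have h4 : waveExponent ħ a' x g = waveExponent ħ a x g + (x ⟨n, n.lt_succ_self⟩ : ℝ) := by
    have h5 : ∀ m : Fin (n + 1), (levelSum a' g ((m : ℕ) + 1) - levelSum a' g m) * (x m : ℂ) =
        (levelSum a g ((m : ℕ) + 1) - levelSum a g m) * (x m : ℂ) -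
          if (⟨n, n.lt_succ_self⟩ : Fin (n + 1)) = m then Complex.I * ħ * x m else 0 := by
      intro m
      rw [hls, hls, if_neg (by omega : ¬ n + 1 = (m : ℕ))]
      simp only [Nat.add_right_cancel_iff, Fin.ext_iff]
      split_ifs <;> ring
    rw [waveExponent, sum_congr rfl fun m _ => h5 m, sum_sub_distrib, waveExponent]
    simp only [sum_ite_eq, mem_univ, if_true]
    field_simp
    linear_combination -(ħ : ℂ) * (x ⟨n, n.lt_succ_self⟩ : ℂ) * Complex.I_sq
  rw [kernel, gzProd, kernel, gzProd, h1, h2, h3, h4, Complex.exp_add, Complex.ofReal_exp]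
  ring

/-- The identity of integrands is pointwise on one contour: lowering a label only moves the poles
further away, so nothing has to be shifted. -/
theorem moment_levelPoly_label (hN : 1 ≤ N) (hħ : 0 < ħ) {a : Fin N → ℂ} (ha : a ∈ labelDomain N ħ)
    (j : Fin N) (x : Fin N → ℝ) :
    moment ħ a (levelPoly a (a j) (N - 1)) x = Complex.I ^ (1 - (N : ℤ)) *
      (Real.exp (-x ⟨N - 1, Nat.sub_lt hN one_pos⟩) : ℂ) *
        moment ħ (Function.update a j (a j - Complex.I * ħ)) (fun _ => 1) x := by
  obtain ⟨n, rfl⟩ : ∃ n, N = n + 1 := ⟨N - 1, by omega⟩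
  rw [moment, moment, ← integral_const_mul]
  congr 1
  ext v
  rw [one_mul, kernel_update_label hħ (crossNeZero_basePoint hħ ha v)]
  have h1 : Complex.I ^ (1 - ((n + 1 : ℕ) : ℤ)) * Complex.I ^ n = 1 := by
    rw [← zpow_natCast, ← zpow_add₀ Complex.I_ne_zero]
    simp
  have h2 : (Real.exp (-x ⟨n + 1 - 1, Nat.sub_lt hN one_pos⟩) : ℂ) *
      (Real.exp (x ⟨n, n.lt_succ_self⟩) : ℂ) = 1 := by
    rw [← Complex.ofReal_mul, ← Real.exp_add]
    simp
  simp only [Nat.add_sub_cancel] at h2 ⊢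
  linear_combination -(levelPoly a (a j) n (basePoint ħ v) * kernel ħ 0 a x (basePoint ħ v)) *
    (h2 * (Complex.I ^ (1 - ((n + 1 : ℕ) : ℤ)) * Complex.I ^ n) + h1)

theorem moment_levelPoly_top {a : Fin N → ℂ} (u : ℂ) (x : Fin N → ℝ) :
    moment ħ a (levelPoly a u N) x = (∏ m, (u - a m)) * moment ħ a (fun _ => 1) x := by
  rw [moment, moment, ← integral_const_mul]
  congr 1
  ext v
  rw [levelPoly, prod_range, one_mul]
  congr 1
  exact prod_congr rfl fun m _ => by rw [gzArray_top _ _ m.2]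

theorem psi_eq_moment (hħ : 0 < ħ) (a : Fin N → ℂ) :
    psi ħ a = ((2 * Real.pi * ħ : ℝ) : ℂ) ^ N.choose 3 • moment ħ a fun _ => 1 := by
  ext x
  rw [psi_eq_integral_kernel hħ, Pi.smul_apply, smul_eq_mul, moment]
  simp only [one_mul]
  rfl

theorem integrable_pairingIntegrand (hN : 1 ≤ N) (hħ : 0 < ħ) {a : Fin N → ℂ}
    (ha : a ∈ labelDomain N ħ) (x : Fin N → ℝ) :
    Integrable (pairingIntegrand ħ (whittakerDual N) (cartanTorus ħ a x (whittaker ħ a))) := by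
  have h := (integrable_moment hN hħ ha x (Subexponential.const 1)).const_mul
    (((2 * Real.pi * ħ : ℝ) : ℂ) ^ N.choose 3)
  have h2 : Integrable fun v => Complex.exp (-((∑ k, x k * rho N k : ℝ) : ℂ)) *
      pairingIntegrand ħ (whittakerDual N) (cartanTorus ħ a x (whittaker ħ a)) v := by
    simp only [exp_mul_pairingIntegrand hħ]
    simp only [one_mul] at h
    exact h
  exact (integrable_const_mul_iff (Ne.isUnit (Complex.exp_ne_zero _)) _).1 h2

end TodaGZ

end

theorem mainTheorem4 (N : ℕ) (hN : 1 ≤ N) (ħ : ℝ) (hħ : 0 < ħ) :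
    -- the integral defining the matrix element converges absolutely
    (∀ a ∈ TodaGZ.labelDomain N ħ, ∀ x : Fin N → ℝ,
      MeasureTheory.Integrable
        (TodaGZ.pairingIntegrand ħ (TodaGZ.whittakerDual N)
          (TodaGZ.cartanTorus ħ a x (TodaGZ.whittaker ħ a)))
        MeasureTheory.volume) ∧
    -- it is holomorphic in the label, so that the shift operator is well defined
    (∀ x : Fin N → ℝ,
      DifferentiableOn ℂ (fun a : Fin N → ℂ => TodaGZ.psi ħ a x) (TodaGZ.labelDomain N ħ)) ∧
    ∀ a ∈ TodaGZ.labelDomain N ħ,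
      -- it is smooth in `x` and solves the system
      (∃ hs : TodaGZ.psi ħ a ∈ TodaGZ.SmoothFn N,
        (∀ (u : ℂ) (x : Fin N → ℝ),
          (TodaGZ.todaA ħ N le_rfl u ⟨TodaGZ.psi ħ a, hs⟩ : (Fin N → ℝ) → ℂ) x =
            (∏ m, (u - a m)) * TodaGZ.psi ħ a x) ∧
        (∀ (j : Fin N) (x : Fin N → ℝ),
          (TodaGZ.todaA ħ (N - 1) (Nat.sub_le N 1) (a j) ⟨TodaGZ.psi ħ a, hs⟩ :
              (Fin N → ℝ) → ℂ) x =
            Complex.I ^ (1 - (N : ℤ)) *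
              (Real.exp (-x ⟨N - 1, Nat.sub_lt hN one_pos⟩) : ℂ) *
              TodaGZ.psi ħ (Function.update a j (a j - Complex.I * ħ)) x)) ∧
      -- it is given by the Mellin-Barnes integral
      (∀ c : TodaGZ.GZIndex N → ℝ, TodaGZ.AdmissibleHeights a c → ∀ x : Fin N → ℝ,
        MeasureTheory.Integrable
          (fun v : TodaGZ.GZIndex N → ℝ =>
            TodaGZ.mellinBarnesIntegrand ħ a x (fun i => (v i : ℂ) + (c i : ℂ) * Complex.I))
          MeasureTheory.volume ∧
        TodaGZ.psi ħ a x =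
          ((2 * Real.pi * ħ : ℝ) : ℂ) ^ (N.choose 3) *
            ∫ v : TodaGZ.GZIndex N → ℝ,
              TodaGZ.mellinBarnesIntegrand ħ a x
                (fun i => (v i : ℂ) + (c i : ℂ) * Complex.I)) := by
  generalize hC : ((2 * Real.pi * ħ : ℝ) : ℂ) ^ N.choose 3 = C
  have hpsi : ∀ a, TodaGZ.psi ħ a = C • TodaGZ.moment (N := N) ħ a fun _ => 1 := fun a => by
    rw [TodaGZ.psi_eq_moment hħ, hC]
  refine ⟨fun a ha x => TodaGZ.integrable_pairingIntegrand hN hħ ha x,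
    TodaGZ.differentiableOn_psi hN hħ, fun a ha => ⟨?_, fun c hc x => ?_⟩⟩
  · have hs : TodaGZ.psi ħ a ∈ TodaGZ.SmoothFn N := by
      rw [hpsi]
      exact (TodaGZ.SmoothFn N).smul_mem C
        (TodaGZ.contDiff_moment hN hħ ha (TodaGZ.Subexponential.const 1))
    have hf : (⟨TodaGZ.psi ħ a, hs⟩ : TodaGZ.SmoothFn N) =
        C • TodaGZ.smoothMoment hN hħ ha (TodaGZ.Subexponential.const 1) :=
      Subtype.ext (hpsi a)
    have hA : ∀ (m : ℕ) (hm : m ≤ N) (u : ℂ) (x : Fin N → ℝ),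
        (TodaGZ.todaA ħ m hm u ⟨TodaGZ.psi ħ a, hs⟩ : (Fin N → ℝ) → ℂ) x =
          C * TodaGZ.moment ħ a (TodaGZ.levelPoly a u m) x := by
      intro m hm u x
      rw [hf, map_smul, TodaGZ.todaA_smoothMoment]
      rfl
    refine ⟨hs, fun u x => ?_, fun j x => ?_⟩
    · rw [hA, TodaGZ.moment_levelPoly_top, hpsi, Pi.smul_apply, smul_eq_mul]
      ring
    · rw [hA, TodaGZ.moment_levelPoly_label hN hħ ha, hpsi, Pi.smul_apply, smul_eq_mul]
      ring
  · have hreg := TodaGZ.mem_regularHeights_of_admissible (ħ := ħ) hc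
    have h1 := TodaGZ.integrable_mul_kernel hN hħ x (TodaGZ.Subexponential.const 1) hreg
    -- The base contour and any admissible one lie in the same convex set of regular heights.
    have h2 := TodaGZ.integral_mul_kernel_shift hN hħ x (TodaGZ.Subexponential.const 1)
      (TodaGZ.baseHeight_mem_regularHeights hħ ha 0) hreg
    simp only [one_mul] at h1 h2
    simp only [TodaGZ.mellinBarnesIntegrand_eq_kernel hħ]
    refine ⟨h1, ?_⟩
    rw [TodaGZ.psi_eq_integral_kernel hħ, hC, h2]
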